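/- There are an algorithm and a constant $C$ such that the following holds. Let $G=(V,E)$ be a simple directed graph with $n$ vertices, $m$ edges and edge weights $w:E\to\mathbb{R}_{\ge 0}$, and let $F$ be an elimination forest of $G$, that is, a rooted forest on $V$ such that for every edge $uv\in E$ one of $u,v$ is an ancestor of the other; let $k$ be its depth, the maximum number of vertices on a path from a root to a leaf. Given $G$ (as a list of weighted edges) and $F$ (by its parent pointers), the algorithm constructs, in time at most $C\,(k(m+n\log n)+1)$ (that is, $O(k(m+n\log n))$ when $n\ge 2$), a 2-hop cover of $G$ of maximum label size at most $2k$. Here time is the number of steps on a unit-cost random access machine which handles nonnegative real numbers only by addition and comparison, and its integers only by successor, predecessor, comparison and array indexing. A 2-hop cover consists of finite sets $L^+(u),L^-(u)\subseteq V\times\mathbb{R}_{\ge 0}$ for $u\in V$ such that for all $s,t\in V$ the shortest-path distance from $s$ to $t$ in $G$ is the minimum of $a+b$ over all $(h,a)\in L^+(s)$ and $(h,b)\in L^-(t)$ (with $\min\emptyset=\infty$, the distance if $t$ is not reachable from $s$); its maximum label size is $\max_{u\in V}(|L^+(u)|+|L^-(u)|)$. Moreover, for every $u\in V$, the set $L^+(u)$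 (respectively $L^-(u)$) of the constructed cover consists exactly of the pairs $(h,d)$ such that $h$ is $u$ or an ancestor of $u$ in $F$ and $d<\infty$ is the shortest-path distance from $u$ to $h$ (respectively from $h$ to $u$) in the subgraph of $G$ induced by the vertices of the subtree of $F$ rooted at $h$. -/

import Mathlib

open scoped NNReal ENNReal

namespace TwoHop

/-! ### Machine model

A unit-cost random access machine with two separate kinds of memory: natural numbers (used for
counters and as array indices) and nonnegative reals.  The only operations on natural numbers are
literals, successor, truncated predecessor and comparison, so that a number produced within `t`
steps exceeds the numbers in the input by at most `O(t)`.  The only operations on reals are zero,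
addition and comparison; a real can neither be converted to a natural number nor used as an
index.  Programs are finite structured programs. -/

/-- Memory: scalar variables and arrays, indexed by their names, for naturals (`nv`, `na`) and for
nonnegative reals (`rv`, `ra`); `na a i` is the `i`-th cell of the array `a`. -/
structure State where
  nv : ℕ → ℕ
  na : ℕ → ℕ → ℕ
  rv : ℕ → ℝ≥0
  ra : ℕ → ℕ → ℝ≥0

/-- Expressions with values in the natural numbers. -/
inductive NExpr where
  | lit (c : ℕ)
  | var (x : ℕ)
  | arr (a : ℕ) (i : NExpr)
  | succ (e : NExpr)
  | pred (e : NExpr)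

/-- The value of an expression; `pred` of zero is zero. -/
def NExpr.eval (s : State) : NExpr → ℕ
  | .lit c => c
  | .var x => s.nv x
  | .arr a i => s.na a (i.eval s)
  | .succ e => e.eval s + 1
  | .pred e => e.eval s - 1

/-- Expressions with values in the nonnegative reals. -/
inductive RExpr where
  | zero
  | var (x : ℕ)
  | arr (a : ℕ) (i : NExpr)
  | add (e f : RExpr)

noncomputable def RExpr.eval (s : State) : RExpr → ℝ≥0
  | .zero => 0
  | .var x => s.rv x
  | .arr a i => s.ra a (i.eval s)
  | .add e f => e.eval s + f.eval s

/-- Tests for branching. -/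
inductive Test where
  | neq (e f : NExpr)
  | nle (e f : NExpr)
  | rle (e f : RExpr)
  | not (b : Test)
  | and (b c : Test)
  | or (b c : Test)

/-- `neq` tests equality of two naturals; `nle`, `rle` test `≤` of naturals and of reals. -/
def Test.Holds (s : State) : Test → Prop
  | .neq e f => e.eval s = f.eval s
  | .nle e f => e.eval s ≤ f.eval s
  | .rle e f => e.eval s ≤ f.eval s
  | .not b => ¬ b.Holds s
  | .and b c => b.Holds s ∧ c.Holds s
  | .or b c => b.Holds s ∨ c.Holds s

/-- Programs: assignments to natural and real scalars (`nset`, `rset`) and array cells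
(`nput a i e` and `rput a i e` store the value of `e` in cell `i` of array `a`),
sequencing, branching and while-loops. -/
inductive Prog where
  | skip
  | nset (x : ℕ) (e : NExpr)
  | nput (a : ℕ) (i e : NExpr)
  | rset (x : ℕ) (e : RExpr)
  | rput (a : ℕ) (i : NExpr) (e : RExpr)
  | seq (p q : Prog)
  | cond (b : Test) (p q : Prog)
  | loop (b : Test) (p : Prog)

/-- `Runs p s s' t`: started in the state `s`, the program `p` halts in the state `s'` after `t`
steps.  Every execution of an assignment, of `skip` and of a test is one step (the expressions in
a fixed program have bounded size, so this is their cost up to a constant factor). -/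
inductive Runs : Prog → State → State → ℕ → Prop
  | skip (s : State) : Runs .skip s s 1
  | nset (s : State) (x : ℕ) (e : NExpr) :
      Runs (.nset x e) s { s with nv := Function.update s.nv x (e.eval s) } 1
  | nput (s : State) (a : ℕ) (i e : NExpr) :
      Runs (.nput a i e) s
        { s with na := Function.update s.na a
                  (Function.update (s.na a) (i.eval s) (e.eval s)) } 1
  | rset (s : State) (x : ℕ) (e : RExpr) :
      Runs (.rset x e) s { s with rv := Function.update s.rv x (e.eval s) } 1
  | rput (s : State) (a : ℕ) (i : NExpr) (e : RExpr) :
      Runs (.rput a i e) s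
        { s with ra := Function.update s.ra a
                  (Function.update (s.ra a) (i.eval s) (e.eval s)) } 1
  | seq {p q : Prog} {s s' s'' : State} {t t' : ℕ}
      (hp : Runs p s s' t) (hq : Runs q s' s'' t') : Runs (.seq p q) s s'' (t + t')
  | cond_true {b : Test} {p q : Prog} {s s' : State} {t : ℕ}
      (hb : b.Holds s) (hp : Runs p s s' t) : Runs (.cond b p q) s s' (t + 1)
  | cond_false {b : Test} {p q : Prog} {s s' : State} {t : ℕ}
      (hb : ¬ b.Holds s) (hq : Runs q s s' t) : Runs (.cond b p q) s s' (t + 1)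
  | loop_false {b : Test} {p : Prog} {s : State}
      (hb : ¬ b.Holds s) : Runs (.loop b p) s s 1
  | loop_true {b : Test} {p : Prog} {s s' s'' : State} {t t' : ℕ}
      (hb : b.Holds s) (hp : Runs p s s' t) (hl : Runs (.loop b p) s' s'' t') :
      Runs (.loop b p) s s'' (t + 1 + t')

/-! ### Weighted directed graphs and elimination forests -/

/-- A simple directed graph on the vertices `0, …, n - 1` with `m` edges, listed in some order,
and nonnegative edge weights.  Opposite edges `uv`, `vu` may both be present. -/
structure WDigraph (n m : ℕ) where
  src : Fin m → Fin n
  dst : Fin m → Fin n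
  weight : Fin m → ℝ≥0
  no_loops : ∀ e, src e ≠ dst e
  no_multi : ∀ e f, src e = src f → dst e = dst f → e = f

/-- `G.WalkIn S u v d`: there is a directed walk from `u` to `v` of total weight `d` in the
subgraph of `G` induced by `S`. -/
inductive WDigraph.WalkIn {n m : ℕ} (G : WDigraph n m) (S : Set (Fin n)) :
    Fin n → Fin n → ℝ≥0 → Prop
  | nil {u : Fin n} (hu : u ∈ S) : G.WalkIn S u u 0
  | cons {u v w : Fin n} {d : ℝ≥0} (e : Fin m) (hu : u ∈ S)
      (hs : G.src e = u) (hd : G.dst e = v) (h : G.WalkIn S v w d) :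
      G.WalkIn S u w (G.weight e + d)

/-- The shortest-path distance from `u` to `v` in the subgraph induced by `S`; it is `∞` if `v`
cannot be reached from `u`.  As weights are nonnegative, walks give the same as paths. -/
noncomputable def WDigraph.distIn {n m : ℕ} (G : WDigraph n m) (S : Set (Fin n))
    (u v : Fin n) : ℝ≥0∞ :=
  ⨅ (d : ℝ≥0) (_ : G.WalkIn S u v d), (d : ℝ≥0∞)

/-- The shortest-path distance in `G`. -/
noncomputable def WDigraph.dist {n m : ℕ} (G : WDigraph n m) (u v : Fin n) : ℝ≥0∞ :=
  G.distIn Set.univ u v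

/-- `IsAncestor parent a v`: `a` lies on the path from `v` to its root (`a = v` is allowed). -/
def IsAncestor {n : ℕ} (parent : Fin n → Option (Fin n)) (a v : Fin n) : Prop :=
  Relation.ReflTransGen (fun x y => parent x = some y) v a

/-- An elimination forest of `G`: a rooted forest on the vertex set of `G`, given by the parent
function (`none` for roots), such that the ends of each edge are in the ancestor relation. -/
structure ElimForest {n m : ℕ} (G : WDigraph n m) where
  parent : Fin n → Option (Fin n)
  acyclic : ∀ v, ¬ Relation.TransGen (fun x y => parent x = some y) v v
  edge : ∀ e, IsAncestor parent (G.src e) (G.dst e) ∨ IsAncestor parent (G.dst e) (G.src e)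

/-- The vertices on the path from `v` to its root, including both ends. -/
def ElimForest.rootPath {n m : ℕ} {G : WDigraph n m} (F : ElimForest G) (v : Fin n) :
    Set (Fin n) :=
  {a | IsAncestor F.parent a v}

/-- The vertices of the subtree rooted at `a`, including `a`. -/
def ElimForest.subtree {n m : ℕ} {G : WDigraph n m} (F : ElimForest G) (a : Fin n) :
    Set (Fin n) :=
  {v | IsAncestor F.parent a v}

/-- The depth: the maximum number of vertices on a path from a vertex to its root. -/
noncomputable def ElimForest.depth {n m : ℕ} {G : WDigraph n m} (F : ElimForest G) : ℕ :=
  Finset.univ.sup fun v => (F.rootPath v).ncard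

/-! ### 2-hop covers -/

/-- `(Lout, Lin)` is a 2-hop cover of `G`: for all `s`, `t` the distance from `s` to `t` is the
minimum of `a + b` over all `(h, a) ∈ Lout s` and `(h, b) ∈ Lin t`
(`∞` if there is no common hub `h`). -/
def IsTwoHopCover {n m : ℕ} (G : WDigraph n m) (Lout Lin : Fin n → Finset (Fin n × ℝ≥0)) :
    Prop :=
  ∀ s t, G.dist s t =
    ⨅ (h : Fin n) (a : ℝ≥0) (b : ℝ≥0) (_ : (h, a) ∈ Lout s) (_ : (h, b) ∈ Lin t),
      ((a + b : ℝ≥0) : ℝ≥0∞)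

/-- The maximum label size. -/
def maxLabelSize {n : ℕ} (Lout Lin : Fin n → Finset (Fin n × ℝ≥0)) : ℕ :=
  Finset.univ.sup fun u => (Lout u).card + (Lin u).card

/-! ### Input and output -/

/-- The function on `ℕ` that agrees with `f` on `Fin n` and is `z` elsewhere. -/
def extend {n : ℕ} {α : Type} (z : α) (f : Fin n → α) (i : ℕ) : α :=
  if h : i < n then f ⟨i, h⟩ else z

/-- The initial memory.  Scalars `0`, `1` hold `n`, `m`; array `0` of naturals holds the parents
(`n` for a root), arrays `1`, `2` the tails and heads of the edges; array `0` of reals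
holds the weights.  Everything else is zero. -/
def input {n m : ℕ} (G : WDigraph n m) (F : ElimForest G) : State where
  nv x := if x = 0 then n else if x = 1 then m else 0
  na a :=
    if a = 0 then extend 0 fun v => ((F.parent v).map Fin.val).getD n
    else if a = 1 then extend 0 fun e => (G.src e : ℕ)
    else if a = 2 then extend 0 fun e => (G.dst e : ℕ)
    else fun _ => 0
  rv _ := 0
  ra a := if a = 0 then extend 0 G.weight else fun _ => 0

/-- The label family `L` is stored in the arrays `lo`, `hi`, `hub` of naturals and `val` of reals:
the cells `lo[u] ≤ i < hi[u]` of `hub` and `val` list the pairs in `L u`, each exactly once. -/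
def Stores {n : ℕ} (s : State) (lo hi hub val : ℕ) (L : Fin n → Finset (Fin n × ℝ≥0)) : Prop :=
  ∀ u : Fin n,
    (((List.Ico (s.na lo u) (s.na hi u)).map fun i => (s.na hub i, s.ra val i) :
        List (ℕ × ℝ≥0)) : Multiset (ℕ × ℝ≥0)) =
      (L u).val.map fun p => ((p.1 : ℕ), p.2)

end TwoHop

namespace TwoHop

/-! ### Weakest preconditions with a step counter -/

/-! The cover rests on one fact about elimination forests (`ElimForest.exists_hub`): every walk
passes through a vertex `h` that is an ancestor of all its vertices. Cutting a walk at `h` leaves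
two walks inside the subtree of `h`, so the distances to and from ancestors, measured inside the
ancestors' subtrees, form a 2-hop cover. A vertex has at most `k` ancestors, hence at most `k`
entries in each of its two labels.

The labels come from Dijkstra searches from every vertex `h`, once in the graph and once in its
reverse. Since the ends of an edge are comparable, a walk from `h` stays in the subtree of `h`
exactly when it never visits a level above that of `h` (`ElimForest.mem_subtree_iff`); restricting a
search to the subtree costs one comparison of depths per edge. A vertex is settled only in the
searches from its ancestors, at most `k` times altogether. Charging each search to the vertices that
it settles gives `k` times the sum over `u` of a logarithm plus the out-degree of `u` (`sum_logFor`,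
`sum_map_item`, `phase_spec`). This needs searches without a linear initialization: queue nodes are
numbered by a counter that is never reset, and a vertex counts as labelled when its node is newer
than the start of the current search.

The queue must decrease keys in amortized constant time, and a hollow heap does so: the old node of
the item stays behind as a hollow node with its first two children, and a fresh root takes the
others. Each node of rank `r ≥ 2` thus keeps children of ranks `r - 1` and `r - 2`, which forces
ranks to be logarithmic in the number of nodes (`HeapInv.pow_rank_le`). The amortization is a
potential added to the step counter: 50 per node, 30 per pending root, 15 per occupied slot.

Programs are analysed by weakest preconditions that carry the step counter, so correctness,
termination and running time are proved by the same invariants. -/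

/-- Assignment to a scalar variable of the naturals. -/
def State.setN (s : State) (x v : ℕ) : State := { s with nv := Function.update s.nv x v }

/-- Assignment to an array cell of the naturals. -/
def State.putN (s : State) (a i v : ℕ) : State :=
  { s with na := Function.update s.na a (Function.update (s.na a) i v) }

/-- Assignment to a scalar variable of the reals. -/
def State.setR (s : State) (x : ℕ) (v : ℝ≥0) : State :=
  { s with rv := Function.update s.rv x v }

/-- Assignment to an array cell of the reals. -/
def State.putR (s : State) (a i : ℕ) (v : ℝ≥0) : State :=
  { s with ra := Function.update s.ra a (Function.update (s.ra a) i v) }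

section projections
variable (s : State) (x y a b i v : ℕ) (d : ℝ≥0)

@[simp] theorem setN_nv : (s.setN x v).nv y = if y = x then v else s.nv y := by
  simp [State.setN, Function.update_apply]
@[simp] theorem setN_na : (s.setN x v).na = s.na := rfl
@[simp] theorem setN_rv : (s.setN x v).rv = s.rv := rfl
@[simp] theorem setN_ra : (s.setN x v).ra = s.ra := rfl
@[simp] theorem putN_nv : (s.putN a i v).nv = s.nv := rfl
@[simp] theorem putN_na : (s.putN a i v).na b =
    if b = a then Function.update (s.na a) i v else s.na b := by
  by_cases h : b = a
  · subst h; simp [State.putN]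
  · simp [State.putN, h]
@[simp] theorem putN_rv : (s.putN a i v).rv = s.rv := rfl
@[simp] theorem putN_ra : (s.putN a i v).ra = s.ra := rfl
@[simp] theorem setR_nv : (s.setR x d).nv = s.nv := rfl
@[simp] theorem setR_na : (s.setR x d).na = s.na := rfl
@[simp] theorem setR_rv : (s.setR x d).rv y = if y = x then d else s.rv y := by
  simp [State.setR, Function.update_apply]
@[simp] theorem setR_ra : (s.setR x d).ra = s.ra := rfl
@[simp] theorem putR_nv : (s.putR a i d).nv = s.nv := rfl
@[simp] theorem putR_na : (s.putR a i d).na = s.na := rfl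
@[simp] theorem putR_rv : (s.putR a i d).rv = s.rv := rfl
@[simp] theorem putR_ra : (s.putR a i d).ra b =
    if b = a then Function.update (s.ra a) i d else s.ra b := by
  by_cases h : b = a
  · subst h; simp [State.putR]
  · simp [State.putR, h]

end projections

attribute [simp] NExpr.eval RExpr.eval Test.Holds

/-- `wp p Q s c`: started in `s` with the step counter at `c`, the program `p` halts with a state
and a counter satisfying `Q`. -/
def wp (p : Prog) (Q : State → ℕ → Prop) (s : State) (c : ℕ) : Prop :=
  ∃ s' t, Runs p s s' t ∧ Q s' (c + t)

section rules
variable {p q : Prog} {b : Test} {Q : State → ℕ → Prop} {s : State} {c : ℕ}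

-- Stated as equivalences for `simp`, these rules turn straight-line code into an assertion about an
-- explicitly updated state and counter; only loops need an invariant.
@[simp] theorem wp_skip : wp .skip Q s c ↔ Q s (c + 1) := by
  constructor
  · rintro ⟨s', t, h, hQ⟩; cases h; exact hQ
  · exact fun h => ⟨_, _, .skip s, h⟩

@[simp] theorem wp_nset {x : ℕ} {e : NExpr} :
    wp (.nset x e) Q s c ↔ Q (s.setN x (e.eval s)) (c + 1) := by
  constructor
  · rintro ⟨s', t, h, hQ⟩; cases h; exact hQ
  · exact fun h => ⟨_, _, .nset s x e, h⟩

@[simp] theorem wp_nput {a : ℕ} {i e : NExpr} :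
    wp (.nput a i e) Q s c ↔ Q (s.putN a (i.eval s) (e.eval s)) (c + 1) := by
  constructor
  · rintro ⟨s', t, h, hQ⟩; cases h; exact hQ
  · exact fun h => ⟨_, _, .nput s a i e, h⟩

@[simp] theorem wp_rset {x : ℕ} {e : RExpr} :
    wp (.rset x e) Q s c ↔ Q (s.setR x (e.eval s)) (c + 1) := by
  constructor
  · rintro ⟨s', t, h, hQ⟩; cases h; exact hQ
  · exact fun h => ⟨_, _, .rset s x e, h⟩

@[simp] theorem wp_rput {a : ℕ} {i : NExpr} {e : RExpr} :
    wp (.rput a i e) Q s c ↔ Q (s.putR a (i.eval s) (e.eval s)) (c + 1) := by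
  constructor
  · rintro ⟨s', t, h, hQ⟩; cases h; exact hQ
  · exact fun h => ⟨_, _, .rput s a i e, h⟩

@[simp] theorem wp_seq : wp (.seq p q) Q s c ↔ wp p (wp q Q) s c := by
  constructor
  · rintro ⟨s', t, h, hQ⟩
    cases h with
    | seq hp hq => exact ⟨_, _, hp, _, _, hq, by rwa [add_assoc]⟩
  · rintro ⟨s', t, hp, s'', t', hq, hQ⟩
    exact ⟨_, _, .seq hp hq, by rwa [← add_assoc]⟩

@[simp] theorem wp_cond : wp (.cond b p q) Q s c ↔
    (b.Holds s → wp p Q s (c + 1)) ∧ (¬ b.Holds s → wp q Q s (c + 1)) := by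
  constructor
  · rintro ⟨s', t, h, hQ⟩
    cases h with
    | cond_true hb hp =>
      exact ⟨fun _ => ⟨_, _, hp, by rwa [add_assoc, add_comm 1]⟩, fun h => absurd hb h⟩
    | cond_false hb hp =>
      exact ⟨fun h => absurd h hb, fun _ => ⟨_, _, hp, by rwa [add_assoc, add_comm 1]⟩⟩
  · rintro ⟨h1, h2⟩
    by_cases hb : b.Holds s
    · obtain ⟨s', t, hp, hQ⟩ := h1 hb
      exact ⟨_, _, .cond_true hb hp, by rwa [add_comm t, ← add_assoc]⟩
    · obtain ⟨s', t, hp, hQ⟩ := h2 hb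
      exact ⟨_, _, .cond_false hb hp, by rwa [add_comm t, ← add_assoc]⟩

end rules

/-! ### Frames -/

/-- The scalar variables of the naturals that a program may write. -/
def Prog.nvWrites : Prog → List ℕ
  | .nset x _ => [x]
  | .seq p q => p.nvWrites ++ q.nvWrites
  | .cond _ p q => p.nvWrites ++ q.nvWrites
  | .loop _ p => p.nvWrites
  | _ => []

/-- The arrays of naturals that a program may write. -/
def Prog.naWrites : Prog → List ℕ
  | .nput a _ _ => [a]
  | .seq p q => p.naWrites ++ q.naWrites
  | .cond _ p q => p.naWrites ++ q.naWrites
  | .loop _ p => p.naWrites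
  | _ => []

/-- The arrays of reals that a program may write. -/
def Prog.raWrites : Prog → List ℕ
  | .rput a _ _ => [a]
  | .seq p q => p.raWrites ++ q.raWrites
  | .cond _ p q => p.raWrites ++ q.raWrites
  | .loop _ p => p.raWrites
  | _ => []

/-- `s'` differs from `s` only in memory that `p` may write. -/
structure Frame (p : Prog) (s s' : State) : Prop where
  nv : ∀ x, x ∉ p.nvWrites → s'.nv x = s.nv x
  na : ∀ a, a ∉ p.naWrites → s'.na a = s.na a
  ra : ∀ a, a ∉ p.raWrites → s'.ra a = s.ra a

theorem Frame.refl (p : Prog) (s : State) : Frame p s s :=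
  ⟨fun _ _ => rfl, fun _ _ => rfl, fun _ _ => rfl⟩

theorem Frame.trans {p : Prog} {s s' s'' : State} (h : Frame p s s') (h' : Frame p s' s'') :
    Frame p s s'' :=
  ⟨fun x hx => (h'.nv x hx).trans (h.nv x hx), fun x hx => (h'.na x hx).trans (h.na x hx),
    fun x hx => (h'.ra x hx).trans (h.ra x hx)⟩

theorem Frame.mono {p q : Prog} {s s' : State} (h : Frame p s s')
    (h1 : p.nvWrites ⊆ q.nvWrites) (h2 : p.naWrites ⊆ q.naWrites)
    (h3 : p.raWrites ⊆ q.raWrites) : Frame q s s' :=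
  ⟨fun x hx => h.nv x fun h => hx (h1 h), fun x hx => h.na x fun h => hx (h2 h),
    fun x hx => h.ra x fun h => hx (h3 h)⟩

/-- Real scalars need no tracking: the only one used by the algorithm is `rD`, which is rewritten
before every use. -/
theorem Runs.frame {p : Prog} {s s' : State} {t : ℕ} (h : Runs p s s' t) : Frame p s s' := by
  induction h with
  | skip s => exact .refl _ _
  | nset s x e =>
    refine ⟨fun y hy => ?_, fun _ _ => rfl, fun _ _ => rfl⟩
    exact Function.update_of_ne (by simpa [Prog.nvWrites] using hy) _ _
  | nput s a i e =>
    refine ⟨fun _ _ => rfl, fun y hy => ?_, fun _ _ => rfl⟩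
    exact Function.update_of_ne (by simpa [Prog.naWrites] using hy) _ _
  | rset s x e => exact ⟨fun _ _ => rfl, fun _ _ => rfl, fun _ _ => rfl⟩
  | rput s a i e =>
    refine ⟨fun _ _ => rfl, fun _ _ => rfl, fun y hy => ?_⟩
    exact Function.update_of_ne (by simpa [Prog.raWrites] using hy) _ _
  | seq _ _ h1 h2 =>
    exact (h1.mono (List.subset_append_left _ _) (List.subset_append_left _ _)
      (List.subset_append_left _ _)).trans (h2.mono (List.subset_append_right _ _)
      (List.subset_append_right _ _) (List.subset_append_right _ _))
  | cond_true _ _ h =>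
    exact h.mono (List.subset_append_left _ _) (List.subset_append_left _ _)
      (List.subset_append_left _ _)
  | cond_false _ _ h =>
    exact h.mono (List.subset_append_right _ _) (List.subset_append_right _ _)
      (List.subset_append_right _ _)
  | loop_false _ => exact .refl _ _
  | loop_true _ _ _ h1 h2 => exact Frame.trans ⟨h1.nv, h1.na, h1.ra⟩ h2

/-- The frame of `p` comes for free, so specifications mention only the memory that changes; for
concrete programs untouched memory is then recovered by `decide`. -/
theorem wp_conseq {p : Prog} {Q Q' : State → ℕ → Prop} {s : State} {c : ℕ} (h : wp p Q s c)
    (hQ : ∀ s' c', Frame p s s' → Q s' c' → Q' s' c') : wp p Q' s c := by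
  obtain ⟨s', t, hr, hq⟩ := h
  exact ⟨s', t, hr, hQ _ _ hr.frame hq⟩

/-- The rule for loops: the invariant bounds the step counter, which forces termination. -/
theorem wp_loop {b : Test} {p : Prog} {Q : State → ℕ → Prop} {s : State} {c : ℕ}
    (I : State → ℕ → Prop) (T : ℕ) (h0 : I s c)
    (hT : ∀ s' c', I s' c' → c' ≤ T)
    (hstep : ∀ s' c', Frame p s s' → I s' c' → b.Holds s' → wp p I s' (c' + 1))
    (hpost : ∀ s' c', Frame p s s' → I s' c' → ¬ b.Holds s' → Q s' (c' + 1)) :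
    wp (.loop b p) Q s c := by
  suffices H : ∀ k s' c', T - c' < k → Frame p s s' → I s' c' → wp (.loop b p) Q s' c' from
    H (T - c + 1) s c (Nat.lt_succ_self _) (.refl _ _) h0
  intro k
  induction k with
  | zero => intro s' c' hk; omega
  | succ k ih =>
    intro s' c' hk hf hI
    by_cases hb : b.Holds s'
    · obtain ⟨s1, t, hr, hI1⟩ := hstep s' c' hf hI hb
      have h1 := hT _ _ hI1
      obtain ⟨s2, t2, hr2, hQ2⟩ := ih s1 (c' + 1 + t) (by omega) (hf.trans hr.frame) hI1
      exact ⟨s2, t + 1 + t2, .loop_true hb hr hr2, by convert hQ2 using 1; ring⟩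
    · exact ⟨s', 1, .loop_false hb, hpost _ _ hf hI hb⟩

/-- Sequencing of programs. -/
infixr:60 " ;; " => Prog.seq

/-! ### Hollow heaps -/

/-- The list `[r - 1, …, 1, 0]`. -/
def down : ℕ → List ℕ
  | 0 => []
  | r + 1 => r :: down r

@[simp] theorem length_down (r : ℕ) : (down r).length = r := by
  induction r with
  | zero => rfl
  | succ r ih => simp [down, ih]

theorem drop_two_down (r : ℕ) : (down r).drop 2 = down (r - 1 - 1) := by
  match r with
  | 0 => rfl
  | 1 => rfl
  | r + 2 => rfl

theorem mem_down {i r : ℕ} : i ∈ down r ↔ i < r := by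
  induction r with
  | zero => simp [down]
  | succ r ih => simp [down, ih]; omega

/-- `Seg next c l`: following the pointers `next` from `c` one meets the members of `l`. -/
def Seg (next : ℕ → ℕ) : ℕ → List ℕ → Prop
  | _, [] => True
  | c, a :: l => c = a ∧ Seg next (next a) l

theorem Seg.congr {f g : ℕ → ℕ} {l : List ℕ} {c : ℕ} (h : Seg f c l) (hfg : ∀ a ∈ l, g a = f a) :
    Seg g c l := by
  induction l generalizing c with
  | nil => trivial
  | cons a l ih =>
    refine ⟨h.1, ?_⟩
    rw [hfg a (by simp)]
    exact ih h.2 fun b hb => hfg b (by simp [hb])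

theorem Seg.take {f : ℕ → ℕ} {l : List ℕ} {c : ℕ} (h : Seg f c l) (k : ℕ) :
    Seg f c (l.take k) := by
  induction l generalizing c k with
  | nil => simp [Seg]
  | cons a l ih =>
    cases k with
    | zero => simp [Seg]
    | succ k => exact ⟨h.1, ih h.2 k⟩

/-- Segments have no terminator; the rank tells their length. Hence a child list can be split after
two members without writing a pointer, and for shorter lists the arbitrary starting pointer is
harmless. -/
theorem Seg.drop_two {f : ℕ → ℕ} {l : List ℕ} {c : ℕ} (h : Seg f c l) :
    Seg f (f (f c)) (l.drop 2) := by
  match l, h with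
  | [], _ => trivial
  | [a], _ => trivial
  | a :: b :: l, ⟨h1, h2, h3⟩ => subst h1; subst h2; exact h3

/-- The heap occupies the nodes `H`, its roots are `R`, and `kids x` are the children of `x`.
The node `x` is full if `node (item x) = x` and hollow otherwise.  A full node of rank `r` has
children of ranks `r - 1, …, 0`, a hollow one has kept only the first two of these. -/
structure HeapInv (rank fc ns item node : ℕ → ℕ) (key : ℕ → ℝ≥0) (kids : ℕ → List ℕ)
    (H R : Multiset ℕ) : Prop where
  nodup : H.Nodup
  eq : H = R + H.bind fun x => (kids x : Multiset ℕ)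
  seg : ∀ x ∈ H, Seg ns (fc x) (kids x)
  full : ∀ x ∈ H, node (item x) = x → (kids x).map rank = down (rank x)
  hollow : ∀ x ∈ H, node (item x) ≠ x → (kids x).map rank = (down (rank x)).take 2
  key_le : ∀ x ∈ H, ∀ y ∈ kids x, key x ≤ key y
  pos : 0 ∉ H

/-! ### Ranks and keys in a hollow heap, and the effect of the heap operations -/

namespace HeapInv

variable {rank fc ns item node : ℕ → ℕ} {key : ℕ → ℝ≥0} {kids : ℕ → List ℕ} {H R : Multiset ℕ}

theorem mem_of_root (h : HeapInv rank fc ns item node key kids H R) {x : ℕ} (hx : x ∈ R) :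
    x ∈ H := by
  rw [h.eq]; exact Multiset.mem_add.2 (.inl hx)

theorem mem_of_kid (h : HeapInv rank fc ns item node key kids H R) {x y : ℕ} (hx : x ∈ H)
    (hy : y ∈ kids x) : y ∈ H := by
  rw [h.eq]; exact Multiset.mem_add.2 (.inr (Multiset.mem_bind.2 ⟨x, hx, by simpa using hy⟩))

theorem root_not_kid (h : HeapInv rank fc ns item node key kids H R) {x y : ℕ} (hx : x ∈ H)
    (hy : y ∈ R) : y ∉ kids x := by
  intro hk
  have := h.nodup
  rw [h.eq, Multiset.nodup_add] at this
  exact Multiset.disjoint_left.1 this.2.2 hy (Multiset.mem_bind.2 ⟨x, hx, by simpa using hk⟩)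

theorem nodup_roots (h : HeapInv rank fc ns item node key kids H R) : R.Nodup := by
  have := h.nodup
  rw [h.eq, Multiset.nodup_add] at this
  exact this.1

theorem rank_kid_lt (h : HeapInv rank fc ns item node key kids H R) {x y : ℕ} (hx : x ∈ H)
    (hy : y ∈ kids x) : rank y < rank x := by
  have h1 : rank y ∈ (kids x).map rank := List.mem_map_of_mem hy
  by_cases hf : node (item x) = x
  · rw [h.full x hx hf] at h1
    exact mem_down.1 h1
  · rw [h.hollow x hx hf] at h1
    exact mem_down.1 (List.mem_of_mem_take h1)

/-- Full or hollow, a node of rank `r ≥ 2` has children of ranks `r - 1` and `r - 2`, and `2 ^ (r /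
2)` is twice `2 ^ ((r - 2) / 2)`. This weaker form of the Fibonacci bound suffices for logarithmic
ranks. -/
theorem pow_le_sum (h : HeapInv rank fc ns item node key kids H R) {x : ℕ} (hx : x ∈ H) :
    2 ^ (rank x / 2) ≤ 1 + ((kids x).map fun y => 2 ^ (rank y / 2)).sum := by
  have key : ∀ r, 2 ^ (r / 2) ≤ 1 + (((down r).take 2).map fun i => 2 ^ (i / 2)).sum := by
    intro r
    match r with
    | 0 => simp [down]
    | 1 => simp [down]
    | r + 2 =>
      have e : (r + 2) / 2 = r / 2 + 1 := by omega
      have : 2 ^ (r / 2) ≤ 2 ^ ((r + 1) / 2) := Nat.pow_le_pow_right (by norm_num) (by omega)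
      simp [down, e, pow_succ]
      omega
  have e : ((kids x).map fun y => 2 ^ (rank y / 2)) = ((kids x).map rank).map fun i => 2 ^ (i / 2) := by
    simp [Function.comp_def]
  rw [e]
  by_cases hf : node (item x) = x
  · rw [h.full x hx hf]
    refine (key _).trans (Nat.add_le_add_left ?_ _)
    exact List.Sublist.sum_le_sum ((List.take_sublist _ _).map _) fun _ _ => Nat.zero_le _
  · rw [h.hollow x hx hf]
    exact key _

/-- The number of nodes is at least exponential in the ranks of the roots. -/
theorem pow_rank_le (h : HeapInv rank fc ns item node key kids H R) {x : ℕ} (hx : x ∈ R) :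
    2 ^ (rank x / 2) ≤ H.card := by
  set F : ℕ → ℕ := fun y => 2 ^ (rank y / 2) with hF
  -- Every node is exactly once a root or a child. Comparing this with `pow_le_sum` summed over all
  -- nodes cancels the contribution of the children and leaves at most `H.card` for the roots; no
  -- subtree sizes are needed.
  have h1 : (H.map F).sum = (R.map F).sum + (H.map fun x => ((kids x).map F).sum).sum := by
    conv_lhs => rw [h.eq]
    rw [Multiset.map_add, Multiset.sum_add, Multiset.map_bind, Multiset.sum_bind]
    simp
  have h2 : (H.map F).sum ≤ (H.map fun x => 1 + ((kids x).map F).sum).sum :=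
    Multiset.sum_map_le_sum_map _ _ fun x hx => h.pow_le_sum hx
  rw [Multiset.sum_map_add] at h2
  have h3 : F x ≤ (R.map F).sum :=
    Multiset.single_le_sum (fun _ _ => Nat.zero_le _) _ (Multiset.mem_map_of_mem F hx)
  simp at h2
  have : F x ≤ H.card := by omega
  exact this

/-- Climbing to the parent does not increase the key and strictly increases the rank, which is
bounded on the finite heap; so the climb ends at a root. -/
theorem exists_root_le (h : HeapInv rank fc ns item node key kids H R) {x : ℕ} (hx : x ∈ H) :
    ∃ r ∈ R, key r ≤ key x := by
  have hb : ∃ b, ∀ y ∈ H, rank y ≤ b :=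
    ⟨(H.map rank).sum, fun y hy =>
      Multiset.single_le_sum (fun _ _ => Nat.zero_le _) _ (Multiset.mem_map_of_mem rank hy)⟩
  obtain ⟨b, hb⟩ := hb
  have : ∀ k x, x ∈ H → b - rank x ≤ k → ∃ r ∈ R, key r ≤ key x := by
    intro k
    induction k with
    | zero =>
      intro x hx hk
      have hx' := hx
      rw [h.eq, Multiset.mem_add] at hx'
      rcases hx' with hr | hk'
      · exact ⟨x, hr, le_rfl⟩
      · obtain ⟨p, hp, hxp⟩ := Multiset.mem_bind.1 hk'
        have h1 := h.rank_kid_lt hp (by simpa using hxp)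
        have h2 := hb p hp
        omega
    | succ k ih =>
      intro x hx hk
      have hx' := hx
      rw [h.eq, Multiset.mem_add] at hx'
      rcases hx' with hr | hk'
      · exact ⟨x, hr, le_rfl⟩
      · obtain ⟨p, hp, hxp⟩ := Multiset.mem_bind.1 hk'
        have hxp : x ∈ kids p := by simpa using hxp
        have h1 := h.rank_kid_lt hp hxp
        have h2 := hb p hp
        obtain ⟨r, hr, hle⟩ := ih p hp (by omega)
        exact ⟨r, hr, hle.trans (h.key_le p hp x hxp)⟩
  exact this _ x hx le_rfl

/-- Linking: of two full roots of the same rank, the one with the larger key becomes the first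
child of the other. -/
theorem link {x y : ℕ} (h : HeapInv rank fc ns item node key kids H (x ::ₘ y ::ₘ R))
    (hf : node (item x) = x) (hr : rank y = rank x) (hk : key x ≤ key y) :
    HeapInv (Function.update rank x (rank x + 1)) (Function.update fc x y)
      (Function.update ns y (fc x)) item node key (Function.update kids x (y :: kids x)) H
      (x ::ₘ R) := by
  have hxR : x ∈ x ::ₘ y ::ₘ R := by simp
  have hyR : y ∈ x ::ₘ y ::ₘ R := by simp
  have hx := h.mem_of_root hxR
  have hxy : x ≠ y := by
    have := h.nodup_roots
    simp at this
    exact this.1.1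
  have hrank : ∀ z ∈ H, (kids z).map (Function.update rank x (rank x + 1)) = (kids z).map rank := by
    intro z hz
    refine List.map_congr_left fun a ha => Function.update_of_ne ?_ _ _
    rintro rfl
    exact h.root_not_kid hz hxR ha
  refine ⟨h.nodup, ?_, ?_, ?_, ?_, ?_, h.pos⟩
  -- Isolating `x` in `H` makes its child list the only summand that changes.
  · obtain ⟨H', hH'⟩ := Multiset.exists_cons_of_mem hx
    have hxH' : x ∉ H' := by have := h.nodup; rw [hH'] at this; simp at this; exact this.1
    have e := h.eq
    have hc : (H'.bind fun z => (Function.update kids x (y :: kids x) z : Multiset ℕ)) =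
        H'.bind fun z => (kids z : Multiset ℕ) := by
      refine Multiset.bind_congr fun z hz => ?_
      rw [Function.update_of_ne]
      rintro rfl; exact hxH' hz
    rw [hH', Multiset.cons_bind] at e
    rw [hH', Multiset.cons_bind, hc, e]
    simp only [Function.update_self, ← Multiset.cons_coe, Multiset.cons_add, Multiset.add_cons]
    exact Multiset.cons_swap _ _ _
  · intro z hz
    by_cases hzx : z = x
    · subst hzx
      simp only [Function.update_self]
      refine ⟨rfl, ?_⟩
      simp only [Function.update_self]
      refine (h.seg z hz).congr fun a ha => Function.update_of_ne ?_ _ _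
      rintro rfl; exact h.root_not_kid hz hyR ha
    · simp only [Function.update_of_ne hzx]
      refine (h.seg z hz).congr fun a ha => Function.update_of_ne ?_ _ _
      rintro rfl; exact h.root_not_kid hz hyR ha
  · intro z hz hfz
    by_cases hzx : z = x
    · subst hzx
      simp only [Function.update_self, List.map_cons, hrank z hz, h.full z hz hf, down,
        Function.update_of_ne hxy.symm, hr]
    · simp only [Function.update_of_ne hzx, hrank z hz, h.full z hz hfz]
  · intro z hz hfz
    have hzx : z ≠ x := by rintro rfl; exact hfz hf
    simp only [Function.update_of_ne hzx, hrank z hz, h.hollow z hz hfz]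
  · intro z hz w hw
    by_cases hzx : z = x
    · subst hzx
      simp only [Function.update_self, List.mem_cons] at hw
      rcases hw with rfl | hw
      · exact hk
      · exact h.key_le z hz w hw
    · simp only [Function.update_of_ne hzx] at hw
      exact h.key_le z hz w hw

/-- Removing a root turns its children into roots. -/
theorem remove {x : ℕ} {H' : Multiset ℕ}
    (h : HeapInv rank fc ns item node key kids (x ::ₘ H') (x ::ₘ R)) :
    HeapInv rank fc ns item node key kids H' (R + (kids x : Multiset ℕ)) := by
  have e := h.eq
  rw [Multiset.cons_bind, Multiset.cons_add, Multiset.cons_inj_right, ← add_assoc] at e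
  exact ⟨(Multiset.nodup_cons.1 h.nodup).2, e, fun z hz => h.seg z (by simp [hz]),
    fun z hz => h.full z (by simp [hz]), fun z hz => h.hollow z (by simp [hz]),
    fun z hz => h.key_le z (by simp [hz]), fun hz => h.pos (by simp [hz])⟩

/-- Insertion of the node `z` for an item `v` that is not in the heap. -/
theorem insert {z v c : ℕ} {d : ℝ≥0} (h : HeapInv rank fc ns item node key kids H R)
    (hz : z ∉ H) (hz0 : z ≠ 0) (hv : node v ∉ H) :
    HeapInv (Function.update rank z 0) (Function.update fc z c) ns (Function.update item z v)
      (Function.update node v z) (Function.update key z d) (Function.update kids z [])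
      (z ::ₘ H) (z ::ₘ R) := by
  have hne : ∀ x ∈ H, x ≠ z := by rintro x hx rfl; exact hz hx
  -- Redirecting `node v` can only affect whether its old value is full, and that node is not in
  -- `H`.
  have hfull : ∀ x ∈ H, (Function.update node v z (item x) = x ↔ node (item x) = x) := by
    intro x hx
    by_cases hxv : item x = v
    · rw [hxv, Function.update_self]
      exact ⟨fun h => absurd h.symm (hne x hx), fun h => absurd (h ▸ hx) hv⟩
    · rw [Function.update_of_ne hxv]
  have hrank : ∀ x ∈ H, (kids x).map (Function.update rank z 0) = (kids x).map rank := by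
    intro x hx
    refine List.map_congr_left fun a ha => Function.update_of_ne ?_ _ _
    exact hne a (h.mem_of_kid hx ha)
  refine ⟨Multiset.nodup_cons.2 ⟨hz, h.nodup⟩, ?_, ?_, ?_, ?_, ?_, by simp [h.pos, hz0.symm]⟩
  · have hc : (H.bind fun x => (Function.update kids z [] x : Multiset ℕ)) =
        H.bind fun x => (kids x : Multiset ℕ) :=
      Multiset.bind_congr fun x hx => by rw [Function.update_of_ne (hne x hx)]
    rw [Multiset.cons_bind, hc]
    simpa using h.eq
  all_goals
    intro x hx
    rcases Multiset.mem_cons.1 hx with rfl | hx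
    · simp [Seg, down]
  · simpa only [Function.update_of_ne (hne x hx)] using h.seg x hx
  · simp only [Function.update_of_ne (hne x hx), hrank x hx, hfull x hx]
    exact h.full x hx
  · simp only [Function.update_of_ne (hne x hx), hrank x hx, ne_eq, hfull x hx]
    exact h.hollow x hx
  · simp only [Function.update_of_ne (hne x hx)]
    intro y hy
    rw [Function.update_of_ne (hne y (h.mem_of_kid hx hy))]
    exact h.key_le x hx y hy

/-- Decreasing the key of an item `v` in the heap: its node becomes hollow, and a new node `z`
takes over all but the first two of the children. -/
theorem decrease {z v : ℕ} {d : ℝ≥0} (h : HeapInv rank fc ns item node key kids H R)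
    (hz : z ∉ H) (hz0 : z ≠ 0) (hv : node v ∈ H) (hiv : item (node v) = v)
    (hd : d ≤ key (node v)) :
    HeapInv (Function.update rank z (rank (node v) - 1 - 1))
      (Function.update fc z (ns (ns (fc (node v))))) ns (Function.update item z v)
      (Function.update node v z) (Function.update key z d)
      (Function.update (Function.update kids (node v) ((kids (node v)).take 2)) z
        ((kids (node v)).drop 2))
      (z ::ₘ H) (z ::ₘ R) := by
  set y := node v with hy
  have hne : ∀ x ∈ H, x ≠ z := by rintro x hx rfl; exact hz hx
  have hyz : y ≠ z := hne y hv
  have hyf : node (item y) = y := by rw [hiv]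
  have hrank : ∀ x ∈ H, ∀ r,
      (kids x).map (Function.update rank z r) = (kids x).map rank := by
    intro x hx r
    refine List.map_congr_left fun a ha => Function.update_of_ne ?_ _ _
    exact hne a (h.mem_of_kid hx ha)
  have hkey : ∀ x ∈ H, Function.update key z d x = key x :=
    fun x hx => Function.update_of_ne (hne x hx) _ _
  refine ⟨Multiset.nodup_cons.2 ⟨hz, h.nodup⟩, ?_, ?_, ?_, ?_, ?_, by simp [h.pos, hz0.symm]⟩
  · obtain ⟨H', hH'⟩ := Multiset.exists_cons_of_mem hv
    have hyH' : y ∉ H' := by have := h.nodup; rw [hH'] at this; simp at this; exact this.1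
    have hc : (H'.bind fun x => (Function.update (Function.update kids y ((kids y).take 2)) z
        ((kids y).drop 2) x : Multiset ℕ)) = H'.bind fun x => (kids x : Multiset ℕ) := by
      refine Multiset.bind_congr fun x hx => ?_
      rw [Function.update_of_ne (hne x (by rw [hH']; simp [hx])), Function.update_of_ne]
      rintro rfl; exact hyH' hx
    have e := h.eq
    have e2 : (kids y : Multiset ℕ) = ((kids y).drop 2 : List ℕ) + ((kids y).take 2 : List ℕ) := by
      rw [add_comm, Multiset.coe_add, List.take_append_drop]
    rw [hH', Multiset.cons_bind, e2] at e
    rw [hH', Multiset.cons_bind, Multiset.cons_bind, hc, Function.update_self,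
      Function.update_of_ne hyz, Function.update_self, Multiset.cons_add, e]
    congr 2
    ac_rfl
  · intro x hx
    rcases Multiset.mem_cons.1 hx with rfl | hx
    · simp only [Function.update_self]
      exact (h.seg y hv).drop_two
    · simp only [Function.update_of_ne (hne x hx)]
      by_cases hxy : x = y
      · subst hxy; rw [Function.update_self]; exact (h.seg _ hx).take 2
      · rw [Function.update_of_ne hxy]; exact h.seg x hx
  · intro x hx
    rcases Multiset.mem_cons.1 hx with rfl | hx
    · intro _
      simp only [Function.update_self]
      rw [List.map_drop, hrank y hv, h.full y hv hyf, drop_two_down]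
    · have hxv : item x = v → x ≠ y → node (item x) ≠ x := by
        intro h1 h2 h3
        rw [h1] at h3; exact h2 h3.symm
      simp only [Function.update_of_ne (hne x hx)]
      by_cases hxi : item x = v
      · rw [hxi, Function.update_self]
        exact fun h => absurd h.symm (hne x hx)
      · have hxy : x ≠ y := by rintro rfl; exact hxi hiv
        rw [Function.update_of_ne hxi, Function.update_of_ne hxy, hrank x hx]
        exact h.full x hx
  · intro x hx
    rcases Multiset.mem_cons.1 hx with rfl | hx
    · simp
    · simp only [Function.update_of_ne (hne x hx)]
      by_cases hxy : x = y
      · intro _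
        rw [hxy, Function.update_self, List.map_take, hrank y hv, h.full y hv hyf]
      · rw [Function.update_of_ne hxy, hrank x hx]
        by_cases hxi : item x = v
        · intro _
          exact h.hollow x hx fun h3 => hxy (by rw [hxi] at h3; exact h3.symm)
        · rw [Function.update_of_ne hxi]
          exact h.hollow x hx
  · intro x hx w hw
    rcases Multiset.mem_cons.1 hx with rfl | hx
    · rw [Function.update_self] at hw
      have hw' := List.mem_of_mem_drop hw
      rw [Function.update_self, hkey w (h.mem_of_kid hv hw')]
      exact hd.trans (h.key_le y hv w hw')
    · rw [Function.update_of_ne (hne x hx)] at hw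
      have hw' : w ∈ kids x := by
        by_cases hxy : x = y
        · rw [hxy, Function.update_self] at hw; rw [hxy]; exact List.mem_of_mem_take hw
        · rwa [Function.update_of_ne hxy] at hw
      rw [hkey x hx, hkey w (h.mem_of_kid hx hw')]
      exact h.key_le x hx w hw'

end HeapInv

/-! ### The program for the priority queue

The memory used besides input and output, by name. -/

notation "iN" => (0 : ℕ)
notation "iM" => (1 : ℕ)
notation "iSource" => (2 : ℕ)
notation "iCount" => (3 : ℕ)
notation "iBase" => (4 : ℕ)
notation "iPend" => (5 : ℕ)
notation "iBound" => (6 : ℕ)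
notation "iI" => (7 : ℕ)
notation "iX" => (8 : ℕ)
notation "iY" => (9 : ℕ)
notation "iR" => (10 : ℕ)
notation "iBest" => (11 : ℕ)
notation "iE" => (12 : ℕ)
notation "iV" => (13 : ℕ)
notation "iLog" => (14 : ℕ)
notation "iJ" => (15 : ℕ)
notation "iC" => (16 : ℕ)
notation "iStart" => (17 : ℕ)

notation "aParent" => (0 : ℕ)
notation "aHead" => (9 : ℕ)
notation "aNext" => (10 : ℕ)
notation "aTarget" => (11 : ℕ)
notation "aDepth" => (12 : ℕ)
notation "aItem" => (13 : ℕ)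
notation "aRank" => (14 : ℕ)
notation "aFirst" => (15 : ℕ)
notation "aSib" => (16 : ℕ)
notation "aNode" => (17 : ℕ)
notation "aPend" => (18 : ℕ)
notation "aSlot" => (19 : ℕ)
notation "aLogHub" => (20 : ℕ)
notation "aLogItem" => (21 : ℕ)

notation "rWeight" => (0 : ℕ)
notation "rKey" => (3 : ℕ)
notation "rLogDist" => (4 : ℕ)
notation "rD" => (0 : ℕ)

/-- Add the node `e` to the list of pending roots. -/
def push (e : NExpr) : Prog :=
  .nput aPend (.var iPend) e ;; .nset iPend (.succ (.var iPend))

/-- Link `x` with the roots of the same rank met in the slots. -/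
def linkLoop : Prog :=
  .loop (.not (.neq (.arr aSlot (.arr aRank (.var iX))) (.lit 0)))
    (.nset iY (.arr aSlot (.arr aRank (.var iX))) ;;
      .nput aSlot (.arr aRank (.var iX)) (.lit 0) ;;
      .cond (.rle (.arr rKey (.var iX)) (.arr rKey (.var iY))) .skip
        (.nset iC (.var iX) ;; .nset iX (.var iY) ;; .nset iY (.var iC)) ;;
      .nput aSib (.var iY) (.arr aFirst (.var iX)) ;;
      .nput aFirst (.var iX) (.var iY) ;;
      .nput aRank (.var iX) (.succ (.arr aRank (.var iX))))

/-- Move the pending roots to the slots: hollow roots are replaced by their children, full roots of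
equal rank are linked. -/
def consolidate : Prog :=
  .nset iBound (.lit 0) ;;
  .loop (.not (.neq (.var iPend) (.lit 0)))
    (.nset iPend (.pred (.var iPend)) ;;
      .nset iX (.arr aPend (.var iPend)) ;;
      .cond (.neq (.arr aNode (.arr aItem (.var iX))) (.var iX))
        (linkLoop ;;
          .nput aSlot (.arr aRank (.var iX)) (.var iX) ;;
          .cond (.nle (.var iBound) (.arr aRank (.var iX)))
            (.nset iBound (.succ (.arr aRank (.var iX)))) .skip)
        (.cond (.nle (.lit 1) (.arr aRank (.var iX)))
          (push (.arr aFirst (.var iX)) ;;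
            .cond (.nle (.lit 2) (.arr aRank (.var iX)))
              (push (.arr aSib (.arr aFirst (.var iX)))) .skip)
          .skip))

/-- Move the roots from the slots to the pending list, except one with minimum key. -/
def scan : Prog :=
  .nset iBest (.lit 0) ;; .nset iI (.lit 0) ;;
  .loop (.not (.nle (.var iBound) (.var iI)))
    (.nset iX (.arr aSlot (.var iI)) ;;
      .nput aSlot (.var iI) (.lit 0) ;;
      .cond (.neq (.var iX) (.lit 0)) .skip
        (.cond (.neq (.var iBest) (.lit 0)) (.nset iBest (.var iX))
          (.cond (.rle (.arr rKey (.var iBest)) (.arr rKey (.var iX)))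
            (push (.var iX))
            (push (.var iBest) ;; .nset iBest (.var iX)))) ;;
      .nset iI (.succ (.var iI)))

/-- Find a full root of minimum key. -/
def findMin : Prog := consolidate ;; scan

/-- The children of the best root become pending roots. -/
def pushKids : Prog :=
  .nset iC (.arr aFirst (.var iBest)) ;; .nset iJ (.arr aRank (.var iBest)) ;;
  .loop (.not (.neq (.var iJ) (.lit 0)))
    (push (.var iC) ;; .nset iC (.arr aSib (.var iC)) ;; .nset iJ (.pred (.var iJ)))

/-! ### Its specification -/

/-- The multiset of the first `k` entries of an array. -/
def entries (f : ℕ → ℕ) (k : ℕ) : Multiset ℕ := (Multiset.range k).map f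

@[simp] theorem entries_zero (f : ℕ → ℕ) : entries f 0 = 0 := rfl

theorem entries_succ (f : ℕ → ℕ) (k : ℕ) : entries f (k + 1) = f k ::ₘ entries f k := by
  simp [entries, Multiset.range_succ]

@[simp] theorem entries_update (f : ℕ → ℕ) {i k : ℕ} (x : ℕ) (h : k ≤ i) :
    entries (Function.update f i x) k = entries f k := by
  refine Multiset.map_congr rfl fun i hi => Function.update_of_ne ?_ _ _
  rw [Multiset.mem_range] at hi; omega

@[simp] theorem card_entries (f : ℕ → ℕ) (k : ℕ) : (entries f k).card = k := by simp [entries]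

/-- The content of a cell, where `0` means that it is empty. -/
def cell (a : ℕ) : Multiset ℕ := if a = 0 then 0 else {a}

@[simp] theorem cell_zero : cell 0 = 0 := rfl

theorem cell_of_ne {a : ℕ} (h : a ≠ 0) : cell a = {a} := if_neg h

/-- The nonempty cells among the first `k` cells of an array. -/
def slots (f : ℕ → ℕ) (k : ℕ) : Multiset ℕ := ∑ i ∈ Finset.range k, cell (f i)

/-- The additive form avoids multiset subtraction and serves both for emptying and for filling a
slot. -/
theorem slots_update (f : ℕ → ℕ) {i k : ℕ} (a : ℕ) (hi : i < k) :
    slots (Function.update f i a) k + cell (f i) = slots f k + cell a := by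
  have hm := Finset.mem_range.2 hi
  rw [slots, slots, ← Finset.add_sum_erase _ _ hm, ← Finset.add_sum_erase _ _ hm,
    Function.update_self]
  have : ∑ j ∈ (Finset.range k).erase i, cell (Function.update f i a j) =
      ∑ j ∈ (Finset.range k).erase i, cell (f j) :=
    Finset.sum_congr rfl fun j hj => by rw [Function.update_of_ne (Finset.ne_of_mem_erase hj)]
  rw [this]
  abel

theorem slots_eq_zero {f : ℕ → ℕ} {k : ℕ} (h : ∀ i < k, f i = 0) : slots f k = 0 :=
  Finset.sum_eq_zero fun i hi => by rw [h i (Finset.mem_range.1 hi), cell_zero]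

theorem mem_slots {f : ℕ → ℕ} {k x : ℕ} : x ∈ slots f k ↔ x ≠ 0 ∧ ∃ i < k, f i = x := by
  rw [slots, Multiset.mem_sum]
  constructor
  · rintro ⟨i, hi, hx⟩
    by_cases h0 : f i = 0
    · simp [h0] at hx
    · rw [cell_of_ne h0, Multiset.mem_singleton] at hx
      exact ⟨by rwa [hx], i, Finset.mem_range.1 hi, hx.symm⟩
  · rintro ⟨h0, i, hi, rfl⟩
    exact ⟨i, Finset.mem_range.2 hi, by simp [cell_of_ne h0]⟩

/-- The heap stored in the memory. -/
abbrev HeapAt (s : State) (kids : ℕ → List ℕ) (H R : Multiset ℕ) : Prop :=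
  HeapInv (s.na aRank) (s.na aFirst) (s.na aSib) (s.na aItem) (s.na aNode) (s.ra rKey) kids H R

/-- The pending roots. -/
abbrev pending (s : State) : Multiset ℕ := entries (s.na aPend) (s.nv iPend)

/-- The roots in the slots are full and sorted by rank. -/
def SlotsOk (s : State) : Prop :=
  ∀ i, s.na aSlot i ≠ 0 → i < s.nv iBound ∧ s.na aRank (s.na aSlot i) = i ∧
    s.na aNode (s.na aItem (s.na aSlot i)) = s.na aSlot i

/-- Each link empties one slot, and the 15 units released pay for one pass of the loop. -/
theorem linkLoop_spec {s : State} {c B X : ℕ} {kids : ℕ → List ℕ} {H : Multiset ℕ}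
    (h : HeapAt s kids H (s.nv iX ::ₘ (pending s + slots (s.na aSlot) B)))
    (hs : SlotsOk s) (hK : s.nv iBound ≤ B)
    (hf : s.na aNode (s.na aItem (s.nv iX)) = s.nv iX)
    (hc : c + 15 * (slots (s.na aSlot) B).card ≤ X) :
    wp linkLoop (fun s' c' => ∃ kids',
      HeapAt s' kids' H (s'.nv iX ::ₘ (pending s' + slots (s'.na aSlot) B)) ∧
      SlotsOk s' ∧ s'.na aNode (s'.na aItem (s'.nv iX)) = s'.nv iX ∧
      s'.na aSlot (s'.na aRank (s'.nv iX)) = 0 ∧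
      c' + 15 * (slots (s'.na aSlot) B).card ≤ X + 1) s c := by
  refine wp_loop (fun s' c' => ∃ kids',
      HeapAt s' kids' H (s'.nv iX ::ₘ (pending s' + slots (s'.na aSlot) B)) ∧
      SlotsOk s' ∧ s'.na aNode (s'.na aItem (s'.nv iX)) = s'.nv iX ∧
      c' + 15 * (slots (s'.na aSlot) B).card ≤ X) X ⟨kids, h, hs, hf, hc⟩ ?_ ?_ ?_
  · rintro s' c' ⟨_, _, _, _, h⟩; omega
  · rintro s' c' hfr ⟨kids', h, hs, hf, hc⟩ hb
    have hbd : s'.nv iBound = s.nv iBound := hfr.nv _ (by decide)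
    simp only [Test.Holds, NExpr.eval] at hb
    set x := s'.nv iX with hx
    set r := s'.na aRank x with hr
    set y := s'.na aSlot r with hy
    obtain ⟨hrB, hry, hfy⟩ := hs r hb
    have hslot := slots_update (s'.na aSlot) 0 (show r < B by omega)
    rw [← hy, cell_of_ne hb, cell_zero, add_zero] at hslot
    have hcard := congrArg Multiset.card hslot
    simp only [Multiset.card_add, Multiset.card_singleton] at hcard
    have hroots : HeapAt s' kids' H
        (x ::ₘ y ::ₘ (pending s' + slots (Function.update (s'.na aSlot) r 0) B)) := by
      rw [← hslot] at h
      have e : pending s' + (slots (Function.update (s'.na aSlot) r 0) B + {y}) =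
          y ::ₘ (pending s' + slots (Function.update (s'.na aSlot) r 0) B) := by
        rw [← Multiset.singleton_add]; abel
      rwa [e] at h
    have hxy : x ≠ y := by
      intro e
      have h2 := hroots.nodup_roots
      simp [e] at h2
    -- A slot holds only a root whose rank is the slot's index, so the other slots contain neither
    -- `x` nor `y` and survive the change of rank.
    have hother : ∀ i, i ≠ r → s'.na aSlot i ≠ 0 →
        s'.na aSlot i ≠ x ∧ s'.na aSlot i ≠ y := by
      intro i hi h0
      refine ⟨fun e => ?_, fun e => ?_⟩
      · have := (hs i h0).2.1; rw [e, ← hr] at this; exact hi this.symm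
      · have := (hs i h0).2.1; rw [e, hry] at this; exact hi this.symm
    simp only [wp_seq, wp_nset, NExpr.eval, wp_nput, wp_cond, wp_skip, Test.Holds, RExpr.eval]
    simp [-exists_and_right, HeapAt, pending, ← hx, ← hr, ← hy]
    refine ⟨fun hle => ?_, fun hlt => ?_⟩
    · refine ⟨_, hroots.link hf hry hle, ?_, hf, by omega⟩
      intro i hi
      simp only [putN_na, setN_na, putN_nv, setN_nv] at hi ⊢
      simp at hi ⊢
      have hir : i ≠ r := by rintro rfl; simp at hi
      rw [Function.update_of_ne hir] at hi ⊢
      have h1 := hother i hir hi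
      rw [Function.update_of_ne h1.1]
      exact hs i hi
    · have hr2 : HeapAt s' kids' H
        (y ::ₘ x ::ₘ (pending s' + slots (Function.update (s'.na aSlot) r 0) B)) := by
        rwa [Multiset.cons_swap]
      refine ⟨_, hr2.link hfy (hr.symm.trans hry.symm) hlt.le, ?_, hfy, by omega⟩
      intro i hi
      simp at hi ⊢
      have hir : i ≠ r := by rintro rfl; simp at hi
      rw [Function.update_of_ne hir] at hi ⊢
      have h1 := hother i hir hi
      rw [Function.update_of_ne h1.2]
      exact hs i hi
  · rintro s' c' hfr ⟨kids', h, hs, hf, hc⟩ hb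
    simp only [Test.Holds, NExpr.eval, not_not] at hb
    exact ⟨kids', h, hs, hf, hb, by omega⟩

/-- Amortization: a full pending root releases 30 units, of which 15 stay with its slot. A hollow
root releases 50 + 30 units, enough to make up to two children pending at 30 each and to pay for the
steps. Only hollow nodes are destroyed, so every item keeps its current node. -/
theorem consolidate_spec {s : State} {c B X : ℕ} {kids : ℕ → List ℕ} {H : Multiset ℕ}
    (hB : ∀ r, 2 ^ (r / 2) ≤ H.card → r < B)
    (h : HeapAt s kids H (pending s)) (hs : ∀ i, s.na aSlot i = 0)
    (hc : c + 50 * H.card + 30 * s.nv iPend ≤ X) :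
    wp consolidate (fun s' c' => ∃ kids' H',
      HeapAt s' kids' H' (slots (s'.na aSlot) B) ∧ SlotsOk s' ∧ s'.nv iBound ≤ B ∧
      s'.nv iPend = 0 ∧ H' ≤ H ∧ (∀ x ∈ H, s'.na aNode (s'.na aItem x) = x → x ∈ H') ∧
      c' + 50 * H'.card ≤ X + 2) s c := by
  simp only [consolidate, wp_seq, wp_nset, NExpr.eval]
  refine wp_loop (fun s' c' => ∃ kids' H',
      HeapAt s' kids' H' (pending s' + slots (s'.na aSlot) B) ∧ SlotsOk s' ∧ s'.nv iBound ≤ B ∧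
      H' ≤ H ∧ (∀ x ∈ H, s'.na aNode (s'.na aItem x) = x → x ∈ H') ∧
      c' + 50 * H'.card + 30 * s'.nv iPend + 15 * (slots (s'.na aSlot) B).card ≤ X + 1) (X + 1)
      ?_ ?_ ?_ ?_
  · refine ⟨kids, H, ?_, ?_, ?_, le_rfl, fun x hx _ => hx, ?_⟩
    · simpa [HeapAt, pending, slots_eq_zero fun i (_ : i < B) => hs i] using h
    · intro i hi; simp [hs i] at hi
    · simp
    · simp [slots_eq_zero fun i (_ : i < B) => hs i]; omega
  · rintro s' c' ⟨_, _, _, _, _, _, _, h⟩; omega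
  · rintro s' c' - ⟨kids', H', h, hs, hK, hle, hful, hc⟩ hb
    simp only [Test.Holds, NExpr.eval] at hb
    obtain ⟨k, hk⟩ := Nat.exists_eq_succ_of_ne_zero hb
    simp only [push, wp_seq, wp_nset, NExpr.eval, wp_cond, Test.Holds]
    simp [-exists_and_right, -exists_and_left, HeapAt, pending, hk]
    set x := s'.na aPend k with hx
    have hpend : pending s' = x ::ₘ entries (s'.na aPend) k := by
      simp only [pending, hk, Nat.succ_eq_add_one, entries_succ, ← hx]
    rw [hpend, Multiset.cons_add] at h
    have hxH := h.mem_of_root (Multiset.mem_cons_self _ _)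
    refine ⟨fun hf => ?_, fun hf => ?_⟩
    -- The links are paid from the potential of the slots alone; `c' + 4` is the counter on entering
    -- the link loop.
    · refine wp_conseq (linkLoop_spec (B := B) (X := c' + 4 + 15 * (slots (s'.na aSlot) B).card)
        (kids := kids') (H := H') (by simpa [HeapAt, pending] using h) (by simpa [SlotsOk] using hs) (by simpa using hK) (by simpa using hf)
        (by simp)) ?_
      rintro s2 c2 hfr ⟨kids2, h2, hs2, hf2, he2, hc2⟩
      have hN : s2.nv iPend = k := (hfr.nv _ (by decide)).trans (by simp)
      have hbd : s2.nv iBound = s'.nv iBound := (hfr.nv _ (by decide)).trans (by simp)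
      have hno : s2.na aNode = s'.na aNode := (hfr.na _ (by decide)).trans (by simp)
      have hit : s2.na aItem = s'.na aItem := (hfr.na _ (by decide)).trans (by simp)
      set x2 := s2.nv iX with hx2
      set r := s2.na aRank x2 with hr
      have hrB : r < B := hB r ((h2.pow_rank_le (Multiset.mem_cons_self _ _)).trans
        (Multiset.card_le_card hle))
      have hx0 : x2 ≠ 0 := fun e => h2.pos (e ▸ h2.mem_of_root (Multiset.mem_cons_self _ _))
      have hslot := slots_update (s2.na aSlot) x2 hrB
      rw [he2, cell_zero, add_zero, cell_of_ne hx0] at hslot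
      have hcard := congrArg Multiset.card hslot
      simp only [Multiset.card_add, Multiset.card_singleton] at hcard
      have h3 : HeapAt s2 kids2 H'
          (pending s2 + slots (Function.update (s2.na aSlot) r x2) B) := by
        convert h2 using 1
        rw [hslot, ← Multiset.singleton_add]; abel
      have hs3 : ∀ i, Function.update (s2.na aSlot) r x2 i ≠ 0 →
          (i ≠ r → i < s2.nv iBound) ∧
          s2.na aRank (Function.update (s2.na aSlot) r x2 i) = i ∧
          s2.na aNode (s2.na aItem (Function.update (s2.na aSlot) r x2 i)) =
            Function.update (s2.na aSlot) r x2 i := by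
        intro i hi
        by_cases hir : i = r
        · subst hir
          simp only [Function.update_self]
          exact ⟨fun h => absurd rfl h, hr.symm, hf2⟩
        · rw [Function.update_of_ne hir] at hi ⊢
          exact ⟨fun _ => (hs2 i hi).1, (hs2 i hi).2⟩
      simp only [wp_seq, wp_nput, wp_cond, wp_skip, wp_nset, NExpr.eval, Test.Holds]
      simp [-exists_and_right, -exists_and_left, ← hx2, ← hr]
      refine ⟨fun hle2 => ?_, fun hlt => ?_⟩
      · refine ⟨kids2, H', h3, ?_, hrB, hle, ?_, by omega⟩
        · intro i hi
          simp at hi ⊢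
          refine ⟨?_, (hs3 i hi).2⟩
          by_cases hir : i = r
          · omega
          · have := (hs3 i hi).1 hir; omega
        · rw [hno, hit]; exact hful
      · refine ⟨kids2, H', h3, ?_, by omega, hle, ?_, by omega⟩
        · intro i hi
          simp at hi ⊢
          refine ⟨?_, (hs3 i hi).2⟩
          by_cases hir : i = r
          · omega
          · exact (hs3 i hi).1 hir
        · rw [hno, hit]; exact hful
    · obtain ⟨H2, rfl⟩ := Multiset.exists_cons_of_mem hxH
      have hho := h.hollow x hxH hf
      have hseg := h.seg x hxH
      have h2 := h.remove
      have hful2 : ∀ z ∈ H, s'.na aNode (s'.na aItem z) = z → z ∈ H2 := by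
        intro z hz hzf
        rcases Multiset.mem_cons.1 (hful z hz hzf) with rfl | h
        · exact absurd hzf hf
        · exact h
      have hle2 : H2 ≤ H := (Multiset.le_cons_self _ _).trans hle
      -- A hollow node has `min 2 (rank x)` children, so the two tests on the rank decide how many
      -- to push.
      have hlen := congrArg List.length hho
      simp at hlen hc
      refine ⟨fun h1 => ⟨fun h3 => ?_, fun h3 => ?_⟩, fun h1 => ?_⟩
      · match hkd : kids' x with
        | [] => rw [hkd] at hlen; simp at hlen; omega
        | [a] => rw [hkd] at hlen; simp at hlen; omega
        | a :: b :: d :: l => rw [hkd] at hlen; simp at hlen; omega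
        | [a, b] =>
          rw [hkd] at hseg h2
          obtain ⟨ha, hb', -⟩ := hseg
          refine ⟨kids', H2, ?_, ?_, hK, hle2, hful2, by omega⟩
          · convert h2 using 1
            simp [entries_succ, ← ha, ← hb', ← Multiset.cons_coe]
            rw [← Multiset.singleton_add, ← Multiset.singleton_add]
            simp only [← Multiset.singleton_add]
            abel
          · simpa [SlotsOk] using hs
      · match hkd : kids' x with
        | [] => rw [hkd] at hlen; simp at hlen; omega
        | a :: b :: l => rw [hkd] at hlen; simp at hlen; omega
        | [a] =>
          rw [hkd] at hseg h2
          obtain ⟨ha, -⟩ := hseg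
          refine ⟨kids', H2, ?_, ?_, hK, hle2, hful2, by omega⟩
          · convert h2 using 1
            simp [entries_succ, ← ha]
            simp only [← Multiset.singleton_add]
            abel
          · simpa [SlotsOk] using hs
      · match hkd : kids' x with
        | a :: l => rw [hkd] at hlen; simp at hlen; omega
        | [] =>
          rw [hkd] at h2
          refine ⟨kids', H2, ?_, ?_, hK, hle2, hful2, by omega⟩
          · simpa [pending] using h2
          · simpa [SlotsOk] using hs
  · rintro s' c' - ⟨kids', H', h, hs, hK, hle, hful, hc⟩ hb
    simp only [Test.Holds, NExpr.eval, not_not] at hb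
    refine ⟨kids', H', ?_, hs, hK, hb, hle, hful, by omega⟩
    simpa [pending, hb] using h

/-- A minimum over the roots is a minimum over the heap by `exists_root_le`. Per slot, at most 10
steps are made and one root becomes pending at 30 units, whence `40 * B`. -/
theorem scan_spec {s : State} {c B : ℕ} {kids : ℕ → List ℕ} {H : Multiset ℕ}
    (h : HeapAt s kids H (slots (s.na aSlot) B)) (hs : SlotsOk s) (hK : s.nv iBound ≤ B)
    (hp : s.nv iPend = 0) :
    wp scan (fun s' c' => HeapAt s' kids H (cell (s'.nv iBest) + pending s') ∧
      (∀ i, s'.na aSlot i = 0) ∧ (s'.nv iBest = 0 → H = 0) ∧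
      (s'.nv iBest ≠ 0 → s'.na aNode (s'.na aItem (s'.nv iBest)) = s'.nv iBest ∧
        ∀ x ∈ H, s'.ra rKey (s'.nv iBest) ≤ s'.ra rKey x) ∧
      c' + 30 * s'.nv iPend ≤ c + 40 * B + 3) s c := by
  simp only [scan, wp_seq, wp_nset, NExpr.eval]
  set R := slots (s.na aSlot) B with hR
  refine wp_loop (fun s' c' => cell (s'.nv iBest) + pending s' + slots (s'.na aSlot) B = R ∧
      (∀ i, i < s'.nv iI → s'.na aSlot i = 0) ∧
      (∀ i, s'.nv iI ≤ i → s'.na aSlot i = s.na aSlot i) ∧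
      s'.nv iI ≤ s.nv iBound ∧
      (s'.nv iBest = 0 → s'.nv iPend = 0) ∧
      (∀ x ∈ pending s', s'.ra rKey (s'.nv iBest) ≤ s'.ra rKey x) ∧ s'.nv iPend ≤ s'.nv iI ∧
      c' ≤ c + 2 + 10 * s'.nv iI) (c + 2 + 10 * B) ?_ ?_ ?_ ?_
  · simp [pending, hp, hR]
  · rintro s' c' ⟨_, _, _, hi, _, _, _, _⟩; omega
  · rintro s' c' hfr ⟨hsum, hz, hsame, hi, hb0, hmin, hpi, hc⟩ hb
    have hbd : s'.nv iBound = s.nv iBound := (hfr.nv _ (by decide)).trans (by simp)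
    simp only [Test.Holds, NExpr.eval, hbd] at hb
    set i := s'.nv iI with hi'
    set x := s'.na aSlot i with hx
    have hslot := slots_update (s'.na aSlot) 0 (show i < B by omega)
    rw [← hx, cell_zero, add_zero] at hslot
    have hz' : ∀ j, j ≤ i → Function.update (s'.na aSlot) i 0 j = 0 := by
      intro j hj
      by_cases hji : j = i
      · rw [hji, Function.update_self]
      · rw [Function.update_of_ne hji]; exact hz j (by omega)
    have hsame' : ∀ j, i + 1 ≤ j → Function.update (s'.na aSlot) i 0 j = s.na aSlot j := by
      intro j hj
      rw [Function.update_of_ne (by omega)]; exact hsame j (by omega)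
    rw [← hslot] at hsum
    simp only [wp_seq, wp_nset, wp_nput, wp_cond, wp_skip, NExpr.eval, Test.Holds, RExpr.eval, push]
    simp [pending, ← hi', ← hx]
    refine ⟨fun hx0 => ?_, fun hx0 => ⟨fun hb0' => ?_, fun hb0' => ⟨fun hle => ?_, fun hlt => ?_⟩⟩⟩
    · refine ⟨?_, hz', hsame', by omega, hb0, hmin, by omega, by omega⟩
      rw [hx0] at hsum; simpa using hsum
    · refine ⟨?_, hz', hsame', by omega, fun h => absurd h hx0, ?_, by omega, by omega⟩
      · rw [hb0'] at hsum
        rw [← hsum]; simp only [cell_zero]; abel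
      · simp [hb0 hb0']
    · refine ⟨?_, hz', hsame', by omega, ?_, ?_, by omega, by omega⟩
      · rw [← hsum, entries_succ, cell_of_ne hx0]
        simp [← Multiset.singleton_add]; abel
      · exact fun h => absurd h hb0'
      · intro z hz
        rw [entries_succ] at hz
        simp at hz
        rcases hz with rfl | hz
        · exact hle
        · exact hmin z hz
    · refine ⟨?_, hz', hsame', by omega, ?_, ?_, by omega, by omega⟩
      · rw [← hsum, entries_succ, cell_of_ne hx0, cell_of_ne hb0']
        simp [← Multiset.singleton_add]; abel
      · exact fun h => absurd h hx0
      · intro z hz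
        rw [entries_succ] at hz
        simp at hz
        rcases hz with rfl | hz
        · exact hlt.le
        · exact hlt.le.trans (hmin z hz)
  · rintro s' c' hfr ⟨hsum, hz, hsame, hi, hb0, hmin, hpi, hc⟩ hb
    have hbd : s'.nv iBound = s.nv iBound := (hfr.nv _ (by decide)).trans (by simp)
    have e1 : s'.na aRank = s.na aRank := (hfr.na _ (by decide)).trans (by simp)
    have e2 : s'.na aFirst = s.na aFirst := (hfr.na _ (by decide)).trans (by simp)
    have e3 : s'.na aSib = s.na aSib := (hfr.na _ (by decide)).trans (by simp)
    have e4 : s'.na aItem = s.na aItem := (hfr.na _ (by decide)).trans (by simp)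
    have e5 : s'.na aNode = s.na aNode := (hfr.na _ (by decide)).trans (by simp)
    have e6 : s'.ra rKey = s.ra rKey := (hfr.ra _ (by decide)).trans (by simp)
    simp only [Test.Holds, NExpr.eval, hbd, not_not] at hb
    -- Slots below the bound have been cleared, and the others were empty by `SlotsOk`.
    have hzero : ∀ i, s'.na aSlot i = 0 := by
      intro i
      by_cases hi2 : i < s'.nv iI
      · exact hz i hi2
      · rw [hsame i (by omega)]
        by_contra h0
        have := (hs i h0).1
        omega
    rw [slots_eq_zero fun i _ => hzero i, add_zero] at hsum
    have hmin' : ∀ x ∈ R, s'.ra rKey (s'.nv iBest) ≤ s'.ra rKey x := by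
      intro x hx
      rw [← hsum, Multiset.mem_add] at hx
      rcases hx with hx | hx
      · by_cases h0 : s'.nv iBest = 0
        · simp [h0] at hx
        · rw [cell_of_ne h0, Multiset.mem_singleton] at hx; rw [hx]
      · exact hmin x hx
    refine ⟨?_, hzero, ?_, ?_, by omega⟩
    · unfold HeapAt
      rw [e1, e2, e3, e4, e5, e6, hsum]; exact h
    · intro h0
      refine Multiset.eq_zero_of_forall_notMem fun x hx => ?_
      obtain ⟨r, hr, -⟩ := h.exists_root_le hx
      rw [← hsum, h0, cell_zero, zero_add, pending, hb0 h0] at hr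
      simp at hr
    · intro h0
      refine ⟨?_, fun x hx => ?_⟩
      · have hm : s'.nv iBest ∈ R := by rw [← hsum, cell_of_ne h0]; simp
        obtain ⟨-, i, -, hi3⟩ := mem_slots.1 hm
        have := (hs i (by rw [hi3]; exact h0)).2.2
        rw [e4, e5, ← hi3, this]
      · obtain ⟨r, hr, hrx⟩ := h.exists_root_le hx
        exact (hmin' r hr).trans (by rw [e6]; exact hrx)

/-- The amortized cost is of the order of the rank bound `B`, however many roots are pending. A best
root of 0 signals an empty heap. -/
theorem findMin_spec {s : State} {c B X : ℕ} {kids : ℕ → List ℕ} {H : Multiset ℕ}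
    (hB : ∀ r, 2 ^ (r / 2) ≤ H.card → r < B)
    (h : HeapAt s kids H (pending s)) (hs : ∀ i, s.na aSlot i = 0)
    (hc : c + 50 * H.card + 30 * s.nv iPend ≤ X) :
    wp findMin (fun s' c' => ∃ kids' H',
      HeapAt s' kids' H' (cell (s'.nv iBest) + pending s') ∧
      (∀ i, s'.na aSlot i = 0) ∧ H' ≤ H ∧
      (∀ x ∈ H, s'.na aNode (s'.na aItem x) = x → x ∈ H') ∧
      (s'.nv iBest = 0 → H' = 0) ∧
      (s'.nv iBest ≠ 0 → s'.na aNode (s'.na aItem (s'.nv iBest)) = s'.nv iBest ∧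
        ∀ x ∈ H', s'.ra rKey (s'.nv iBest) ≤ s'.ra rKey x) ∧
      c' + 50 * H'.card + 30 * s'.nv iPend ≤ X + 40 * B + 5) s c := by
  simp only [findMin, wp_seq]
  refine wp_conseq (consolidate_spec hB h hs hc) ?_
  rintro s1 c1 - ⟨kids1, H1, h1, hs1, hK1, hp1, hle1, hful1, hc1⟩
  refine wp_conseq (scan_spec h1 hs1 hK1 hp1) ?_
  rintro s2 c2 hfr ⟨h2, hz2, hb2, hm2, hc2⟩
  have e4 : s2.na aItem = s1.na aItem := hfr.na _ (by decide)
  have e5 : s2.na aNode = s1.na aNode := hfr.na _ (by decide)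
  refine ⟨kids1, H1, h2, hz2, hle1, ?_, hb2, hm2, by omega⟩
  rw [e4, e5]; exact hful1

/-- The rank of the full root serves as the loop count, since the child list has no terminator. -/
theorem pushKids_spec {s : State} {c : ℕ} {l : List ℕ}
    (hseg : Seg (s.na aSib) (s.na aFirst (s.nv iBest)) l)
    (hlen : l.length = s.na aRank (s.nv iBest)) :
    wp pushKids (fun s' c' => pending s' = pending s + (l : Multiset ℕ) ∧
      s'.nv iPend = s.nv iPend + l.length ∧ c' ≤ c + 5 * l.length + 3) s c := by
  simp only [pushKids, wp_seq, wp_nset, NExpr.eval]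
  refine wp_loop (fun s' c' => ∃ l1 l2, l = l1 ++ l2 ∧ Seg (s.na aSib) (s'.nv iC) l2 ∧
      s'.nv iJ = l2.length ∧ pending s' = pending s + (l1 : Multiset ℕ) ∧
      s'.nv iPend = s.nv iPend + l1.length ∧ c' ≤ c + 5 * l1.length + 2)
      (c + 5 * l.length + 2) ?_ ?_ ?_ ?_
  · exact ⟨[], l, by simp, by simpa using hseg, by simp [hlen], by simp [pending], by simp,
      by simp⟩
  · rintro s' c' ⟨l1, l2, rfl, -, -, -, -, h⟩; simp; omega
  · rintro s' c' hfr ⟨l1, l2, hl, hseg, hj, hp, hn, hc⟩ hb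
    have e3 : s'.na aSib = s.na aSib := (hfr.na _ (by decide)).trans (by simp)
    simp only [Test.Holds, NExpr.eval] at hb
    match l2, hl, hseg, hj with
    | [], _, _, hj => simp [hj] at hb
    | a :: l2, hl, hseg, hj =>
      obtain ⟨ha, hseg⟩ := hseg
      simp only [push, wp_seq, wp_nset, wp_nput, NExpr.eval]
      refine ⟨l1 ++ [a], l2, by simp [hl], by simpa [e3, ha] using hseg, by simp [hj], ?_,
        by simp [hn]; omega, by simp; omega⟩
      simp only [pending] at hp
      simp [pending, entries_succ, ha, hp]
      rw [← Multiset.coe_add, Multiset.coe_singleton, ← Multiset.singleton_add]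
      abel
  · rintro s' c' hfr ⟨l1, l2, hl, hseg, hj, hp, hn, hc⟩ hb
    simp only [Test.Holds, NExpr.eval, not_not] at hb
    have : l2 = [] := List.length_eq_zero_iff.1 (by omega)
    subst this
    simp at hl
    subst hl
    exact ⟨hp, hn, by omega⟩

/-! ### Shortest-path searches -/

/-- Following the pointers `next` from `c` one meets the members of `l` and then `0`. -/
def Chain (next : ℕ → ℕ) : ℕ → List ℕ → Prop
  | c, [] => c = 0
  | c, a :: l => c = a ∧ a ≠ 0 ∧ Chain next (next a) l

/-- A digraph given by linked adjacency lists, with a depth for each vertex.  The edge with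
index `e` is represented by `e + 1`. -/
structure SearchGraph where
  n : ℕ
  head : ℕ → ℕ
  next : ℕ → ℕ
  target : ℕ → ℕ
  depth : ℕ → ℕ
  weight : ℕ → ℝ≥0
  adj : ℕ → List ℕ
  chain : ∀ u < n, Chain next (head u) (adj u)
  target_lt : ∀ u < n, ∀ e ∈ adj u, target e < n

/-- Walks from `h` that visit only vertices at least as deep as `h`. -/
inductive SearchGraph.Walk (g : SearchGraph) (h : ℕ) : ℕ → ℝ≥0 → Prop
  | nil : g.Walk h h 0
  | snoc {u : ℕ} {d : ℝ≥0} {e : ℕ} (hw : g.Walk h u d) (he : e ∈ g.adj u)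
      (hd : g.depth h ≤ g.depth (g.target e)) : g.Walk h (g.target e) (d + g.weight (e - 1))

/-- `l` lists the vertices reached from `h` with their distances. -/
structure SearchGraph.IsResult (g : SearchGraph) (h : ℕ) (l : List (ℕ × ℝ≥0)) : Prop where
  nodup : (l.map Prod.fst).Nodup
  walk : ∀ p ∈ l, g.Walk h p.1 p.2
  le : ∀ v d, g.Walk h v d → ∃ d' ≤ d, (v, d') ∈ l

/-- The graph is stored in the memory. -/
structure GraphAt (s : State) (g : SearchGraph) : Prop where
  n : s.nv iN = g.n
  head : s.na aHead = g.head
  next : s.na aNext = g.next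
  target : s.na aTarget = g.target
  depth : s.na aDepth = g.depth
  weight : s.ra rWeight = g.weight

theorem GraphAt.of_frame {s s' : State} {g : SearchGraph} {p : Prog} (h : GraphAt s g)
    (hf : Frame p s s') (hp : iN ∉ p.nvWrites ∧
      (∀ a ∈ [aHead, aNext, aTarget, aDepth], a ∉ p.naWrites) ∧ rWeight ∉ p.raWrites) :
    GraphAt s' g :=
  ⟨(hf.nv _ hp.1).trans h.n, (hf.na _ (hp.2.1 _ (by simp))).trans h.head,
    (hf.na _ (hp.2.1 _ (by simp))).trans h.next, (hf.na _ (hp.2.1 _ (by simp))).trans h.target,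
    (hf.na _ (hp.2.1 _ (by simp))).trans h.depth, (hf.ra _ hp.2.2).trans h.weight⟩

/-- The state of a search from `h`: `S` lists the settled vertices; the tentative distance of a
vertex `v` is `key (node v)`, provided that `base < node v`; settled vertices have distance at
most `cur`, the others at least `cur`.  The edges in `rem` from `u` have not been relaxed yet. -/
structure SearchInv (g : SearchGraph) (h base count : ℕ) (item node : ℕ → ℕ) (key : ℕ → ℝ≥0)
    (S : List ℕ) (H : Multiset ℕ) (cur : ℝ≥0) (u : ℕ) (rem : List ℕ) : Prop where
  node_le : ∀ v, node v ≤ count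
  range : ∀ x ∈ H, base < x ∧ x ≤ count
  item : ∀ v, base < node v → item (node v) = v ∧ v < g.n ∧ (v ∉ S → node v ∈ H)
  settled : ∀ v ∈ S, base < node v ∧ node v ∉ H
  nodup : S.Nodup
  walk : ∀ v, base < node v → g.Walk h v (key (node v))
  below : ∀ v ∈ S, key (node v) ≤ cur
  above : ∀ v, v ∉ S → base < node v → cur ≤ key (node v)
  closed : ∀ a ∈ S, ∀ e ∈ g.adj a, g.depth h ≤ g.depth (g.target e) → (a = u ∧ e ∈ rem) ∨
    (base < node (g.target e) ∧ key (node (g.target e)) ≤ key (node a) + g.weight (e - 1))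
  source : base < node h ∧ key (node h) = 0

/-! ### Dijkstra's invariant under the moves of a search -/

namespace SearchInv

variable {g : SearchGraph} {h base count : ℕ} {item node : ℕ → ℕ} {key : ℕ → ℝ≥0} {S : List ℕ}
  {H : Multiset ℕ} {cur : ℝ≥0} {u : ℕ} {rem : List ℕ}

theorem lt_n (hS : SearchInv g h base count item node key S H cur u rem) {v : ℕ} (hv : v ∈ S) :
    v < g.n := (hS.item v (hS.settled v hv).1).2.1

theorem card_le (hS : SearchInv g h base count item node key S H cur u rem) (hH : H.Nodup) :
    H.card ≤ count - base := by
  have : (⟨H, hH⟩ : Finset ℕ) ⊆ Finset.Ioc base count := fun x hx =>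
    Finset.mem_Ioc.2 (hS.range x hx)
  simpa using Finset.card_le_card this

/-- The invariant refers only to the current nodes of vertices, so hollow nodes may disappear during
a search for the minimum. -/
theorem mono_heap (hS : SearchInv g h base count item node key S H cur u rem) {H' : Multiset ℕ}
    (hle : H' ≤ H) (hf : ∀ x ∈ H, node (item x) = x → x ∈ H') :
    SearchInv g h base count item node key S H' cur u rem :=
  { hS with
    range := fun x hx => hS.range x (Multiset.mem_of_le hle hx)
    item := fun v hv => ⟨(hS.item v hv).1, (hS.item v hv).2.1, fun h =>
      hf _ ((hS.item v hv).2.2 h) (by rw [(hS.item v hv).1])⟩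
    settled := fun v hv => ⟨(hS.settled v hv).1, fun h =>
      (hS.settled v hv).2 (Multiset.mem_of_le hle h)⟩ }

theorem skip {e : ℕ} (hS : SearchInv g h base count item node key S H cur u (e :: rem))
    (he : g.depth h ≤ g.depth (g.target e) → base < node (g.target e) ∧
      key (node (g.target e)) ≤ key (node u) + g.weight (e - 1)) :
    SearchInv g h base count item node key S H cur u rem :=
  { hS with
    closed := fun a ha f hf hd => by
      rcases hS.closed a ha f hf hd with ⟨rfl, h⟩ | h
      · rcases List.mem_cons.1 h with rfl | h
        · exact .inr (he hd)
        · exact .inl ⟨rfl, h⟩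
      · exact .inr h }

/-- The new node has an unused number and belongs to an unsettled vertex, so settled labels do not
change. -/
theorem label_eq (hS : SearchInv g h base count item node key S H cur u rem) {v : ℕ} (hv : v ∉ S)
    {d : ℝ≥0} {a : ℕ} (ha : a ∈ S) :
    Function.update node v (count + 1) a = node a ∧
      Function.update key (count + 1) d (node a) = key (node a) := by
  refine ⟨Function.update_of_ne (by rintro rfl; exact hv ha) _ _, Function.update_of_ne ?_ _ _⟩
  have := hS.node_le a; omega

/-- Covers a first label and a decreased one alike, since `hle` matters only for a vertex that
already has a label. Lowering a label keeps `closed`, and nonnegative weights keep the new label at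
least `cur`. -/
theorem relabel {e : ℕ} (hS : SearchInv g h base count item node key S H cur u (e :: rem))
    (hu : u ∈ S) (he : e ∈ g.adj u) (hcur : key (node u) = cur)
    (hd : g.depth h ≤ g.depth (g.target e)) (hv : g.target e ∉ S)
    (hle : base < node (g.target e) →
      key (node u) + g.weight (e - 1) ≤ key (node (g.target e))) :
    SearchInv g h base (count + 1) (Function.update item (count + 1) (g.target e))
      (Function.update node (g.target e) (count + 1))
      (Function.update key (count + 1) (key (node u) + g.weight (e - 1))) S ((count + 1) ::ₘ H)
      cur u rem := by
  have hbc : base < count + 1 := by have := hS.source.1; have := hS.node_le h; omega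
  set v := g.target e with hvd
  set d := key (node u) + g.weight (e - 1) with hdd
  have hnode : ∀ a, a ≠ v → Function.update node v (count + 1) a = node a :=
    fun a ha => Function.update_of_ne ha _ _
  have hne : ∀ a, node a ≠ count + 1 := fun a => by have := hS.node_le a; omega
  have hkey : ∀ a, Function.update key (count + 1) d (node a) = key (node a) :=
    fun a => Function.update_of_ne (hne a) _ _
  have hSv : ∀ a ∈ S, a ≠ v := by rintro a ha rfl; exact hv ha
  refine ⟨?_, ?_, ?_, ?_, hS.nodup, ?_, ?_, ?_, ?_, ?_⟩
  · intro a
    by_cases ha : a = v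
    · rw [ha, Function.update_self]
    · rw [hnode a ha]; exact (hS.node_le a).trans (Nat.le_succ _)
  · intro x hx
    rcases Multiset.mem_cons.1 hx with rfl | hx
    · exact ⟨hbc, le_rfl⟩
    · exact ⟨(hS.range x hx).1, (hS.range x hx).2.trans (Nat.le_succ _)⟩
  · intro a ha
    by_cases hav : a = v
    · rw [hav, Function.update_self, Function.update_self]
      exact ⟨rfl, g.target_lt u (hS.lt_n hu) e he, fun _ => by simp⟩
    · rw [hnode a hav] at ha ⊢
      rw [Function.update_of_ne (hne a)]
      exact ⟨(hS.item a ha).1, (hS.item a ha).2.1, fun h => by simp [(hS.item a ha).2.2 h]⟩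
  · intro a ha
    rw [hnode a (hSv a ha)]
    exact ⟨(hS.settled a ha).1, by simp [hne a, (hS.settled a ha).2]⟩
  · intro a ha
    by_cases hav : a = v
    · rw [hav, Function.update_self, Function.update_self]
      exact .snoc (hS.walk u (hS.settled u hu).1) he hd
    · rw [hnode a hav] at ha ⊢
      rw [hkey]; exact hS.walk a ha
  · intro a ha
    rw [hnode a (hSv a ha), hkey]; exact hS.below a ha
  · intro a ha hb
    by_cases hav : a = v
    · rw [hav, Function.update_self, Function.update_self, ← hcur]
      exact le_self_add
    · rw [hnode a hav] at hb ⊢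
      rw [hkey]; exact hS.above a ha hb
  · intro a ha f hf hdf
    rw [hnode a (hSv a ha), hkey]
    by_cases hfv : g.target f = v
    · rw [hfv, Function.update_self, Function.update_self]
      rcases hS.closed a ha f hf hdf with ⟨rfl, h⟩ | h
      · rcases List.mem_cons.1 h with rfl | h
        · exact .inr ⟨hbc, le_rfl⟩
        · exact .inl ⟨rfl, h⟩
      · rw [hfv] at h
        exact .inr ⟨hbc, (hle h.1).trans h.2⟩
    · rw [hnode _ hfv, hkey]
      rcases hS.closed a ha f hf hdf with ⟨rfl, h⟩ | h
      · rcases List.mem_cons.1 h with rfl | h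
        · exact absurd rfl hfv
        · exact .inl ⟨rfl, h⟩
      · exact .inr h
  -- The invariant does not record that the source is settled; if it were relabelled, its new label
  -- would still be at most its old label 0.
  · by_cases hhv : h = v
    · rw [hhv, Function.update_self, Function.update_self]
      have h0 := hS.source
      rw [hhv] at h0
      exact ⟨hbc, le_antisymm ((hle h0.1).trans h0.2.le) zero_le⟩
    · rw [hnode h hhv, hkey]; exact hS.source

/-- All unsettled labelled vertices have their nodes in the heap, so the minimum separates settled
from unsettled labels. The outgoing edges of the new vertex become the ones still to be relaxed. -/
theorem settle {x w : ℕ} {H' : Multiset ℕ}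
    (hS : SearchInv g h base count item node key S (x ::ₘ H') cur w [])
    (hnd : (x ::ₘ H').Nodup) (hf : node (item x) = x)
    (hmin : ∀ y ∈ x ::ₘ H', key x ≤ key y) :
    item x ∉ S ∧
    SearchInv g h base count item node key (S ++ [item x]) H' (key x) (item x)
      (g.adj (item x)) := by
  have hxH : x ∈ x ::ₘ H' := Multiset.mem_cons_self _ _
  have hbx := (hS.range x hxH).1
  have hbx' : base < node (item x) := by rwa [hf]
  have hnS : item x ∉ S := fun hm => (hS.settled _ hm).2 (by rw [hf]; exact hxH)
  have hcur : cur ≤ key x := by have := hS.above _ hnS hbx'; rwa [hf] at this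
  refine ⟨hnS, hS.node_le, fun y hy => hS.range y (by simp [hy]), ?_, ?_, ?_, hS.walk, ?_, ?_, ?_,
    hS.source⟩
  · intro v hv
    refine ⟨(hS.item v hv).1, (hS.item v hv).2.1, fun hvS => ?_⟩
    simp only [List.mem_append, List.mem_singleton, not_or] at hvS
    have := (hS.item v hv).2.2 hvS.1
    rcases Multiset.mem_cons.1 this with e | h
    · exact absurd (by rw [← (hS.item v hv).1, e]) hvS.2
    · exact h
  · intro v hv
    rcases List.mem_append.1 hv with hv | hv
    · exact ⟨(hS.settled v hv).1, fun h => (hS.settled v hv).2 (by simp [h])⟩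
    · rw [List.mem_singleton] at hv
      rw [hv]
      refine ⟨hbx', ?_⟩
      rw [hf]; exact (Multiset.nodup_cons.1 hnd).1
  · rw [List.nodup_append]
    refine ⟨hS.nodup, List.nodup_singleton _, fun a ha b hb => ?_⟩
    rw [List.mem_singleton] at hb
    rintro rfl; exact hnS (hb ▸ ha)
  · intro v hv
    rcases List.mem_append.1 hv with hv | hv
    · exact (hS.below v hv).trans hcur
    · rw [List.mem_singleton] at hv
      rw [hv, hf]
  · intro v hv hb
    simp only [List.mem_append, not_or] at hv
    exact hmin _ ((hS.item v hb).2.2 hv.1)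
  · intro a ha e he hd
    rcases List.mem_append.1 ha with ha | ha
    · rcases hS.closed a ha e he hd with ⟨-, h⟩ | h
      · simp at h
      · exact .inr h
    · rw [List.mem_singleton] at ha
      subst ha
      exact .inl ⟨rfl, he⟩

/-- All older nodes have numbers at most `c`, so taking `c` as the base erases every label of
earlier searches at no cost. -/
theorem init {c : ℕ} {item node : ℕ → ℕ} {key : ℕ → ℝ≥0} (hnode : ∀ v, node v ≤ c) (hh : h < g.n) :
    SearchInv g h c (c + 1) (Function.update item (c + 1) h) (Function.update node h (c + 1))
      (Function.update key (c + 1) 0) [] {c + 1} 0 0 [] := by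
  have hv : ∀ v, c < Function.update node h (c + 1) v → v = h := by
    intro v hv
    by_contra hne
    rw [Function.update_of_ne hne] at hv
    exact absurd (hnode v) (by omega)
  refine ⟨?_, ?_, ?_, by simp, List.nodup_nil, ?_, by simp, fun _ _ _ => zero_le, by simp,
    by simp⟩
  · intro v
    by_cases hvh : v = h
    · rw [hvh, Function.update_self]
    · rw [Function.update_of_ne hvh]; exact (hnode v).trans (Nat.le_succ _)
  · intro x hx
    rw [Multiset.mem_singleton] at hx
    omega
  · intro v hv'
    rw [hv v hv', Function.update_self, Function.update_self]
    exact ⟨rfl, hh, fun _ => by simp⟩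
  · intro v hv'
    rw [hv v hv', Function.update_self, Function.update_self]
    exact .nil

/-- With an empty heap every labelled vertex is settled. By `closed`, induction along a walk shows
that its end is settled with a label at most the length of the walk; `walk` shows that labels are
attained. -/
theorem isResult (hS : SearchInv g h base count item node key S 0 cur u []) :
    g.IsResult h (S.map fun v => (v, key (node v))) := by
  refine ⟨by simpa [Function.comp_def] using hS.nodup, ?_, ?_⟩
  · intro p hp
    obtain ⟨v, hv, rfl⟩ := List.mem_map.1 hp
    exact hS.walk v (hS.settled v hv).1
  · have hmem : ∀ v, base < node v → v ∈ S := by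
      intro v hv
      by_contra hvS
      simpa using (hS.item v hv).2.2 hvS
    intro v d hw
    suffices v ∈ S ∧ key (node v) ≤ d from ⟨_, this.2, List.mem_map.2 ⟨v, this.1, rfl⟩⟩
    induction hw with
    | nil => exact ⟨hmem h hS.source.1, hS.source.2.le⟩
    | snoc hw he hd ih =>
      rcases hS.closed _ ih.1 _ he hd with ⟨-, h⟩ | h
      · simp at h
      · exact ⟨hmem _ h.1, h.2.trans (add_le_add_left ih.2 _)⟩

end SearchInv

/-- Create a node for the vertex `iV` with key `rD`, rank `iR` and first child `iC`. -/
def create : Prog :=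
  .nset iCount (.succ (.var iCount)) ;;
  .nput aItem (.var iCount) (.var iV) ;;
  .rput rKey (.var iCount) (.var rD) ;;
  .nput aRank (.var iCount) (.var iR) ;;
  .nput aFirst (.var iCount) (.var iC) ;;
  .nput aNode (.var iV) (.var iCount) ;;
  push (.var iCount)

/-- Relax the edge `iE` from the vertex of the node `iBest`. -/
def relax : Prog :=
  .nset iV (.arr aTarget (.var iE)) ;;
  .cond (.nle (.arr aDepth (.var iSource)) (.arr aDepth (.var iV)))
    (.rset rD (.add (.arr rKey (.var iBest)) (.arr rWeight (.pred (.var iE)))) ;;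
      .cond (.nle (.arr aNode (.var iV)) (.var iBase))
        (.nset iR (.lit 0) ;; .nset iC (.lit 0) ;; create)
        (.nset iY (.arr aNode (.var iV)) ;;
          .cond (.rle (.arr rKey (.var iY)) (.var rD)) .skip
            (.nset iR (.pred (.pred (.arr aRank (.var iY)))) ;;
              .nset iC (.arr aSib (.arr aSib (.arr aFirst (.var iY)))) ;; create)))
    .skip ;;
  .nset iE (.arr aNext (.var iE))

/-- Relax the edges from the vertex of the node `iBest`. -/
def relaxAll : Prog :=
  .nset iE (.arr aHead (.arr aItem (.var iBest))) ;;
  .loop (.not (.neq (.var iE) (.lit 0))) relax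

/-- Append an entry to the log. -/
def record : Prog :=
  .nput aLogHub (.var iLog) (.var iSource) ;;
  .nput aLogItem (.var iLog) (.arr aItem (.var iBest)) ;;
  .rput rLogDist (.var iLog) (.arr rKey (.var iBest)) ;;
  .nset iLog (.succ (.var iLog))

/-- The search from `iSource`. -/
def search : Prog :=
  .nset iBase (.var iCount) ;; .nset iV (.var iSource) ;; .rset rD .zero ;; .nset iR (.lit 0) ;;
  .nset iC (.lit 0) ;; create ;; findMin ;;
  .loop (.not (.neq (.var iBest) (.lit 0))) (pushKids ;; record ;; relaxAll ;; findMin)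

/-- The search from every vertex. -/
def searchAll : Prog :=
  .nset iSource (.lit 0) ;;
  .loop (.not (.nle (.var iN) (.var iSource))) (search ;; .nset iSource (.succ (.var iSource)))

/-- The log, a list of triples of a source, a vertex reached from it and a distance. -/
def logOf (s : State) : List (ℕ × ℕ × ℝ≥0) :=
  (List.range (s.nv iLog)).map fun i => (s.na aLogHub i, s.na aLogItem i, s.ra rLogDist i)

/-- The search invariant read off from the memory. -/
abbrev SearchAt (s : State) (g : SearchGraph) (S : List ℕ) (H : Multiset ℕ) (cur : ℝ≥0)
    (u : ℕ) (rem : List ℕ) : Prop :=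
  SearchInv g (s.nv iSource) (s.nv iBase) (s.nv iCount) (s.na aItem) (s.na aNode) (s.ra rKey)
    S H cur u rem

/-- Of the 110 units, 80 are the potential of the node created, which is also a pending root; the
rest pays for the steps. -/
theorem relax_spec {s : State} {c : ℕ} {g : SearchGraph} {kids : ℕ → List ℕ} {H : Multiset ℕ}
    {S : List ℕ} {cur : ℝ≥0} {u : ℕ} {rem : List ℕ} (hg : GraphAt s g)
    (h : HeapAt s kids H (pending s)) (hS : SearchAt s g S H cur u (s.nv iE :: rem))
    (hu : u ∈ S) (he : s.nv iE ∈ g.adj u) (hbest : s.nv iBest = s.na aNode u)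
    (hcur : s.ra rKey (s.na aNode u) = cur) :
    wp relax (fun s' c' => ∃ kids' H', HeapAt s' kids' H' (pending s') ∧
      SearchAt s' g S H' cur u rem ∧
      (∀ a ∈ S, s'.na aNode a = s.na aNode a ∧
        s'.ra rKey (s.na aNode a) = s.ra rKey (s.na aNode a)) ∧
      s'.nv iCount ≤ s.nv iCount + 1 ∧ s'.nv iE = g.next (s.nv iE) ∧
      c' + 50 * H'.card + 30 * s'.nv iPend ≤ c + 50 * H.card + 30 * s.nv iPend + 110) s c := by
  obtain ⟨hgn, hgh, hgx, hgt, hgd, hgw⟩ := hg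
  set e := s.nv iE with hes
  set z := s.nv iCount + 1 with hz
  have hzH : z ∉ H := fun hm => by have := (hS.range z hm).2; omega
  have hz0 : z ≠ 0 := by omega
  have hzero := hS.node_le
  simp only [relax, create, push, wp_seq, wp_nset, wp_nput, wp_rset, wp_rput, wp_cond, wp_skip,
    NExpr.eval, RExpr.eval, Test.Holds]
  simp [-exists_and_right, -exists_and_left, HeapAt, SearchAt, pending, entries_succ, ← hes, ← hz,
    hgt, hgd, hgw, hgx]
  refine ⟨fun hd => ⟨fun hn => ?_, fun hn => ⟨fun hk => ?_, fun hk => ?_⟩⟩, fun hd => ?_⟩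
  · have hv : g.target e ∉ S := fun hm => by have := (hS.settled _ hm).1; omega
    have hnH : s.na aNode (g.target e) ∉ H := fun hm => by have := (hS.range _ hm).1; omega
    refine ⟨_, _, h.insert hzH hz0 hnH, ?_, ?_, by simp; omega⟩
    · rw [hbest]
      exact hS.relabel hu he hcur hd hv fun hb => by omega
    · rw [hbest]
      exact fun a ha => hS.label_eq hv ha
  · rw [hbest] at hk
    exact ⟨kids, H, h, hS.skip fun _ => ⟨hn, hk⟩, by omega⟩
  · rw [hbest] at hk ⊢
    -- Settled labels are at most `cur`, the label of `u`, so an edge out of `u` cannot improve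
    -- them: settled vertices never return to the heap.
    have hv : g.target e ∉ S := fun hm => by
      have := hS.below _ hm
      rw [← hcur] at this
      exact absurd (this.trans le_self_add) (not_le.2 hk)
    obtain ⟨hi, -, hm⟩ := hS.item _ hn
    refine ⟨_, _, h.decrease hzH hz0 (hm hv) hi hk.le, ?_, ?_, by simp; omega⟩
    · exact hS.relabel hu he hcur hd hv fun _ => hk.le
    · exact fun a ha => hS.label_eq hv ha
  · exact ⟨kids, H, h, hS.skip fun hd' => absurd hd' (not_le.2 hd), by omega⟩

/-- An edge costs the 110 units of `relax_spec` and one loop test. The stability of settled labels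
is kept because their values go into the log when they are settled. -/
theorem relaxAll_spec {s : State} {c : ℕ} {g : SearchGraph} {kids : ℕ → List ℕ}
    {H : Multiset ℕ} {S : List ℕ} {u : ℕ} (hg : GraphAt s g)
    (h : HeapAt s kids H (pending s))
    (hS : SearchAt s g S H (s.ra rKey (s.nv iBest)) u (g.adj u))
    (hu : u ∈ S) (hbest : s.nv iBest = s.na aNode u) (hitem : s.na aItem (s.nv iBest) = u) :
    wp relaxAll (fun s' c' => ∃ kids' H', HeapAt s' kids' H' (pending s') ∧
      SearchAt s' g S H' (s.ra rKey (s.nv iBest)) u [] ∧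
      (∀ a ∈ S, s'.ra rKey (s'.na aNode a) = s.ra rKey (s.na aNode a)) ∧
      s'.nv iCount ≤ s.nv iCount + (g.adj u).length ∧
      c' + 50 * H'.card + 30 * s'.nv iPend ≤
        c + 50 * H.card + 30 * s.nv iPend + 111 * (g.adj u).length + 2) s c := by
  simp only [relaxAll, wp_seq, wp_nset, NExpr.eval]
  refine wp_loop (fun s' c' => ∃ kids' H' done rem, g.adj u = done ++ rem ∧
      Chain g.next (s'.nv iE) rem ∧ HeapAt s' kids' H' (pending s') ∧
      SearchAt s' g S H' (s.ra rKey (s.nv iBest)) u rem ∧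
      (∀ a ∈ S, s'.na aNode a = s.na aNode a ∧
        s'.ra rKey (s.na aNode a) = s.ra rKey (s.na aNode a)) ∧
      s'.nv iCount ≤ s.nv iCount + done.length ∧
      c' + 50 * H'.card + 30 * s'.nv iPend ≤
        c + 50 * H.card + 30 * s.nv iPend + 111 * done.length + 1)
      (c + 50 * H.card + 30 * s.nv iPend + 111 * (g.adj u).length + 1) ?_ ?_ ?_ ?_
  · refine ⟨kids, H, [], g.adj u, rfl, ?_, ?_, ?_, by simp, by simp, by simp; omega⟩
    · have := g.chain u (hS.lt_n hu)
      simpa [hitem, hg.head] using this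
    · simpa [HeapAt, pending] using h
    · simpa [SearchAt] using hS
  · rintro s' c' ⟨_, _, _, _, hd, -, -, -, -, -, hc⟩
    rw [hd, List.length_append]; omega
  · rintro s' c' hfr ⟨kids', H', done, rem, hd, hch, h', hS', hlab, hcnt, hc⟩ hb
    simp only [Test.Holds, NExpr.eval] at hb
    have hg1 : GraphAt (s.setN iE (s.na aHead (s.na aItem (s.nv iBest)))) g := by
      exact ⟨by simpa using hg.n, hg.head, hg.next, hg.target, hg.depth, hg.weight⟩
    have hg' : GraphAt s' g := hg1.of_frame hfr (by decide)
    have hbe : s'.nv iBest = s.nv iBest := (hfr.nv _ (by decide)).trans (by simp)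
    match rem, hd, hch, hS' with
    | [], _, hch, _ => exact absurd hch hb
    | e :: rem, hd, hch, hS' =>
      obtain ⟨rfl, -, hch⟩ := hch
      have hl := hlab u hu
      refine wp_conseq (relax_spec hg' h' hS' hu (by rw [hd]; simp) ?_ ?_) ?_
      · rw [hbe, hl.1, hbest]
      · rw [hl.1, hl.2, hbest]
      · rintro s2 c2 - ⟨kids2, H2, h2, hS2, hlab2, hcnt2, hE2, hc2⟩
        refine ⟨kids2, H2, done ++ [s'.nv iE], rem, by simp [hd], by rw [hE2]; exact hch, h2, hS2,
          ?_, by simp; omega, by simp; omega⟩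
        intro a ha
        have h3 := hlab a ha
        have h4 := hlab2 a ha
        rw [h3.1] at h4
        exact ⟨h4.1, h4.2.trans h3.2⟩
  · rintro s' c' - ⟨kids', H', done, rem, hd, hch, h', hS', hlab, hcnt, hc⟩ hb
    simp only [Test.Holds, NExpr.eval, not_not] at hb
    match rem, hd, hch, hS' with
    | e :: rem, _, hch, _ => exact absurd (hch.1.symm.trans hb) hch.2.1
    | [], hd, _, hS' =>
      rw [List.append_nil] at hd
      rw [hd]
      refine ⟨kids', H', h', hS', fun a ha => ?_, hcnt, by omega⟩
      rw [(hlab a ha).1, (hlab a ha).2]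

theorem HeapInv.empty (rank fc ns item node : ℕ → ℕ) (key : ℕ → ℝ≥0) (kids : ℕ → List ℕ) :
    HeapInv rank fc ns item node key kids 0 0 :=
  ⟨Multiset.nodup_zero, by simp, by simp, by simp, by simp, by simp, by simp⟩

theorem logOf_congr {s s' : State} (h1 : s'.nv iLog = s.nv iLog)
    (h2 : s'.na aLogHub = s.na aLogHub) (h3 : s'.na aLogItem = s.na aLogItem)
    (h4 : s'.ra rLogDist = s.ra rLogDist) : logOf s' = logOf s := by
  simp only [logOf, h1, h2, h3, h4]

theorem record_spec (s : State) (c : ℕ) :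
    wp record (fun s' c' => logOf s' = logOf s ++
      [(s.nv iSource, s.na aItem (s.nv iBest), s.ra rKey (s.nv iBest))] ∧ c' = c + 4) s c := by
  simp only [record, wp_seq, wp_nset, wp_nput, wp_rput, NExpr.eval, RExpr.eval]
  refine ⟨?_, trivial⟩
  simp only [logOf]
  simp [List.range_succ]
  intro i hi
  simp [Function.update_of_ne hi.ne]

/-- A bound for the time of a search that settles the vertices `S`. -/
def searchCost (g : SearchGraph) (B : ℕ) (S : List ℕ) : ℕ :=
  (S.map fun u => 80 * (B + 1) + 111 * (g.adj u).length).sum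

theorem searchCost_eq (g : SearchGraph) (B : ℕ) (S : List ℕ) : searchCost g B S =
    80 * (B + 1) * S.length + 111 * (S.map fun u => (g.adj u).length).sum := by
  induction S with
  | nil => rfl
  | cons a S ih =>
    simp only [searchCost, List.map_cons, List.sum_cons, List.length_cons] at ih ⊢
    rw [ih]; ring

theorem searchCost_le {g : SearchGraph} {M : ℕ} (B : ℕ)
    (hM : ∀ S : List ℕ, S.Nodup → (∀ u ∈ S, u < g.n) → (S.map fun u => (g.adj u).length).sum ≤ M)
    {S : List ℕ} (hnd : S.Nodup) (hS : ∀ u ∈ S, u < g.n) :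
    searchCost g B S ≤ 80 * (B + 1) * g.n + 111 * M := by
  have h1 := hM S hnd hS
  have h3 : S.length ≤ g.n := by
    have : S.toFinset ⊆ Finset.range g.n := fun u hu =>
      Finset.mem_range.2 (hS u (List.mem_toFinset.1 hu))
    have := Finset.card_le_card this
    rwa [List.toFinset_card_of_nodup hnd, Finset.card_range] at this
  have h4 := Nat.mul_le_mul_left (80 * (B + 1)) h3
  rw [searchCost_eq]
  omega

theorem SearchGraph.Walk.lt_n {g : SearchGraph} {h v : ℕ} {d : ℝ≥0} (hw : g.Walk h v d)
    (hh : h < g.n) : v < g.n := by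
  induction hw with
  | nil => exact hh
  | snoc _ he _ ih => exact g.target_lt _ ih _ he

/-- The cost depends on the settled vertices only, apart from one initial extraction; this is what
makes searches in small subtrees cheap. -/
theorem search_spec {s : State} {c B M : ℕ} {g : SearchGraph}
    (hM : ∀ S : List ℕ, S.Nodup → (∀ u ∈ S, u < g.n) → (S.map fun u => (g.adj u).length).sum ≤ M)
    (hB : ∀ r, 2 ^ (r / 2) ≤ M + 1 → r < B) (hg : GraphAt s g) (hh : s.nv iSource < g.n)
    (hp : s.nv iPend = 0) (hz : ∀ i, s.na aSlot i = 0) (hn : ∀ v, s.na aNode v ≤ s.nv iCount) :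
    wp search (fun s' c' => ∃ l : List (ℕ × ℝ≥0),
      logOf s' = logOf s ++ l.map (fun p => (s.nv iSource, p.1, p.2)) ∧
      g.IsResult (s.nv iSource) l ∧ s'.nv iPend = 0 ∧ (∀ i, s'.na aSlot i = 0) ∧
      (∀ v, s'.na aNode v ≤ s'.nv iCount) ∧
      c' ≤ c + 40 * B + 110 + searchCost g B (l.map Prod.fst)) s c := by
  set h := s.nv iSource with hhs
  simp only [search, create, push, wp_seq, wp_nset, wp_nput, wp_rset, wp_rput, NExpr.eval,
    RExpr.eval, setN_nv, putN_nv, putR_nv, setR_nv, setR_rv, setN_rv, putN_rv, Nat.reduceEqDiff,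
    ↓reduceIte]
  set z := s.nv iCount + 1 with hzz
  -- The search starts from an empty heap laid over whatever the arrays still contain from earlier
  -- searches.
  have hheap := (HeapInv.empty (s.na aRank) (s.na aFirst) (s.na aSib) (s.na aItem) (s.na aNode)
    (s.ra rKey) fun _ => []).insert (z := z) (v := h) (c := 0) (d := 0) (by simp) (by omega)
      (by simp)
  have hsearch := SearchInv.init (g := g) (c := s.nv iCount) (item := s.na aItem)
    (key := s.ra rKey) hn hh
  -- The budget `c + 100` covers the 13 steps so far and the potential 50 + 30 of the source's node.
  refine wp_conseq (findMin_spec (kids := Function.update (fun _ => []) z []) (H := {z})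
    (X := c + 100) (B := B) ?_ ?_ ?_ ?_) ?_
  · intro r hr
    exact hB r (hr.trans (by simp))
  · simpa [HeapAt, pending, hp, ← hhs, entries_succ, ← hzz] using hheap
  · simpa using hz
  · simp [hp]
  rintro s1 c1 hfr1 ⟨kids1, H1, h1, hz1, hle1, hful1, hb1, hm1, hc1⟩
  have e4 : s1.na aItem = Function.update (s.na aItem) z h :=
    (hfr1.na _ (by decide)).trans (by simp [← hhs])
  have e5 : s1.na aNode = Function.update (s.na aNode) h z :=
    (hfr1.na _ (by decide)).trans (by simp [← hhs])
  have e6 : s1.ra rKey = Function.update (s.ra rKey) z 0 :=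
    (hfr1.ra _ (by decide)).trans (by simp)
  have e7 : s1.nv iSource = h := (hfr1.nv _ (by decide)).trans (by simp [← hhs])
  have e8 : s1.nv iBase = s.nv iCount := (hfr1.nv _ (by decide)).trans (by simp)
  have e9 : s1.nv iCount = z := (hfr1.nv _ (by decide)).trans (by simp)
  have e10 : logOf s1 = logOf s :=
    logOf_congr ((hfr1.nv _ (by decide)).trans (by simp))
      ((hfr1.na _ (by decide)).trans (by simp)) ((hfr1.na _ (by decide)).trans (by simp))
      ((hfr1.ra _ (by decide)).trans (by simp))
  have hg1 : GraphAt s1 g := by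
    refine GraphAt.of_frame (p := findMin) ?_ hfr1 (by decide)
    exact ⟨by simpa using hg.n, by simpa using hg.head, by simpa using hg.next,
      by simpa using hg.target, by simpa using hg.depth, by simpa using hg.weight⟩
  have hS1 : SearchAt s1 g [] H1 0 0 [] := by
    unfold SearchAt
    rw [e4, e5, e6, e7, e8, e9]
    refine hsearch.mono_heap hle1 ?_
    rw [e4, e5] at hful1
    exact hful1
  refine wp_loop (fun s' c' => ∃ kids H S cur u,
      HeapAt s' kids H (cell (s'.nv iBest) + pending s') ∧ SearchAt s' g S H cur u [] ∧
      (∀ i, s'.na aSlot i = 0) ∧ (s'.nv iBest = 0 → H = 0) ∧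
      (s'.nv iBest ≠ 0 → s'.na aNode (s'.na aItem (s'.nv iBest)) = s'.nv iBest ∧
        ∀ x ∈ H, s'.ra rKey (s'.nv iBest) ≤ s'.ra rKey x) ∧
      logOf s' = logOf s ++ S.map (fun v => (h, v, s'.ra rKey (s'.na aNode v))) ∧
      s'.nv iCount ≤ s'.nv iBase + 1 + (S.map fun u => (g.adj u).length).sum ∧
      c' + 50 * H.card + 30 * s'.nv iPend ≤ c + 40 * B + 105 + searchCost g B S)
      (c + 40 * B + 105 + (80 * (B + 1) * g.n + 111 * M)) ?_ ?_ ?_ ?_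
  · exact ⟨kids1, H1, [], 0, 0, h1, hS1, hz1, hb1, hm1, by simp [e10], by simp [e9, e8, hzz],
      by simp [searchCost]; omega⟩
  · rintro s' c' ⟨kids, H, S, cur, u, -, hS, -, -, -, -, -, hc⟩
    have := searchCost_le B hM hS.nodup fun u hu => hS.lt_n hu
    omega
  · rintro s2 c2 hfr ⟨kids, H, S, cur, u, hH, hS, hz2, hb2, hm2, hlog, hcnt, hc⟩ hb
    simp only [Test.Holds, NExpr.eval] at hb
    have hg2 : GraphAt s2 g := hg1.of_frame hfr (by decide)
    obtain ⟨hfull, hmin⟩ := hm2 hb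
    set x := s2.nv iBest with hx
    rw [cell_of_ne hb, Multiset.singleton_add] at hH
    have hxH := hH.mem_of_root (Multiset.mem_cons_self _ _)
    -- The search creates one node for the source and at most one per relaxed edge; this bounds the
    -- heap and thereby the ranks.
    have hHM : H.card ≤ M + 1 := by
      have h1 := hS.card_le hH.nodup
      have h2 := hM S hS.nodup fun u hu => hS.lt_n hu
      omega
    have hrB : s2.na aRank x < B :=
      hB _ ((hH.pow_rank_le (Multiset.mem_cons_self _ _)).trans hHM)
    obtain ⟨H2, rfl⟩ := Multiset.exists_cons_of_mem hxH
    obtain ⟨hnS, hS2⟩ := hS.settle hH.nodup hfull hmin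
    have hkr := hH.full x hxH hfull
    have hlen : (kids x).length = s2.na aRank x := by
      have := congrArg List.length hkr; simpa using this
    simp only [wp_seq]
    refine wp_conseq (pushKids_spec (hH.seg x hxH) hlen) ?_
    rintro s3 c3 hfr3 ⟨hp3, hn3, hc3⟩
    have hx3 : s3.nv iBest = x := hfr3.nv _ (by decide)
    have i3 : s3.na aItem = s2.na aItem := hfr3.na _ (by decide)
    have n3 : s3.na aNode = s2.na aNode := hfr3.na _ (by decide)
    have k3 : s3.ra rKey = s2.ra rKey := hfr3.ra _ (by decide)
    have s3' : s3.nv iSource = s2.nv iSource := hfr3.nv _ (by decide)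
    have l3 : logOf s3 = logOf s2 := logOf_congr (hfr3.nv _ (by decide)) (hfr3.na _ (by decide))
      (hfr3.na _ (by decide)) (hfr3.ra _ (by decide))
    have hH3 : HeapAt s3 kids H2 (pending s3) := by
      unfold HeapAt
      rw [hp3, hfr3.na aRank (by decide), hfr3.na aFirst (by decide), hfr3.na aSib (by decide),
        i3, n3, k3]
      exact hH.remove
    have hg3 : GraphAt s3 g := hg2.of_frame hfr3 (by decide)
    rw [wp_seq]
    refine wp_conseq (record_spec s3 c3) ?_
    rintro s4 c4 hfr4 ⟨l4, hc4⟩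
    have hx4 : s4.nv iBest = x := (hfr4.nv _ (by decide)).trans hx3
    have i4 : s4.na aItem = s2.na aItem := (hfr4.na _ (by decide)).trans i3
    have n4 : s4.na aNode = s2.na aNode := (hfr4.na _ (by decide)).trans n3
    have k4 : s4.ra rKey = s2.ra rKey := (hfr4.ra _ (by decide)).trans k3
    have p4 : pending s4 = pending s3 := by
      simp only [pending]
      rw [hfr4.na _ (by decide), hfr4.nv _ (by decide)]
    have np4 : s4.nv iPend = s3.nv iPend := hfr4.nv _ (by decide)
    have sh4 : s4.nv iSource = s2.nv iSource := (hfr4.nv _ (by decide)).trans s3'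
    have sb4 : s4.nv iBase = s2.nv iBase :=
      (hfr4.nv _ (by decide)).trans (hfr3.nv _ (by decide))
    have sc4 : s4.nv iCount = s2.nv iCount :=
      (hfr4.nv _ (by decide)).trans (hfr3.nv _ (by decide))
    have hH4 : HeapAt s4 kids H2 (pending s4) := by
      unfold HeapAt
      rw [p4, hfr4.na aRank (by decide), hfr4.na aFirst (by decide), hfr4.na aSib (by decide),
        hfr4.na aItem (by decide), hfr4.na aNode (by decide), hfr4.ra rKey (by decide)]
      exact hH3
    have hg4 : GraphAt s4 g := hg3.of_frame hfr4 (by decide)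
    set w := s2.na aItem x with hw
    have hS4 : SearchAt s4 g (S ++ [w]) H2 (s4.ra rKey (s4.nv iBest)) w (g.adj w) := by
      unfold SearchAt
      rw [hx4, i4, n4, k4, sh4, sb4, sc4]
      exact hS2
    rw [wp_seq]
    refine wp_conseq (relaxAll_spec hg4 hH4 hS4 (by simp) (by rw [hx4, n4, hfull])
      (by rw [hx4, i4])) ?_
    rintro s5 c5 hfr5 ⟨kids5, H5, h5, hS5, hlab5, hcnt5, hc5⟩
    have z5 : ∀ i, s5.na aSlot i = 0 := by
      intro i
      rw [hfr5.na aSlot (by decide), hfr4.na aSlot (by decide), hfr3.na aSlot (by decide)]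
      exact hz2 i
    have b5 : s5.nv iBase = s2.nv iBase := (hfr5.nv _ (by decide)).trans sb4
    have hcard5 : H5.card ≤ M + 1 := by
      have h1 := hS5.card_le h5.nodup
      have h2 := hM _ hS5.nodup fun u hu => hS5.lt_n hu
      simp only [List.map_append, List.sum_append, List.map_cons, List.map_nil, List.sum_cons,
        List.sum_nil] at h2
      omega
    refine wp_conseq (findMin_spec (X := _) (B := B) (fun r hr => hB r (hr.trans hcard5)) h5 z5
      le_rfl) ?_
    rintro s6 c6 hfr6 ⟨kids6, H6, h6, hz6, hle6, hful6, hb6, hm6, hc6⟩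
    have i6 : s6.na aItem = s5.na aItem := hfr6.na _ (by decide)
    have n6 : s6.na aNode = s5.na aNode := hfr6.na _ (by decide)
    have k6 : s6.ra rKey = s5.ra rKey := hfr6.ra _ (by decide)
    refine ⟨kids6, H6, S ++ [w], s4.ra rKey (s4.nv iBest), w, h6, ?_, hz6, hb6, hm6, ?_, ?_, ?_⟩
    · unfold SearchAt
      rw [i6, n6, k6, hfr6.nv iSource (by decide), hfr6.nv iBase (by decide),
        hfr6.nv iCount (by decide)]
      rw [i6, n6] at hful6
      exact hS5.mono_heap hle6 hful6
    · have l6 : logOf s6 = logOf s4 :=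
        logOf_congr ((hfr6.nv _ (by decide)).trans (hfr5.nv _ (by decide)))
          ((hfr6.na _ (by decide)).trans (hfr5.na _ (by decide)))
          ((hfr6.na _ (by decide)).trans (hfr5.na _ (by decide)))
          ((hfr6.ra _ (by decide)).trans (hfr5.ra _ (by decide)))
      have hlab : ∀ a ∈ S ++ [w], s6.ra rKey (s6.na aNode a) = s2.ra rKey (s2.na aNode a) := by
        intro a ha
        rw [k6, n6, hlab5 a ha, k4, n4]
      have hsrc : s3.nv iSource = h := by
        rw [s3', hfr.nv iSource (by decide), e7]
      rw [l6, l4, l3, hlog, List.append_assoc, hsrc, hx3, i3, k3, ← hw]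
      congr 1
      rw [List.map_append, List.map_singleton, hlab w (by simp), hfull]
      congr 1
      refine List.map_congr_left fun a ha => ?_
      rw [hlab a (by simp [ha])]
    · have : s6.nv iCount = s5.nv iCount := hfr6.nv _ (by decide)
      have hb6 : s6.nv iBase = s5.nv iBase := hfr6.nv _ (by decide)
      simp
      omega
    · simp only [Multiset.card_cons] at hc
      simp [searchCost] at hc ⊢
      omega
  · rintro s2 c2 hfr ⟨kids, H, S, cur, u, hH, hS, hz2, hb2, hm2, hlog, hcnt, hc⟩ hb
    simp only [Test.Holds, NExpr.eval, not_not] at hb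
    have hsrc : s2.nv iSource = h := (hfr.nv _ (by decide)).trans e7
    have hH0 := hb2 hb
    subst hH0
    have hp2 : s2.nv iPend = 0 := by
      have e := hH.eq
      simp [hb] at e
      have := congrArg Multiset.card e
      simpa [pending] using this.symm
    refine ⟨S.map fun v => (v, s2.ra rKey (s2.na aNode v)), by simp [hlog, Function.comp_def],
      ?_, hp2, hz2, hS.node_le, ?_⟩
    · rw [← hsrc]; exact hS.isResult
    · simp [Function.comp_def] at hc ⊢
      omega

/-- The bound keeps the results `l` visible: only the forest, which is not known here, limits how
often a vertex occurs in them. -/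
theorem searchAll_spec {s : State} {c B M : ℕ} {g : SearchGraph}
    (hM : ∀ S : List ℕ, S.Nodup → (∀ u ∈ S, u < g.n) → (S.map fun u => (g.adj u).length).sum ≤ M)
    (hB : ∀ r, 2 ^ (r / 2) ≤ M + 1 → r < B) (hg : GraphAt s g)
    (hp : s.nv iPend = 0) (hz : ∀ i, s.na aSlot i = 0) (hn : ∀ v, s.na aNode v ≤ s.nv iCount) :
    wp searchAll (fun s' c' => ∃ l : ℕ → List (ℕ × ℝ≥0),
      logOf s' = logOf s ++
        (List.range g.n).flatMap (fun h => (l h).map fun p => (h, p.1, p.2)) ∧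
      (∀ h < g.n, g.IsResult h (l h)) ∧ s'.nv iPend = 0 ∧ (∀ i, s'.na aSlot i = 0) ∧
      (∀ v, s'.na aNode v ≤ s'.nv iCount) ∧
      c' ≤ c + 2 + ∑ h ∈ Finset.range g.n,
        (40 * B + 112 + searchCost g B ((l h).map Prod.fst))) s c := by
  simp only [searchAll, wp_seq, wp_nset, NExpr.eval]
  -- The bound used for termination lets every search settle all vertices; the finer sum is carried
  -- by the invariant.
  refine wp_loop (fun s' c' => ∃ l : ℕ → List (ℕ × ℝ≥0),
      logOf s' = logOf s ++
        (List.range (s'.nv iSource)).flatMap (fun h => (l h).map fun p => (h, p.1, p.2)) ∧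
      (∀ h < s'.nv iSource, g.IsResult h (l h)) ∧ s'.nv iSource ≤ g.n ∧ s'.nv iPend = 0 ∧
      (∀ i, s'.na aSlot i = 0) ∧ (∀ v, s'.na aNode v ≤ s'.nv iCount) ∧
      c' ≤ c + 1 + ∑ h ∈ Finset.range (s'.nv iSource),
        (40 * B + 112 + searchCost g B ((l h).map Prod.fst)))
      (c + 1 + g.n * (40 * B + 112 + (80 * (B + 1) * g.n + 111 * M))) ?_ ?_ ?_ ?_
  · exact ⟨fun _ => [], by simp [logOf], by simp, by simp, by simpa using hp, by simpa using hz,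
      by simpa using hn, by simp⟩
  · rintro s' c' ⟨l, -, hl, hle, -, -, -, hc⟩
    have h1 : ∑ h ∈ Finset.range (s'.nv iSource),
        (40 * B + 112 + searchCost g B ((l h).map Prod.fst)) ≤
        (Finset.range (s'.nv iSource)).card •
          (40 * B + 112 + (80 * (B + 1) * g.n + 111 * M)) := by
      refine Finset.sum_le_card_nsmul _ _ _ fun h hh => ?_
      have hh := Finset.mem_range.1 hh
      have hr := hl h hh
      refine Nat.add_le_add_left (searchCost_le B hM hr.nodup fun u hu => ?_) _
      obtain ⟨p, hp, rfl⟩ := List.mem_map.1 hu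
      exact (hr.walk p hp).lt_n (hh.trans_le hle)
    rw [Finset.card_range, smul_eq_mul] at h1
    have h2 := Nat.mul_le_mul_right (40 * B + 112 + (80 * (B + 1) * g.n + 111 * M)) hle
    omega
  · rintro s1 c1 hfr ⟨l, hlog, hl, hle, hp1, hz1, hn1, hc⟩ hb
    have hg0 : GraphAt (s.setN iSource 0) g :=
      ⟨by simpa using hg.n, hg.head, hg.next, hg.target, hg.depth, hg.weight⟩
    have hg1 : GraphAt s1 g := hg0.of_frame hfr (by decide)
    simp only [Test.Holds, NExpr.eval, hg1.n, not_le] at hb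
    rw [wp_seq]
    refine wp_conseq (search_spec hM hB hg1 hb hp1 hz1 hn1) ?_
    rintro s2 c2 hfr2 ⟨r, hlog2, hr, hp2, hz2, hn2, hc2⟩
    have hsrc : s2.nv iSource = s1.nv iSource := hfr2.nv _ (by decide)
    rw [wp_nset]
    set h := s1.nv iSource with hh
    have hne : ∀ i, i < h → Function.update l h r i = l i :=
      fun i hi => Function.update_of_ne hi.ne _ _
    refine ⟨Function.update l h r, ?_, ?_, ?_, by simpa using hp2, by simpa using hz2,
      by simpa using hn2, ?_⟩
    · have e : logOf (s2.setN iSource ((NExpr.var iSource).succ.eval s2)) = logOf s2 := by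
        simp [logOf]
      rw [e, hlog2, hlog]
      simp only [setN_nv, NExpr.eval, hsrc, ↓reduceIte, List.range_succ, List.flatMap_append,
        List.flatMap_cons, List.flatMap_nil, Function.update_self, List.append_nil,
        List.append_assoc]
      congr 2
      refine List.flatMap_congr fun i hi => ?_
      rw [hne i (List.mem_range.1 hi)]
    · intro i hi
      simp [hsrc] at hi
      rcases Nat.lt_or_eq_of_le hi with hi | rfl
      · rw [hne i hi]; exact hl i hi
      · rw [Function.update_self]; exact hr
    · simp [hsrc]; omega
    · simp only [setN_nv, NExpr.eval, hsrc, ↓reduceIte, Finset.sum_range_succ,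
        Function.update_self]
      have : ∑ i ∈ Finset.range h, (40 * B + 112 + searchCost g B ((Function.update l h r i).map
          Prod.fst)) = ∑ i ∈ Finset.range h,
            (40 * B + 112 + searchCost g B ((l i).map Prod.fst)) :=
        Finset.sum_congr rfl fun i hi => by rw [hne i (Finset.mem_range.1 hi)]
      omega
  · rintro s1 c1 hfr ⟨l, hlog, hl, hle, hp1, hz1, hn1, hc⟩ hb
    have hN : s1.nv iN = g.n := by
      rw [hfr.nv iN (by decide)]; simpa using hg.n
    simp only [Test.Holds, NExpr.eval, hN, not_not] at hb
    have e := le_antisymm hle hb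
    rw [e] at hlog hl hc
    exact ⟨l, hlog, hl, hp1, hz1, hn1, by omega⟩

/-! ### Preparation and output -/

/-- Build the adjacency lists from the arrays `a` of tails and `b` of heads. -/
def buildAdj (a b : ℕ) : Prog :=
  .nset iV (.lit 0) ;;
  .loop (.not (.nle (.var iN) (.var iV)))
    (.nput aHead (.var iV) (.lit 0) ;; .nset iV (.succ (.var iV))) ;;
  .nset iE (.lit 0) ;;
  .loop (.not (.nle (.var iM) (.var iE)))
    (.nput aNext (.succ (.var iE)) (.arr aHead (.arr a (.var iE))) ;;
      .nput aTarget (.succ (.var iE)) (.arr b (.var iE)) ;;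
      .nput aHead (.arr a (.var iE)) (.succ (.var iE)) ;;
      .nset iE (.succ (.var iE)))

/-- The edges among the first `m` with tail `u`, the last first, with indices increased by one. -/
def adjList (src : ℕ → ℕ) (u : ℕ) : ℕ → List ℕ
  | 0 => []
  | e + 1 => if src e = u then (e + 1) :: adjList src u e else adjList src u e

theorem mem_adjList {src : ℕ → ℕ} {u m x : ℕ} :
    x ∈ adjList src u m ↔ ∃ e < m, x = e + 1 ∧ src e = u := by
  induction m with
  | zero => simp [adjList]
  | succ m ih =>
    have : (∃ e < m + 1, x = e + 1 ∧ src e = u) ↔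
        (x = m + 1 ∧ src m = u) ∨ ∃ e < m, x = e + 1 ∧ src e = u := by
      constructor
      · rintro ⟨e, he, h⟩
        rcases Nat.lt_succ_iff_lt_or_eq.1 he with he | rfl
        · exact .inr ⟨e, he, h⟩
        · exact .inl h
      · rintro (h | ⟨e, he, h⟩)
        · exact ⟨m, Nat.lt_succ_self m, h⟩
        · exact ⟨e, Nat.lt_succ_of_lt he, h⟩
    rw [this, ← ih]
    by_cases h : src m = u <;> simp [adjList, h]

/-- An edge has one tail, so it lengthens the list of at most one member of `S`. -/
theorem sum_length_adjList_le (src : ℕ → ℕ) (m : ℕ) {S : List ℕ} (hS : S.Nodup) :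
    (S.map fun u => (adjList src u m).length).sum ≤ m := by
  induction m with
  | zero => simp [adjList]
  | succ m ih =>
    have h1 : ∀ u, (adjList src u (m + 1)).length =
        (adjList src u m).length + if src m = u then 1 else 0 := by
      intro u
      by_cases h : src m = u <;> simp [adjList, h]
    simp only [h1, List.sum_map_add]
    have h2 : (S.map fun u => if src m = u then 1 else 0).sum ≤ 1 := by
      have := List.nodup_iff_count_le_one.1 hS (src m)
      convert this using 1
      clear ih hS this
      induction S with
      | nil => rfl
      | cons a S ih =>
        rw [List.map_cons, List.sum_cons, ih, List.count_cons, add_comm]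
        by_cases h : a = src m
        · simp [h]
        · simp [h, Ne.symm h]
    omega

theorem Chain.congr {f g : ℕ → ℕ} {l : List ℕ} {c : ℕ} (h : Chain f c l)
    (hfg : ∀ a ∈ l, g a = f a) : Chain g c l := by
  induction l generalizing c with
  | nil => exact h
  | cons a l ih =>
    refine ⟨h.1, h.2.1, ?_⟩
    rw [hfg a (by simp)]
    exact ih h.2.2 fun b hb => hfg b (by simp [hb])

theorem buildAdj_spec {s : State} {c n m a b : ℕ} (hn : s.nv iN = n) (hm : s.nv iM = m)
    (ha : a ≠ aHead ∧ a ≠ aNext ∧ a ≠ aTarget) (hb : b ≠ aHead ∧ b ≠ aNext ∧ b ≠ aTarget) :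
    wp (buildAdj a b) (fun s' c' =>
      (∀ u < n, Chain (s'.na aNext) (s'.na aHead u) (adjList (s.na a) u m)) ∧
      (∀ e < m, s'.na aTarget (e + 1) = s.na b e) ∧ c' ≤ c + 3 * n + 5 * m + 4) s c := by
  simp only [buildAdj, wp_seq, wp_nset, NExpr.eval]
  refine wp_loop (fun s' c' => (∀ u < s'.nv iV, s'.na aHead u = 0) ∧ s'.nv iV ≤ n ∧
    c' ≤ c + 3 * s'.nv iV + 1) (c + 3 * n + 1) ?_ ?_ ?_ ?_
  · simp
  · rintro s' c' ⟨-, h1, h2⟩; omega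
  · rintro s' c' hfr ⟨h1, h2, h3⟩ hb
    have hN : s'.nv iN = n := by rw [hfr.nv iN (by decide)]; simpa using hn
    simp only [Test.Holds, NExpr.eval, hN] at hb
    simp only [wp_seq, wp_nput, wp_nset, NExpr.eval]
    simp
    refine ⟨fun u hu => ?_, by omega, by omega⟩
    by_cases he : u = s'.nv iV
    · rw [he, Function.update_self]
    · rw [Function.update_of_ne he]; exact h1 u (by omega)
  · rintro s1 c1 hfr1 ⟨h1, h2, h3⟩ hb1
    have hN : s1.nv iN = n := by rw [hfr1.nv iN (by decide)]; simpa using hn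
    have hM : s1.nv iM = m := by rw [hfr1.nv iM (by decide)]; simpa using hm
    have hA : s1.na a = s.na a := (hfr1.na a (by simp [Prog.naWrites, ha])).trans (by simp)
    have hB : s1.na b = s.na b := (hfr1.na b (by simp [Prog.naWrites, hb])).trans (by simp)
    simp only [Test.Holds, NExpr.eval, hN, not_not] at hb1
    simp only [wp_seq, wp_nset, NExpr.eval]
    refine wp_loop (fun s' c' =>
      (∀ u < n, Chain (s'.na aNext) (s'.na aHead u) (adjList (s.na a) u (s'.nv iE))) ∧
      (∀ e < s'.nv iE, s'.na aTarget (e + 1) = s.na b e) ∧ s'.nv iE ≤ m ∧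
      c' ≤ c + 3 * n + 5 * s'.nv iE + 3) (c + 3 * n + 5 * m + 3) ?_ ?_ ?_ ?_
    · simp [adjList, Chain]
      exact ⟨fun u hu => h1 u (by omega), by omega⟩
    · rintro s' c' ⟨-, -, h1, h2⟩; omega
    · rintro s' c' hfr ⟨hch, htg, hle, hc⟩ hb2
      have hM' : s'.nv iM = m := by rw [hfr.nv iM (by simp [Prog.nvWrites])]; simpa using hM
      have hA' : s'.na a = s.na a :=
        (hfr.na a (by simp [Prog.naWrites, ha])).trans (by simpa using hA)
      have hB' : s'.na b = s.na b :=
        (hfr.na b (by simp [Prog.naWrites, hb])).trans (by simpa using hB)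
      simp only [Test.Holds, NExpr.eval, hM'] at hb2
      simp only [wp_seq, wp_nput, wp_nset, NExpr.eval]
      set e := s'.nv iE with he
      simp [← he, ha, hb, hA', hB']
      refine ⟨fun u hu => ?_, fun f hf => ?_, by omega, by omega⟩
      -- Earlier list members have indices at most `e`, so writing the link in cell `e + 1` leaves
      -- the old chains intact.
      · have hch' : Chain (Function.update (s'.na aNext) (e + 1) (s'.na aHead (s.na a e)))
            (s'.na aHead u) (adjList (s.na a) u e) := by
          refine (hch u hu).congr fun x hx => Function.update_of_ne ?_ _ _
          obtain ⟨f, hf, rfl, -⟩ := mem_adjList.1 hx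
          omega
        by_cases hau : s.na a e = u
        · rw [adjList, if_pos hau, hau, Function.update_self]
          refine ⟨rfl, by omega, ?_⟩
          rw [hau] at hch'
          rwa [Function.update_self]
        · rw [adjList, if_neg hau, Function.update_of_ne (Ne.symm hau)]
          exact hch'
      · by_cases hfe : f = e
        · rw [hfe, Function.update_self]
        · rw [Function.update_of_ne (by omega)]; exact htg f (by omega)
    · rintro s' c' hfr ⟨hch, htg, hle, hc⟩ hb2
      have hM' : s'.nv iM = m := by rw [hfr.nv iM (by simp [Prog.nvWrites])]; simpa using hM
      simp only [Test.Holds, NExpr.eval, hM', not_not] at hb2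
      have e := le_antisymm hle hb2
      rw [e] at hch htg hc
      exact ⟨hch, htg, by omega⟩

/-- Compute the depth of every vertex. -/
def depths : Prog :=
  .nset iV (.lit 0) ;;
  .loop (.not (.nle (.var iN) (.var iV)))
    (.nset iX (.var iV) ;; .nset iJ (.lit 0) ;;
      .loop (.not (.neq (.var iX) (.var iN)))
        (.nset iJ (.succ (.var iJ)) ;; .nset iX (.arr aParent (.var iX))) ;;
      .nput aDepth (.var iV) (.var iJ) ;; .nset iV (.succ (.var iV)))

/-- The value `n` acts as a virtual parent of all roots, at depth 0, and is where each climb stops.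
-/
theorem depths_spec {s : State} {c n : ℕ} {dep : ℕ → ℕ} (hn : s.nv iN = n) (h0 : dep n = 0)
    (hdep : ∀ v < n, s.na aParent v ≤ n ∧ dep v = dep (s.na aParent v) + 1) :
    wp depths (fun s' c' => (∀ v < n, s'.na aDepth v = dep v) ∧
      c' ≤ c + 2 + ∑ v ∈ Finset.range n, (3 * dep v + 6)) s c := by
  simp only [depths, wp_seq, wp_nset, NExpr.eval]
  have hmono : ∀ i ≤ n, ∑ v ∈ Finset.range i, (3 * dep v + 6) ≤
      ∑ v ∈ Finset.range n, (3 * dep v + 6) := fun i hi =>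
    Finset.sum_le_sum_of_subset (Finset.range_mono hi)
  refine wp_loop (fun s' c' => (∀ v < s'.nv iV, s'.na aDepth v = dep v) ∧ s'.nv iV ≤ n ∧
    c' ≤ c + 1 + ∑ v ∈ Finset.range (s'.nv iV), (3 * dep v + 6))
    (c + 1 + ∑ v ∈ Finset.range n, (3 * dep v + 6)) ?_ ?_ ?_ ?_
  · simp
  · rintro s' c' ⟨-, h1, h2⟩
    have := hmono _ h1
    omega
  · rintro s1 c1 hfr1 ⟨h1, h2, h3⟩ hb
    have hN : s1.nv iN = n := by rw [hfr1.nv iN (by decide)]; simpa using hn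
    have hP : s1.na aParent = s.na aParent := (hfr1.na _ (by decide)).trans (by simp)
    simp only [Test.Holds, NExpr.eval, hN] at hb
    simp only [wp_seq, wp_nset, NExpr.eval]
    set v := s1.nv iV with hv
    refine wp_loop (fun s' c' => s'.nv iJ + dep (s'.nv iX) = dep v ∧ s'.nv iX ≤ n ∧
      c' ≤ c1 + 3 + 3 * s'.nv iJ) (c1 + 3 + 3 * dep v) ?_ ?_ ?_ ?_
    · simp; omega
    · rintro s' c' ⟨h1, h2, h3⟩; omega
    · rintro s2 c2 hfr2 ⟨h4, h5, h6⟩ hb2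
      have hN2 : s2.nv iN = n := by rw [hfr2.nv iN (by decide)]; simpa using hN
      have hP2 : s2.na aParent = s.na aParent := by
        rw [hfr2.na _ (by decide)]; simpa using hP
      simp only [Test.Holds, NExpr.eval, hN2] at hb2
      simp only [wp_seq, wp_nset, NExpr.eval]
      simp [hP2]
      obtain ⟨h7, h8⟩ := hdep (s2.nv iX) (by omega)
      exact ⟨by omega, h7, by omega⟩
    · rintro s2 c2 hfr2 ⟨h4, h5, h6⟩ hb2
      have hN2 : s2.nv iN = n := by rw [hfr2.nv iN (by decide)]; simpa using hN
      have hV2 : s2.nv iV = v := by rw [hfr2.nv iV (by decide)]; simp [← hv]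
      have hD2 : s2.na aDepth = s1.na aDepth := (hfr2.na _ (by decide)).trans (by simp)
      simp only [Test.Holds, NExpr.eval, hN2, not_not] at hb2
      rw [hb2, h0] at h4
      simp only [wp_seq, wp_nset, wp_nput, NExpr.eval]
      simp [hV2, hD2, Finset.sum_range_succ, -Order.lt_add_one_iff]
      refine ⟨fun w hw => ?_, by omega, by omega⟩
      by_cases hwv : w = v
      · rw [hwv, Function.update_self]; omega
      · rw [Function.update_of_ne hwv]; exact h1 w (by omega)
  · rintro s1 c1 hfr1 ⟨h1, h2, h3⟩ hb
    have hN : s1.nv iN = n := by rw [hfr1.nv iN (by decide)]; simpa using hn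
    simp only [Test.Holds, NExpr.eval, hN, not_not] at hb
    have e := le_antisymm h2 hb
    rw [e] at h1 h3
    exact ⟨h1, by omega⟩

/-- Reserve as many cells for the label of each vertex as its depth. -/
def reserve (lo hi : ℕ) : Prog :=
  .nset iC (.lit 0) ;; .nset iV (.lit 0) ;;
  .loop (.not (.nle (.var iN) (.var iV)))
    (.nput lo (.var iV) (.var iC) ;; .nput hi (.var iV) (.var iC) ;;
      .nset iJ (.arr aDepth (.var iV)) ;;
      .loop (.not (.neq (.var iJ) (.lit 0)))
        (.nset iC (.succ (.var iC)) ;; .nset iJ (.pred (.var iJ))) ;;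
      .nset iV (.succ (.var iV)))

/-- Blocks begin at the partial sums of the depths. These are reached by counting, as the machine
cannot add naturals. -/
theorem reserve_spec {s : State} {c n lo hi : ℕ} (hn : s.nv iN = n) (hlh : lo ≠ hi)
    (hlo : lo ≠ aDepth) (hhi : hi ≠ aDepth) :
    wp (reserve lo hi) (fun s' c' =>
      (∀ v < n, s'.na lo v = ∑ i ∈ Finset.range v, s.na aDepth i ∧ s'.na hi v = s'.na lo v) ∧
      c' ≤ c + 3 + ∑ v ∈ Finset.range n, (3 * s.na aDepth v + 6)) s c := by
  simp only [reserve, wp_seq, wp_nset, NExpr.eval]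
  set dep := s.na aDepth with hdep
  have hmono : ∀ i ≤ n, ∑ v ∈ Finset.range i, (3 * dep v + 6) ≤
      ∑ v ∈ Finset.range n, (3 * dep v + 6) := fun i hi =>
    Finset.sum_le_sum_of_subset (Finset.range_mono hi)
  refine wp_loop (fun s' c' =>
    (∀ v < s'.nv iV, s'.na lo v = ∑ i ∈ Finset.range v, dep i ∧ s'.na hi v = s'.na lo v) ∧
    s'.nv iC = ∑ i ∈ Finset.range (s'.nv iV), dep i ∧ s'.nv iV ≤ n ∧
    c' ≤ c + 2 + ∑ v ∈ Finset.range (s'.nv iV), (3 * dep v + 6))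
    (c + 2 + ∑ v ∈ Finset.range n, (3 * dep v + 6)) ?_ ?_ ?_ ?_
  · simp
  · rintro s' c' ⟨-, -, h1, h2⟩
    have := hmono _ h1
    omega
  · rintro s1 c1 hfr1 ⟨h1, hC, h2, h3⟩ hb
    have hN : s1.nv iN = n := by rw [hfr1.nv iN (by simp [Prog.nvWrites])]; simpa using hn
    have hD : s1.na aDepth = dep :=
      (hfr1.na _ (by simp [Prog.naWrites, hlo.symm, hhi.symm])).trans (by simp [← hdep])
    simp only [Test.Holds, NExpr.eval, hN] at hb
    simp only [wp_seq, wp_nset, wp_nput, NExpr.eval]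
    set v := s1.nv iV with hv
    refine wp_loop (fun s' c' => s'.nv iC + s'.nv iJ = s1.nv iC + dep v ∧
      c' + 3 * s'.nv iJ ≤ c1 + 4 + 3 * dep v) (c1 + 4 + 3 * dep v) ?_ ?_ ?_ ?_
    · simp [← hv, hlo.symm, hhi.symm, hD]
    · rintro s' c' ⟨h1, h2⟩; omega
    · rintro s2 c2 hfr2 ⟨h4, h5⟩ hb2
      simp only [Test.Holds, NExpr.eval] at hb2
      simp only [wp_seq, wp_nset, NExpr.eval]
      simp
      omega
    · rintro s2 c2 hfr2 ⟨h4, h5⟩ hb2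
      have hV2 : s2.nv iV = v := by rw [hfr2.nv iV (by decide)]; simp [← hv]
      have hna : ∀ a, s2.na a = _ := fun a => hfr2.na a (by simp [Prog.naWrites])
      simp only [Test.Holds, NExpr.eval, not_not] at hb2
      simp only [wp_nset, NExpr.eval]
      simp [hV2, hna, hlh, Ne.symm hlh, ← hv, Finset.sum_range_succ, -Order.lt_add_one_iff]
      refine ⟨fun w hw => ?_, by omega, by omega, by omega⟩
      by_cases hwv : w = v
      · rw [hwv, Function.update_self, Function.update_self]; exact ⟨hC, rfl⟩
      · rw [Function.update_of_ne hwv, Function.update_of_ne hwv]; exact h1 w (by omega)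
  · rintro s1 c1 hfr1 ⟨h1, hC, h2, h3⟩ hb
    have hN : s1.nv iN = n := by rw [hfr1.nv iN (by simp [Prog.nvWrites])]; simpa using hn
    simp only [Test.Holds, NExpr.eval, hN, not_not] at hb
    have e := le_antisymm h2 hb
    rw [e] at h1 h3
    exact ⟨h1, by omega⟩

/-- Append the log entries from `iStart` on to the labels. -/
def emit (hi hub val : ℕ) : Prog :=
  .nset iI (.var iStart) ;;
  .loop (.not (.nle (.var iLog) (.var iI)))
    (.nset iV (.arr aLogItem (.var iI)) ;;
      .nput hub (.arr hi (.var iV)) (.arr aLogHub (.var iI)) ;;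
      .rput val (.arr hi (.var iV)) (.arr rLogDist (.var iI)) ;;
      .nput hi (.var iV) (.succ (.arr hi (.var iV))) ;;
      .nset iI (.succ (.var iI)))

/-- The entries of the log for the vertex `v`, as pairs of a source and a distance. -/
def entriesFor (D : List (ℕ × ℕ × ℝ≥0)) (v : ℕ) : List (ℕ × ℝ≥0) :=
  (D.filter fun p => p.2.1 = v).map fun p => (p.1, p.2.2)

theorem entriesFor_append (D E : List (ℕ × ℕ × ℝ≥0)) (v : ℕ) :
    entriesFor (D ++ E) v = entriesFor D v ++ entriesFor E v := by
  simp [entriesFor]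

theorem logOf_drop (s : State) (k : ℕ) : (logOf s).drop k =
    (List.range' k (s.nv iLog - k)).map
      fun i => (s.na aLogHub i, s.na aLogItem i, s.ra rLogDist i) := by
  rw [logOf, List.range_eq_range', ← List.map_drop, List.drop_range']
  simp

/-- The log is ordered by sources; this distributes it by vertices. Disjoint blocks ensure that
appending for one vertex leaves the others untouched. -/
theorem emit_spec {s : State} {c n hi hub val : ℕ} {off size : ℕ → ℕ}
    {D : List (ℕ × ℕ × ℝ≥0)} (hD : (logOf s).drop (s.nv iStart) = D)
    (hne : hi ≠ hub ∧ hi ≠ aLogHub ∧ hi ≠ aLogItem ∧ hub ≠ aLogHub ∧ hub ≠ aLogItem)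
    (hval : val ≠ rLogDist) (hitem : ∀ p ∈ D, p.2.1 < n)
    (hsize : ∀ v < n, (entriesFor D v).length ≤ size v)
    (hdisj : ∀ u < n, ∀ v < n, u ≠ v → off u + size u ≤ off v ∨ off v + size v ≤ off u)
    (hoff : ∀ v < n, s.na hi v = off v) :
    wp (emit hi hub val) (fun s' c' =>
      (∀ v < n, s'.na hi v = off v + (entriesFor D v).length ∧
        (List.range' (off v) (entriesFor D v).length).map
          (fun i => (s'.na hub i, s'.ra val i)) = entriesFor D v) ∧
      c' ≤ c + 6 * D.length + 2) s c := by
  rw [logOf_drop] at hD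
  obtain ⟨hne1, hne2, hne3, hne4, hne5⟩ := hne
  simp only [emit, wp_seq, wp_nset, NExpr.eval]
  refine wp_loop (fun s' c' => ∃ P R, D = P ++ R ∧
      R = (List.range' (s'.nv iI) (s.nv iLog - s'.nv iI)).map
        (fun i => (s.na aLogHub i, s.na aLogItem i, s.ra rLogDist i)) ∧
      (∀ v < n, s'.na hi v = off v + (entriesFor P v).length ∧
        (List.range' (off v) (entriesFor P v).length).map
          (fun i => (s'.na hub i, s'.ra val i)) = entriesFor P v) ∧
      c' ≤ c + 6 * P.length + 1) (c + 6 * D.length + 1) ?_ ?_ ?_ ?_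
  · refine ⟨[], D, rfl, by simpa using hD.symm, ?_, by simp⟩
    simpa [entriesFor] using hoff
  · rintro s' c' ⟨P, R, rfl, -, -, hc⟩
    rw [List.length_append]; omega
  · rintro s' c' hfr ⟨P, R, hPR, hR, hinv, hc⟩ hb
    have hL : s'.nv iLog = s.nv iLog := (hfr.nv _ (by simp [Prog.nvWrites])).trans (by simp)
    have hA : s'.na aLogHub = s.na aLogHub :=
      (hfr.na _ (by simp [Prog.naWrites, hne2.symm, hne4.symm])).trans (by simp)
    have hB : s'.na aLogItem = s.na aLogItem :=
      (hfr.na _ (by simp [Prog.naWrites, hne3.symm, hne5.symm])).trans (by simp)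
    have hV : s'.ra rLogDist = s.ra rLogDist :=
      (hfr.ra _ (by simp [Prog.raWrites, hval.symm])).trans (by simp)
    simp only [Test.Holds, NExpr.eval, hL] at hb
    simp only [wp_seq, wp_nset, wp_nput, wp_rput, NExpr.eval, RExpr.eval]
    set i := s'.nv iI with hi'
    obtain ⟨k, hk⟩ : ∃ k, s.nv iLog - i = k + 1 := ⟨s.nv iLog - i - 1, by omega⟩
    rw [hk, List.range'_succ, List.map_cons] at hR
    set u := s.na aLogItem i with hu
    have hun : u < n := hitem (s.na aLogHub i, u, s.ra rLogDist i) (by rw [hPR, hR]; simp)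
    -- The entry being written is itself counted in the final length for `u`, so at least one cell
    -- of its block is free.
    have hlen : off u + (entriesFor P u).length < off u + size u := by
      have := hsize u hun
      rw [hPR, hR, entriesFor_append] at this
      simp [entriesFor] at this
      simp [entriesFor]
      omega
    have hnew : ∀ v, entriesFor (P ++ [(s.na aLogHub i, u, s.ra rLogDist i)]) v =
        entriesFor P v ++ if u = v then [(s.na aLogHub i, s.ra rLogDist i)] else [] := by
      intro v
      rw [entriesFor_append]
      by_cases huv : u = v <;> simp [entriesFor, huv]
    refine ⟨P ++ [(s.na aLogHub i, u, s.ra rLogDist i)], _, ?_, rfl, ?_, ?_⟩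
    · have e : s.nv iLog - (i + 1) = k := by omega
      simp [← hi', e, hPR, hR]
    · intro v hv
      obtain ⟨hv1, hv2⟩ := hinv v hv
      rw [hnew v]
      simp [← hi', hA, hB, hV, hne1, hne1.symm, ← hu, (hinv u hun).1]
      by_cases huv : u = v
      · subst huv
        simp only [if_true, Function.update_self, List.length_singleton]
        refine ⟨by omega, ?_⟩
        rw [List.range'_1_concat, List.map_append, ← hv2]
        simp only [List.length_map, List.length_range', List.map_cons, List.map_nil,
          Function.update_self]
        congr 1
        refine List.map_congr_left fun j hj => ?_
        rw [List.mem_range'_1] at hj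
        rw [Function.update_of_ne (by omega), Function.update_of_ne (by omega)]
      · simp only [if_neg huv, Function.update_of_ne (Ne.symm huv), List.append_nil]
        refine ⟨hv1, ?_⟩
        conv_rhs => rw [← hv2]
        refine List.map_congr_left fun j hj => ?_
        rw [List.mem_range'_1] at hj
        simp only [List.length_nil, add_zero] at hj
        have h1 := hdisj u hun v hv huv
        have h2 : (entriesFor P v).length ≤ size v := by
          have := hsize v hv
          rw [hPR, entriesFor_append, List.length_append] at this
          omega
        rw [Function.update_of_ne (by omega), Function.update_of_ne (by omega)]
    · simp; omega
  · rintro s' c' hfr ⟨P, R, hPR, hR, hinv, hc⟩ hb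
    have hL : s'.nv iLog = s.nv iLog := (hfr.nv _ (by simp [Prog.nvWrites])).trans (by simp)
    simp only [Test.Holds, NExpr.eval, hL, not_not] at hb
    have e : s.nv iLog - s'.nv iI = 0 := by omega
    rw [e] at hR
    simp at hR
    rw [hR, List.append_nil] at hPR
    subst hPR
    exact ⟨hinv, by omega⟩

/-! ### Walks and elimination forests -/

namespace WDigraph

variable {n m : ℕ} {G : WDigraph n m} {S T : Set (Fin n)} {u v w : Fin n} {d d' : ℝ≥0}

theorem WalkIn.mono (h : G.WalkIn S u v d) (hST : S ⊆ T) : G.WalkIn T u v d := by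
  induction h with
  | nil hu => exact .nil (hST hu)
  | cons e hu hs hd _ ih => exact .cons e (hST hu) hs hd ih

theorem WalkIn.mem_left (h : G.WalkIn S u v d) : u ∈ S := by
  cases h <;> assumption

theorem WalkIn.mem_right (h : G.WalkIn S u v d) : v ∈ S := by
  induction h with
  | nil hu => exact hu
  | cons _ _ _ _ _ ih => exact ih

theorem WalkIn.append (h : G.WalkIn S u v d) (h' : G.WalkIn S v w d') :
    G.WalkIn S u w (d + d') := by
  induction h with
  | nil hu => simpa using h'
  | cons e hu hs hd _ ih => rw [add_assoc]; exact .cons e hu hs hd (ih h')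

/-- A walk consisting of one edge. -/
theorem WalkIn.edge (e : Fin m) (hs : G.src e ∈ S) (hd : G.dst e ∈ S) :
    G.WalkIn S (G.src e) (G.dst e) (G.weight e) := by
  simpa using WalkIn.cons e hs rfl rfl (.nil hd)

/-- The graph with all edges reversed. -/
def rev (G : WDigraph n m) : WDigraph n m where
  src := G.dst
  dst := G.src
  weight := G.weight
  no_loops e := (G.no_loops e).symm
  no_multi e f h h' := G.no_multi e f h' h

theorem WalkIn.rev (h : G.WalkIn S u v d) : G.rev.WalkIn S v u d := by
  induction h with
  | nil hu => exact .nil hu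
  | cons e hu hs hd hw ih =>
    subst hs; subst hd
    rw [add_comm]
    exact ih.append (WalkIn.edge (G := G.rev) e hw.mem_left hu)

theorem rev_walkIn : G.rev.WalkIn S v u d ↔ G.WalkIn S u v d :=
  ⟨fun h => h.rev, fun h => h.rev⟩

theorem rev_distIn (G : WDigraph n m) (S : Set (Fin n)) (u v : Fin n) :
    G.rev.distIn S v u = G.distIn S u v := by
  simp only [distIn, rev_walkIn]

theorem distIn_le (h : G.WalkIn S u v d) : G.distIn S u v ≤ d := iInf₂_le d h

theorem edges_le_sq (G : WDigraph n m) : m ≤ n * n := by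
  have : Function.Injective fun e => (G.src e, G.dst e) := fun e f h => by
    simp only [Prod.mk.injEq] at h
    exact G.no_multi e f h.1 h.2
  simpa using Fintype.card_le_of_injective _ this

end WDigraph

/-! ### Levels, hubs and labels -/

namespace ElimForest

variable {n m : ℕ} {G : WDigraph n m} (F : ElimForest G)

/-- The same forest for the reversed graph. -/
def rev : ElimForest G.rev where
  parent := F.parent
  acyclic := F.acyclic
  edge e := (F.edge e).symm

/-- The number of vertices on the path from `v` to its root. -/
noncomputable def level (v : Fin n) : ℕ := (F.rootPath v).ncard

theorem level_le_depth (v : Fin n) : F.level v ≤ F.depth :=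
  Finset.le_sup (f := fun v => (F.rootPath v).ncard) (Finset.mem_univ v)

variable {F} {a b v : Fin n}

theorem comparable (ha : IsAncestor F.parent a v) (hb : IsAncestor F.parent b v) :
    IsAncestor F.parent a b ∨ IsAncestor F.parent b a := by
  have hu : Relator.RightUnique fun x y => F.parent x = some y := by
    intro x y z hy hz
    simpa using hy.symm.trans hz
  exact (Relation.ReflTransGen.total_of_right_unique hu ha hb).symm

theorem antisymm (ha : IsAncestor F.parent a b) (hb : IsAncestor F.parent b a) : a = b := by
  rcases Relation.reflTransGen_iff_eq_or_transGen.1 ha with h | h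
  · exact h
  · exact absurd (h.trans_left hb) (F.acyclic b)

theorem rootPath_subset (h : IsAncestor F.parent a v) : F.rootPath a ⊆ F.rootPath v :=
  fun _ hx => Relation.ReflTransGen.trans h hx

/-- The root paths are nested, so if their sizes agree they coincide, and each vertex is an ancestor
of the other. -/
theorem eq_of_level_le (h : IsAncestor F.parent a v) (hl : F.level v ≤ F.level a) : a = v := by
  have h1 := Set.eq_of_subset_of_ncard_le (rootPath_subset h) hl (Set.toFinite _)
  have h2 : v ∈ F.rootPath a := by rw [h1]; exact Relation.ReflTransGen.refl
  exact antisymm h h2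

theorem level_mono (h : IsAncestor F.parent a v) : F.level a ≤ F.level v :=
  Set.ncard_le_ncard (rootPath_subset h) (Set.toFinite _)

theorem level_of_parent {p : Fin n} (h : F.parent v = some p) :
    F.level v = F.level p + 1 := by
  have e : F.rootPath v = insert v (F.rootPath p) := by
    ext x
    constructor
    · intro hx
      rcases Relation.ReflTransGen.cases_head hx with h1 | ⟨q, hq, hx⟩
      · exact .inl h1.symm
      · rw [h] at hq
        simp only [Option.some.injEq] at hq
        subst hq
        exact .inr hx
    · rintro (rfl | hx)
      · exact Relation.ReflTransGen.refl
      · exact Relation.ReflTransGen.head h hx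
  have hv : v ∉ F.rootPath p := fun hv => F.acyclic v (Relation.TransGen.head' h hv)
  rw [level, e, Set.ncard_insert_of_notMem hv (Set.toFinite _)]
  rfl

theorem level_of_root (h : F.parent v = none) : F.level v = 1 := by
  have e : F.rootPath v = {v} := by
    ext x
    constructor
    · intro hx
      rcases Relation.ReflTransGen.cases_head hx with h1 | ⟨q, hq, -⟩
      · exact h1.symm
      · rw [h] at hq; simp at hq
    · rintro rfl; exact Relation.ReflTransGen.refl
  rw [level, e, Set.ncard_singleton]

/-- If `x` is above `u`, then `x` and `h` lie on one root path, and the level decides which is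
higher. If `x` is below `u`, it is in the subtree anyway. So a depth test at each edge confines a
search to the subtree. -/
theorem mem_subtree_iff {h u x : Fin n} (hu : u ∈ F.subtree h)
    (hx : IsAncestor F.parent u x ∨ IsAncestor F.parent x u) :
    x ∈ F.subtree h ↔ F.level h ≤ F.level x := by
  refine ⟨fun hm => level_mono hm, fun hl => ?_⟩
  rcases hx with hx | hx
  · exact Relation.ReflTransGen.trans hx hu
  · rcases comparable hu hx with h1 | h1
    · exact h1
    · rw [eq_of_level_le h1 hl]; exact Relation.ReflTransGen.refl

/-- Every walk has a vertex that is an ancestor of all its vertices. -/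
theorem exists_hub {s t : Fin n} {d : ℝ≥0} (hw : G.WalkIn Set.univ s t d) :
    ∃ (h : Fin n) (a b : ℝ≥0), G.WalkIn (F.subtree h) s h a ∧ G.WalkIn (F.subtree h) h t b ∧
      a + b = d := by
  have refl : ∀ x : Fin n, x ∈ F.subtree x := fun x => Relation.ReflTransGen.refl
  induction hw with
  | @nil u hu => exact ⟨u, 0, 0, .nil (refl u), .nil (refl u), add_zero 0⟩
  | @cons u v w d e hu hs hd hw ih =>
    obtain ⟨h, a, b, ha, hb, rfl⟩ := ih
    have hvh : IsAncestor F.parent h v := ha.mem_left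
    subst hs; subst hd
    have key : G.src e ∈ F.subtree h → ∃ (h : Fin n) (a' b' : ℝ≥0),
        G.WalkIn (F.subtree h) (G.src e) h a' ∧ G.WalkIn (F.subtree h) h w b' ∧
        a' + b' = G.weight e + (a + b) := fun hm =>
      ⟨h, G.weight e + a, b, .cons e hm rfl rfl ha, hb, add_assoc _ _ _⟩
    rcases F.edge e with h1 | h1
    · rcases comparable h1 hvh with h2 | h2
      -- The new first vertex lies above the old hub and becomes the hub itself; otherwise the old
      -- hub is kept.
      · refine ⟨G.src e, 0, G.weight e + (a + b), .nil (refl _), ?_, zero_add _⟩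
        have hsub : F.subtree h ⊆ F.subtree (G.src e) := fun x hx =>
          Relation.ReflTransGen.trans hx h2
        exact .cons e (refl _) rfl rfl ((ha.mono hsub).append (hb.mono hsub))
      · exact key h2
    · exact key (Relation.ReflTransGen.trans h1 hvh)

/-- The label of `u`: the pairs of an ancestor `h` and the finite distance `D h u`. -/
noncomputable def labels (F : ElimForest G) (D : Fin n → Fin n → ℝ≥0∞) (u : Fin n) :
    Finset (Fin n × ℝ≥0) :=
  open Classical in
  (Finset.univ.filter fun h => h ∈ F.rootPath u ∧ D h u ≠ ⊤).image
    fun h => (h, (D h u).toNNReal)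

theorem mem_labels {D : Fin n → Fin n → ℝ≥0∞} {u h : Fin n} {d : ℝ≥0} :
    (h, d) ∈ F.labels D u ↔ h ∈ F.rootPath u ∧ D h u = d := by
  simp only [labels, Finset.mem_image, Finset.mem_filter, Finset.mem_univ, true_and,
    Prod.mk.injEq]
  constructor
  · rintro ⟨h', ⟨h1, h2⟩, rfl, rfl⟩
    exact ⟨h1, (ENNReal.coe_toNNReal h2).symm⟩
  · rintro ⟨h1, h2⟩
    exact ⟨h, ⟨h1, by simp [h2]⟩, rfl, by simp [h2]⟩

theorem card_labels_le (F : ElimForest G) (D : Fin n → Fin n → ℝ≥0∞) (u : Fin n) :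
    (F.labels D u).card ≤ F.level u := by
  classical
  rw [labels, level, ← Set.ncard_coe_finset]
  refine (Set.ncard_le_ncard (t := (fun h => (h, (D h u).toNNReal)) '' F.rootPath u) ?_
    (Set.toFinite _)).trans (Set.ncard_image_le (Set.toFinite _))
  intro p hp
  simp only [Finset.coe_image, Finset.coe_filter, Set.mem_image, Set.mem_ofPred_eq] at hp
  obtain ⟨h, h1, rfl⟩ := hp
  exact ⟨h, h1.2.1, rfl⟩

/-- One inequality concatenates walks through a common hub; the other cuts an arbitrary walk at the
hub given by `exists_hub`. -/
theorem isTwoHopCover_labels (F : ElimForest G) :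
    IsTwoHopCover G (F.labels fun h u => G.distIn (F.subtree h) u h)
      (F.labels fun h u => G.distIn (F.subtree h) h u) := by
  intro s t
  apply le_antisymm
  · refine le_iInf fun h => le_iInf fun a => le_iInf fun b => le_iInf fun ha => le_iInf fun hb => ?_
    rw [ENNReal.coe_add, ← (mem_labels.1 ha).2, ← (mem_labels.1 hb).2]
    simp only [WDigraph.distIn, ENNReal.iInf_add, ENNReal.add_iInf]
    refine le_iInf fun d => le_iInf fun hd => le_iInf fun d' => le_iInf fun hd' => ?_
    rw [← ENNReal.coe_add]
    exact WDigraph.distIn_le ((hd'.mono (Set.subset_univ _)).append (hd.mono (Set.subset_univ _)))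
  · refine le_iInf fun d => le_iInf fun hd => ?_
    obtain ⟨h, a, b, ha, hb, rfl⟩ := F.exists_hub hd
    have ha' := WDigraph.distIn_le ha
    have hb' := WDigraph.distIn_le hb
    have hfa := ne_top_of_le_ne_top ENNReal.coe_ne_top ha'
    have hfb := ne_top_of_le_ne_top ENNReal.coe_ne_top hb'
    refine (iInf_le_of_le h <| iInf_le_of_le (G.distIn (F.subtree h) s h).toNNReal <|
      iInf_le_of_le (G.distIn (F.subtree h) h t).toNNReal <|
      iInf_le_of_le (mem_labels.2 ⟨ha.mem_left, ?_⟩) <|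
      iInf_le_of_le (mem_labels.2 ⟨hb.mem_right, ?_⟩) le_rfl).trans ?_
    · simp [ENNReal.coe_toNNReal hfa]
    · simp [ENNReal.coe_toNNReal hfb]
    · rw [ENNReal.coe_add, ENNReal.coe_toNNReal hfa, ENNReal.coe_toNNReal hfb, ENNReal.coe_add]
      exact add_le_add ha' hb'

end ElimForest

/-- The search graph `g` represents the graph `G` with the levels of the forest `F`. -/
structure Represents {n m : ℕ} (g : SearchGraph) (G : WDigraph n m) (F : ElimForest G) :
    Prop where
  size : g.n = n
  adj : ∀ (u : Fin n) x, x ∈ g.adj u ↔ ∃ e : Fin m, x = e + 1 ∧ G.src e = u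
  target : ∀ e : Fin m, g.target (e + 1) = G.dst e
  weight : ∀ e : Fin m, g.weight e = G.weight e
  depth : ∀ v : Fin n, g.depth v = F.level v

/-! ### Searches limited by depth compute distances in subtrees -/

namespace Represents

variable {n m : ℕ} {g : SearchGraph} {G : WDigraph n m} {F : ElimForest G} {h v : Fin n}
  {d : ℝ≥0}

theorem exists_walkIn (hg : Represents g G F) {w : ℕ} (hw : g.Walk h w d) :
    ∃ v : Fin n, w = v ∧ G.WalkIn (F.subtree h) h v d := by
  induction hw with
  | nil => exact ⟨h, rfl, .nil Relation.ReflTransGen.refl⟩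
  | snoc _ he hd ih =>
    obtain ⟨u, rfl, hw⟩ := ih
    obtain ⟨e, rfl, rfl⟩ := (hg.adj u _).1 he
    rw [hg.target, hg.depth, hg.depth] at hd
    refine ⟨G.dst e, hg.target e, ?_⟩
    rw [Nat.add_sub_cancel, hg.weight]
    exact hw.append (.edge e hw.mem_right
      ((ElimForest.mem_subtree_iff hw.mem_right (F.edge e)).2 hd))

/-- The two notions of walk grow at opposite ends, hence the initial piece of length `a`. -/
theorem walk_of_walkIn (hg : Represents g G F) {u : Fin n} {a : ℝ≥0} (ha : g.Walk h u a)
    (hw : G.WalkIn (F.subtree h) u v d) : g.Walk h v (a + d) := by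
  induction hw generalizing a with
  | nil => simpa using ha
  | cons e hu hs hd hw ih =>
    subst hs; subst hd
    have h1 := SearchGraph.Walk.snoc ha ((hg.adj _ _).2 ⟨e, rfl, rfl⟩) (by
      rw [hg.target, hg.depth, hg.depth]; exact ElimForest.level_mono hw.mem_left)
    rw [hg.target, Nat.add_sub_cancel, hg.weight] at h1
    rw [← add_assoc]
    exact ih h1

theorem walk_iff (hg : Represents g G F) :
    g.Walk h v d ↔ G.WalkIn (F.subtree h) h v d := by
  constructor
  · intro hw
    obtain ⟨v', hv, hw⟩ := hg.exists_walkIn hw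
    rwa [Fin.ext hv]
  · intro hw
    simpa using hg.walk_of_walkIn .nil hw

/-- The result contains an attained length below every walk length, so the infimum is a minimum; a
finite distance supplies a walk and hence an entry. -/
theorem mem_result_iff (hg : Represents g G F) {l : List (ℕ × ℝ≥0)} (hl : g.IsResult h l) :
    ((v : ℕ), d) ∈ l ↔ v ∈ F.subtree h ∧ G.distIn (F.subtree h) h v = d := by
  have key : ∀ d, ((v : ℕ), d) ∈ l → v ∈ F.subtree h ∧ G.distIn (F.subtree h) h v = d := by
    intro d hm
    have hw := hg.walk_iff.1 (hl.walk _ hm)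
    refine ⟨hw.mem_right, le_antisymm (WDigraph.distIn_le hw) ?_⟩
    refine le_iInf fun d' => le_iInf fun hd' => ?_
    obtain ⟨d2, hle, hm2⟩ := hl.le v d' (hg.walk_iff.2 hd')
    have := List.inj_on_of_nodup_map hl.nodup hm hm2 rfl
    simp only [Prod.mk.injEq, true_and] at this
    rw [this]
    exact_mod_cast hle
  refine ⟨key d, fun ⟨_, hd⟩ => ?_⟩
  have : ∃ d', G.WalkIn (F.subtree h) h v d' := by
    by_contra hno
    push Not at hno
    have : G.distIn (F.subtree h) h v = ⊤ := by
      simp [WDigraph.distIn, hno]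
    simp [this] at hd
  obtain ⟨d', hd'⟩ := this
  obtain ⟨d2, -, hm2⟩ := hl.le v d' (hg.walk_iff.2 hd')
  have := (key d2 hm2).2
  rw [hd, ENNReal.coe_inj] at this
  rwa [this]

end Represents

/-! ### The whole algorithm -/

/-- Compute the labels, for the edges with tails in `a` and heads in `b`, from the search from every
vertex. -/
def phase (a b lo hi hub val : ℕ) : Prog :=
  .nset iStart (.var iLog) ;; buildAdj a b ;; searchAll ;; reserve lo hi ;; emit hi hub val

/-- The log of the searches from all vertices with the results `l`. -/
def logFor (n : ℕ) (l : ℕ → List (ℕ × ℝ≥0)) : List (ℕ × ℕ × ℝ≥0) :=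
  (List.range n).flatMap fun h => (l h).map fun p => (h, p.1, p.2)

theorem mem_logFor {n h v : ℕ} {d : ℝ≥0} {l : ℕ → List (ℕ × ℝ≥0)} :
    (h, v, d) ∈ logFor n l ↔ h < n ∧ (v, d) ∈ l h := by
  simp [logFor]

theorem mem_entriesFor {D : List (ℕ × ℕ × ℝ≥0)} {h v : ℕ} {d : ℝ≥0} :
    (h, d) ∈ entriesFor D v ↔ (h, v, d) ∈ D := by
  simp only [entriesFor, List.mem_map, List.mem_filter, decide_eq_true_eq, Prod.mk.injEq]
  constructor
  · rintro ⟨⟨h', v', d'⟩, ⟨hm, rfl⟩, rfl, rfl⟩; exact hm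
  · intro hm; exact ⟨(h, v, d), ⟨hm, rfl⟩, rfl, rfl⟩

theorem nodup_logFor {g : SearchGraph} {n : ℕ} {l : ℕ → List (ℕ × ℝ≥0)}
    (hl : ∀ h < n, g.IsResult h (l h)) : (logFor n l).Nodup := by
  rw [logFor, List.nodup_flatMap]
  constructor
  · intro h hh
    refine ((hl h (List.mem_range.1 hh)).nodup.of_map).map ?_
    rintro ⟨a, b⟩ ⟨a', b'⟩ hab
    simpa using hab
  · refine List.nodup_range.imp ?_
    intro a b hab x hx hy
    simp only [List.mem_map] at hx hy
    obtain ⟨p, -, rfl⟩ := hx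
    obtain ⟨q, -, hq⟩ := hy
    simp only [Prod.mk.injEq] at hq
    exact hab hq.1.symm

theorem nodup_entriesFor {D : List (ℕ × ℕ × ℝ≥0)} (hD : D.Nodup) (v : ℕ) :
    (entriesFor D v).Nodup := by
  refine (hD.filter _).map_on ?_
  rintro ⟨a, b, d⟩ hx ⟨a', b', d'⟩ hy hxy
  simp only [List.mem_filter, decide_eq_true_eq] at hx hy
  simp only [Prod.mk.injEq] at hxy ⊢
  exact ⟨hxy.1, hx.2.trans hy.2.symm, hxy.2⟩

/-- Together with `sum_map_item` this exchanges the order of summation: costs arising per search are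
regrouped by the vertex settled. -/
theorem sum_logFor (n : ℕ) (l : ℕ → List (ℕ × ℝ≥0)) (f : ℕ → ℕ) :
    ((logFor n l).map fun p => f p.2.1).sum =
      ∑ h ∈ Finset.range n, (((l h).map Prod.fst).map f).sum := by
  induction n with
  | zero => simp [logFor]
  | succ n ih =>
    rw [Finset.sum_range_succ, ← ih, logFor, List.range_succ, List.flatMap_append, List.map_append,
      List.sum_append]
    simp [logFor, Function.comp_def]

theorem sum_map_item {D : List (ℕ × ℕ × ℝ≥0)} {n : ℕ} (hD : ∀ p ∈ D, p.2.1 < n) (f : ℕ → ℕ) :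
    (D.map fun p => f p.2.1).sum =
      ∑ v ∈ Finset.range n, (entriesFor D v).length * f v := by
  induction D with
  | nil => simp [entriesFor]
  | cons p D ih =>
    have h1 : ∀ v, (entriesFor (p :: D) v).length * f v =
        (if v = p.2.1 then f v else 0) + (entriesFor D v).length * f v := by
      intro v
      by_cases h : p.2.1 = v
      · simp [entriesFor, h]; ring
      · simp [entriesFor, h, Ne.symm h]
    simp only [List.map_cons, List.sum_cons, h1, Finset.sum_add_distrib,
      Finset.sum_ite_eq', Finset.mem_range, hD p (by simp), if_true]
    rw [ih fun q hq => hD q (by simp [hq])]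

/-- Both sides are free of repetitions, so comparing members is enough. -/
theorem Represents.entriesFor_eq {n m : ℕ} {g : SearchGraph} {G : WDigraph n m}
    {F : ElimForest G} (hg : Represents g G F) {l : ℕ → List (ℕ × ℝ≥0)}
    (hl : ∀ h < n, g.IsResult h (l h)) (v : Fin n) :
    (entriesFor (logFor n l) v : Multiset (ℕ × ℝ≥0)) =
      (F.labels (fun h u => G.distIn (F.subtree h) h u) v).val.map
        fun p => ((p.1 : ℕ), p.2) := by
  have hinj : Function.Injective fun p : Fin n × ℝ≥0 => ((p.1 : ℕ), p.2) := by
    rintro ⟨a, b⟩ ⟨a', b'⟩ hab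
    simp only [Prod.mk.injEq] at hab ⊢
    exact ⟨Fin.ext hab.1, hab.2⟩
  refine (Multiset.Nodup.ext (Multiset.coe_nodup.2 (nodup_entriesFor (nodup_logFor hl) v))
    ((Finset.nodup _).map hinj)).2 ?_
  rintro ⟨h, d⟩
  rw [Multiset.mem_coe, mem_entriesFor, mem_logFor, Multiset.mem_map]
  constructor
  · rintro ⟨hh, hm⟩
    have := (hg.mem_result_iff (h := ⟨h, hh⟩) (hl h hh)).1 hm
    exact ⟨(⟨h, hh⟩, d), ElimForest.mem_labels.2 this, rfl⟩
  · rintro ⟨⟨h', d'⟩, hm, he⟩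
    simp only [Prod.mk.injEq] at he
    obtain ⟨rfl, rfl⟩ := he
    have hm' := (ElimForest.mem_labels (D := fun h u => G.distIn (F.subtree h) h u)).1 hm
    exact ⟨h'.2, (hg.mem_result_iff (hl h' h'.2)).2 hm'⟩

/-- The memory of the priority queue is clean. -/
structure Clean (s : State) : Prop where
  pend : s.nv iPend = 0
  slot : ∀ i, s.na aSlot i = 0
  node : ∀ v, s.na aNode v ≤ s.nv iCount

/-- The input of a phase. -/
structure PhaseInput {n m : ℕ} (s : State) (G : WDigraph n m) (F : ElimForest G) (a b : ℕ) :
    Prop where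
  size : s.nv iN = n
  edges : s.nv iM = m
  src : ∀ e : Fin m, s.na a e = G.src e
  dst : ∀ e : Fin m, s.na b e = G.dst e
  weight : ∀ e : Fin m, s.ra rWeight e = G.weight e
  depth : ∀ v : Fin n, s.na aDepth v = F.level v

theorem ElimForest.level_pos {n m : ℕ} {G : WDigraph n m} (F : ElimForest G) (v : Fin n) :
    1 ≤ F.level v :=
  Nat.one_le_iff_ne_zero.2 fun h0 => by
    have := (Set.ncard_eq_zero (Set.toFinite _)).1 h0
    have h1 : v ∈ F.rootPath v := Relation.ReflTransGen.refl
    rw [this] at h1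
    exact h1

/-- The memory after `buildAdj` represents the graph. -/
theorem exists_represents {n m a b : ℕ} {s s' : State} {G : WDigraph n m} {F : ElimForest G}
    (h : PhaseInput s G F a b)
    (hch : ∀ u < n, Chain (s'.na aNext) (s'.na aHead u) (adjList (s.na a) u m))
    (htg : ∀ e < m, s'.na aTarget (e + 1) = s.na b e) (hn : s'.nv iN = n)
    (hw : s'.ra rWeight = s.ra rWeight) (hd : s'.na aDepth = s.na aDepth) :
    ∃ g : SearchGraph, GraphAt s' g ∧ Represents g G F ∧ g.adj = fun u => adjList (s.na a) u m := by
  refine ⟨⟨n, s'.na aHead, s'.na aNext, s'.na aTarget, s'.na aDepth, s'.ra rWeight,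
    fun u => adjList (s.na a) u m, hch, ?_⟩, ⟨hn, rfl, rfl, rfl, rfl, rfl⟩,
    ⟨rfl, ?_, ?_, ?_, ?_⟩, rfl⟩
  · intro u _ e he
    obtain ⟨f, hf, rfl, -⟩ := mem_adjList.1 he
    rw [htg f hf, h.dst ⟨f, hf⟩]
    exact Fin.is_lt _
  · intro u x
    rw [mem_adjList]
    constructor
    · rintro ⟨e, he, rfl, hs⟩
      refine ⟨⟨e, he⟩, rfl, Fin.ext ?_⟩
      rw [← hs, h.src ⟨e, he⟩]
    · rintro ⟨e, rfl, rfl⟩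
      exact ⟨e, e.2, rfl, h.src e⟩
  · intro e
    simp only
    rw [htg e e.2, h.dst e]
  · intro e
    simp only
    rw [hw, h.weight e]
  · intro v
    simp only
    rw [hd, h.depth v]

/-- Since only the ancestors of `u` settle `u`, the entries for `u` number at most `k`. The same
bound controls the search time and guarantees that the reserved cells suffice. -/
theorem phase_spec {n m a b lo hi hub val c B k : ℕ} {s : State} {G : WDigraph n m}
    {F : ElimForest G} (hin : PhaseInput s G F a b) (hcl : Clean s)
    (hB : ∀ r, 2 ^ (r / 2) ≤ m + 1 → r < B) (hk : ∀ v, F.level v ≤ k)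
    (hab : (a = 1 ∧ b = 2) ∨ (a = 2 ∧ b = 1))
    (hout : (lo = 3 ∧ hi = 4 ∧ hub = 5 ∧ val = 1) ∨ (lo = 6 ∧ hi = 7 ∧ hub = 8 ∧ val = 2)) :
    wp (phase a b lo hi hub val) (fun s' c' =>
      Stores s' lo hi hub val (F.labels fun h u => G.distIn (F.subtree h) h u) ∧ Clean s' ∧
      c' ≤ c + 400 * (k * (n * (B + 1) + m)) + 20) s c := by
  have hapos : a ≠ aHead ∧ a ≠ aNext ∧ a ≠ aTarget := by omega
  have hbpos : b ≠ aHead ∧ b ≠ aNext ∧ b ≠ aTarget := by omega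
  simp only [phase, wp_seq, wp_nset, NExpr.eval]
  refine wp_conseq (buildAdj_spec (n := n) (m := m) (by simpa using hin.size)
    (by simpa using hin.edges) hapos hbpos) ?_
  rintro s1 c1 hfr1 ⟨hch, htg, hc1⟩
  rw [setN_na] at hch htg
  have hmN : s1.nv iN = n :=
    (hfr1.nv _ (by simp [buildAdj, Prog.nvWrites])).trans (by simpa using hin.size)
  have hmD : s1.na aDepth = s.na aDepth :=
    (hfr1.na _ (by simp [buildAdj, Prog.naWrites])).trans (by simp)
  have hmW : s1.ra rWeight = s.ra rWeight :=
    (hfr1.ra _ (by simp [buildAdj, Prog.raWrites])).trans (by simp)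
  obtain ⟨g, hg, hrep, hadj⟩ := exists_represents hin hch htg hmN hmW hmD
  have hlog1 : logOf s1 = logOf s := by
    refine logOf_congr ?_ ?_ ?_ ?_
    · exact (hfr1.nv _ (by simp [buildAdj, Prog.nvWrites])).trans (by simp)
    · exact (hfr1.na _ (by simp [buildAdj, Prog.naWrites])).trans (by simp)
    · exact (hfr1.na _ (by simp [buildAdj, Prog.naWrites])).trans (by simp)
    · exact (hfr1.ra _ (by simp [buildAdj, Prog.raWrites])).trans (by simp)
  have hM : ∀ S : List ℕ, S.Nodup → (∀ u ∈ S, u < g.n) →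
      (S.map fun u => (g.adj u).length).sum ≤ m := by
    intro S hS _
    rw [hadj]
    exact sum_length_adjList_le _ _ hS
  rw [wp_seq]
  refine wp_conseq (searchAll_spec (s := s1) hM hB hg ?_ ?_ ?_) ?_
  · exact (hfr1.nv _ (by simp [buildAdj, Prog.nvWrites])).trans (by simpa using hcl.pend)
  · rw [hfr1.na aSlot (by simp [buildAdj, Prog.naWrites])]; exact hcl.slot
  · rw [hfr1.na aNode (by simp [buildAdj, Prog.naWrites]),
      hfr1.nv iCount (by simp [buildAdj, Prog.nvWrites])]
    exact hcl.node
  rintro s2 c2 hfr2 ⟨l, hlog2, hl, hp2, hz2, hn2, hc2⟩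
  rw [hrep.size] at hlog2 hl hc2
  rw [hlog1] at hlog2
  change logOf s2 = logOf s ++ logFor n l at hlog2
  set D := logFor n l with hD
  have hmN2 : s2.nv iN = n := (hfr2.nv _ (by decide)).trans hmN
  have hmD2 : s2.na aDepth = s.na aDepth := (hfr2.na _ (by decide)).trans hmD
  rw [wp_seq]
  refine wp_conseq (reserve_spec (lo := lo) (hi := hi) hmN2 (by omega) (by omega) (by omega)) ?_
  rintro s3 c3 hfr3 ⟨hres, hc3⟩
  have hna3 : ∀ x, x ≠ lo → x ≠ hi → s3.na x = s2.na x := fun x h1 h2 =>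
    hfr3.na x (by simp [reserve, Prog.naWrites, h1, h2])
  have hnv3 : ∀ x, x ≠ iC → x ≠ iV → x ≠ iJ → s3.nv x = s2.nv x := fun x h1 h2 h3 =>
    hfr3.nv x (by simp [reserve, Prog.nvWrites, h1, h2, h3])
  have hra3 : s3.ra = s2.ra := funext fun x => hfr3.ra x (by simp [reserve, Prog.raWrites])
  have hlog3 : logOf s3 = logOf s ++ D := by
    rw [← hlog2]
    exact logOf_congr (hnv3 _ (by decide) (by decide) (by decide))
      (hna3 _ (by omega) (by omega)) (hna3 _ (by omega) (by omega)) (by rw [hra3])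
  have hst : s3.nv iStart = (logOf s).length := by
    rw [hnv3 _ (by decide) (by decide) (by decide), hfr2.nv iStart (by decide),
      hfr1.nv iStart (by simp [buildAdj, Prog.nvWrites])]
    simp [logOf]
  have hitem : ∀ p ∈ D, p.2.1 < n := by
    rintro ⟨h, v, d⟩ hp
    obtain ⟨hh, hm⟩ := mem_logFor.1 hp
    have := ((hl h hh).walk _ hm).lt_n (by rw [hrep.size]; exact hh)
    rwa [hrep.size] at this
  have hlen : ∀ v : Fin n, (entriesFor D v).length ≤ F.level v := by
    intro v
    have h1 := congrArg Multiset.card (hrep.entriesFor_eq hl v)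
    rw [Multiset.coe_card, Multiset.card_map] at h1
    rw [h1]
    exact F.card_labels_le _ v
  have hdep : ∀ v : Fin n, s2.na aDepth v = F.level v := fun v => by rw [hmD2]; exact hin.depth v
  refine wp_conseq (emit_spec (D := D) (n := n) (size := s2.na aDepth)
    (off := fun v => ∑ i ∈ Finset.range v, s2.na aDepth i) ?_ (by omega) (by omega) hitem
    ?_ ?_ ?_) ?_
  · rw [hlog3, hst]; simp
  · intro v hv
    rw [hdep ⟨v, hv⟩]
    exact hlen ⟨v, hv⟩
  · have hlt : ∀ u v, u < v → ∑ i ∈ Finset.range u, s2.na aDepth i + s2.na aDepth u ≤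
        ∑ i ∈ Finset.range v, s2.na aDepth i := by
      intro u v huv
      rw [← Finset.sum_range_succ]
      exact Finset.sum_le_sum_of_subset (Finset.range_mono huv)
    intro u _ v _ huv
    rcases Nat.lt_or_gt_of_ne huv with h | h
    · exact .inl (hlt u v h)
    · exact .inr (hlt v u h)
  · intro v hv
    rw [(hres v hv).2, (hres v hv).1]
  rintro s4 c4 hfr4 ⟨hem, hc4⟩
  have hna4 : ∀ x, x ≠ hub → x ≠ hi → s4.na x = s3.na x := fun x h1 h2 =>
    hfr4.na x (by simp [emit, Prog.naWrites, h1, h2])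
  have hnv4 : ∀ x, x ≠ iI → x ≠ iV → s4.nv x = s3.nv x := fun x h1 h2 =>
    hfr4.nv x (by simp [emit, Prog.nvWrites, h1, h2])
  refine ⟨?_, ⟨?_, ?_, ?_⟩, ?_⟩
  · intro v
    obtain ⟨h1, h2⟩ := hem v v.2
    rw [← hrep.entriesFor_eq hl v, ← hD, ← h2, hna4 lo (by omega) (by omega), (hres v v.2).1, h1,
      List.Ico, Nat.add_sub_cancel_left]
  · rw [hnv4 _ (by decide) (by decide), hnv3 _ (by decide) (by decide) (by decide)]; exact hp2
  · rw [hna4 _ (by omega) (by omega), hna3 _ (by omega) (by omega)]; exact hz2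
  · rw [hna4 _ (by omega) (by omega), hna3 _ (by omega) (by omega),
      hnv4 _ (by decide) (by decide), hnv3 _ (by decide) (by decide) (by decide)]
    exact hn2
  · set W := k * (n * (B + 1) + m) with hW
    have hlenk : ∀ v ∈ Finset.range n, (entriesFor D v).length ≤ k := fun v hv =>
      (hlen ⟨v, Finset.mem_range.1 hv⟩).trans (hk _)
    have hk1 : n ≠ 0 → 1 ≤ k := fun hn0 =>
      (F.level_pos ⟨0, Nat.pos_of_ne_zero hn0⟩).trans (hk _)
    -- The costs without a factor `k` are absorbed because `k ≥ 1` unless there are no vertices, and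
    -- then there are no edges.
    have hkn : n * (B + 1) + m ≤ W := by
      by_cases hn0 : n = 0
      · have : m = 0 := by have := G.edges_le_sq; subst hn0; omega
        simp [hn0, this]
      · exact Nat.le_mul_of_pos_left _ (hk1 hn0)
    have hsum : ∑ h ∈ Finset.range n, searchCost g B ((l h).map Prod.fst) ≤
        k * (80 * (B + 1) * n + 111 * m) := by
      have h1 := sum_logFor n l fun u => 80 * (B + 1) + 111 * (g.adj u).length
      simp only [searchCost]
      -- From here the sum runs over settled vertices, each with at most `k` log entries, instead of
      -- over sources.
      rw [← h1, ← hD, sum_map_item hitem fun u => 80 * (B + 1) + 111 * (g.adj u).length]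
      calc ∑ v ∈ Finset.range n, (entriesFor D v).length * (80 * (B + 1) + 111 * (g.adj v).length)
          ≤ ∑ v ∈ Finset.range n, k * (80 * (B + 1) + 111 * (g.adj v).length) :=
            Finset.sum_le_sum fun v hv => Nat.mul_le_mul_right _ (hlenk v hv)
        _ = k * ∑ v ∈ Finset.range n, (80 * (B + 1) + 111 * (g.adj v).length) := by
            rw [Finset.mul_sum]
        _ ≤ _ := by
            refine Nat.mul_le_mul_left _ ?_
            have h2 := hM (List.range n) List.nodup_range fun u hu => by
              rw [hrep.size]; exact List.mem_range.1 hu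
            have h3 : ∑ v ∈ Finset.range n, (g.adj v).length =
                ((List.range n).map fun u => (g.adj u).length).sum := rfl
            rw [Finset.sum_add_distrib, Finset.sum_const, ← Finset.mul_sum, h3, Finset.card_range,
              smul_eq_mul, mul_comm n]
            omega
    have hDlen : D.length ≤ k * n := by
      have h1 := sum_map_item hitem fun _ => 1
      simp at h1
      rw [h1]
      have h2 := Finset.sum_le_card_nsmul _ _ k hlenk
      rw [Finset.card_range, smul_eq_mul, mul_comm] at h2
      exact h2
    have hdsum : ∑ v ∈ Finset.range n, (3 * s2.na aDepth v + 6) ≤ n * (3 * k + 6) := by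
      have h2 := Finset.sum_le_card_nsmul (Finset.range n) (fun v => 3 * s2.na aDepth v + 6)
        (3 * k + 6) fun v hv => by
          have := hk ⟨v, Finset.mem_range.1 hv⟩
          rw [← hdep] at this
          simp only at this ⊢
          omega
      rwa [Finset.card_range, smul_eq_mul] at h2
    rw [Finset.sum_add_distrib, Finset.sum_const, Finset.card_range, smul_eq_mul] at hc2
    have e1 : W = k * n * B + k * n + k * m := by rw [hW]; ring
    have e2 : n * (B + 1) = n * B + n := by ring
    have e3 : k * (80 * (B + 1) * n + 111 * m) = 80 * (k * n * B) + 80 * (k * n) +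
      111 * (k * m) := by ring
    have e4 : n * (40 * B + 112) = 40 * (n * B) + 112 * n := by ring
    have e5 : n * (3 * k + 6) = 3 * (k * n) + 6 * n := by ring
    generalize hx1 : k * n * B = x1 at *
    generalize hx2 : k * n = x2 at *
    generalize hx3 : k * m = x3 at *
    generalize hx4 : n * B = x4 at *
    omega

/-- The algorithm. -/
def twoHopProg : Prog := depths ;; phase 1 2 6 7 8 2 ;; phase 2 1 3 4 5 1

theorem extend_val {n : ℕ} {α : Type} (z : α) (f : Fin n → α) (i : Fin n) :
    extend z f i = f i := by
  simp [extend]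

/-- The constant 809 is twice the 400 of a phase plus 9 for computing the depths, using `n ≤ F.depth
* n`. -/
theorem twoHopProg_spec {n m B : ℕ} (G : WDigraph n m) (F : ElimForest G)
    (hB : ∀ r, 2 ^ (r / 2) ≤ m + 1 → r < B) :
    wp twoHopProg (fun s c =>
      Stores s 3 4 5 1 (F.labels fun h u => G.distIn (F.subtree h) u h) ∧
      Stores s 6 7 8 2 (F.labels fun h u => G.distIn (F.subtree h) h u) ∧
      c ≤ 809 * (F.depth * (n * (B + 1) + m)) + 50) (input G F) 0 := by
  have hpar : ∀ v : Fin n, (input G F).na aParent v = ((F.parent v).map Fin.val).getD n := fun v =>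
    extend_val 0 (fun v => ((F.parent v).map Fin.val).getD n) v
  set dep : ℕ → ℕ := fun v => if h : v < n then F.level ⟨v, h⟩ else 0 with hdep
  have hdv : ∀ v : Fin n, dep v = F.level v := fun v => by simp [hdep]
  simp only [twoHopProg, wp_seq]
  refine wp_conseq (depths_spec (n := n) (dep := dep) (by simp [input]) (by simp [hdep]) ?_) ?_
  · intro v hv
    have h1 := hpar ⟨v, hv⟩
    simp only at h1
    rw [h1, show dep v = F.level ⟨v, hv⟩ from hdv ⟨v, hv⟩]
    cases hp : F.parent ⟨v, hv⟩ with
    | none => simp [ElimForest.level_of_root hp, hdep]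
    | some p => simp [ElimForest.level_of_parent hp, hdv, p.2.le]
  rintro s1 c1 hfr1 ⟨hd1, hc1⟩
  have hna : ∀ a, a ≠ aDepth → s1.na a = (input G F).na a := fun a ha =>
    hfr1.na a (by simp [depths, Prog.naWrites, ha])
  have hra : s1.ra = (input G F).ra := funext fun a =>
    hfr1.ra a (by simp [depths, Prog.raWrites])
  have hin1 : PhaseInput s1 G F 1 2 := by
    refine ⟨?_, ?_, fun e => ?_, fun e => ?_, fun e => ?_, fun v => ?_⟩
    · rw [hfr1.nv iN (by decide)]; simp [input]
    · rw [hfr1.nv iM (by decide)]; simp [input]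
    · rw [hna 1 (by decide)]
      exact extend_val 0 (fun e => (G.src e : ℕ)) e
    · rw [hna 2 (by decide)]
      exact extend_val 0 (fun e => (G.dst e : ℕ)) e
    · rw [hra]
      exact extend_val 0 G.weight e
    · rw [hd1 v v.2, hdv]
  have hcl1 : Clean s1 := by
    refine ⟨?_, fun i => ?_, fun v => ?_⟩
    · rw [hfr1.nv iPend (by decide)]; simp [input]
    · rw [hna aSlot (by decide)]; simp [input]
    · rw [hna aNode (by decide)]; simp [input]
  have hk : ∀ v, F.level v ≤ F.depth := F.level_le_depth
  rw [wp_seq]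
  refine wp_conseq (phase_spec (k := F.depth) hin1 hcl1 hB hk (.inl ⟨rfl, rfl⟩)
    (.inr ⟨rfl, rfl, rfl, rfl⟩)) ?_
  rintro s2 c2 hfr2 ⟨hst2, hcl2, hc2⟩
  -- Exchanging the arrays of tails and heads presents the reversed graph, whose searches give
  -- distances towards the hubs. The log and the node counter simply continue.
  have hin2 : PhaseInput s2 G.rev F.rev 2 1 := by
    refine ⟨?_, ?_, fun e => ?_, fun e => ?_, fun e => ?_, fun v => ?_⟩
    · rw [hfr2.nv iN (by decide)]; exact hin1.size
    · rw [hfr2.nv iM (by decide)]; exact hin1.edges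
    · rw [hfr2.na 2 (by decide)]; exact hin1.dst e
    · rw [hfr2.na 1 (by decide)]; exact hin1.src e
    · rw [hfr2.ra rWeight (by decide)]; exact hin1.weight e
    · rw [hfr2.na aDepth (by decide)]; exact hin1.depth v
  refine wp_conseq (phase_spec (k := F.depth) hin2 hcl2 hB hk (.inr ⟨rfl, rfl⟩)
    (.inl ⟨rfl, rfl, rfl, rfl⟩)) ?_
  rintro s3 c3 hfr3 ⟨hst3, -, hc3⟩
  refine ⟨?_, ?_, ?_⟩
  · have e : (F.rev.labels fun h u => G.rev.distIn (F.rev.subtree h) h u) =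
        F.labels fun h u => G.distIn (F.subtree h) u h := by
      simp only [WDigraph.rev_distIn]
      rfl
    rw [← e]
    exact hst3
  · intro v
    rw [hfr3.na 6 (by decide), hfr3.na 7 (by decide), hfr3.na 8 (by decide),
      hfr3.ra 2 (by decide)]
    exact hst2 v
  · have hdsum : ∑ v ∈ Finset.range n, (3 * dep v + 6) ≤ n * (3 * F.depth + 6) := by
      have h2 := Finset.sum_le_card_nsmul (Finset.range n) (fun v => 3 * dep v + 6)
        (3 * F.depth + 6) fun v hv => by
          have := hk ⟨v, Finset.mem_range.1 hv⟩
          rw [← hdv] at this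
          simp only at this ⊢
          omega
      rwa [Finset.card_range, smul_eq_mul] at h2
    have hkn : n ≤ F.depth * n := by
      by_cases hn0 : n = 0
      · simp [hn0]
      · exact Nat.le_mul_of_pos_left _
          ((F.level_pos ⟨0, Nat.pos_of_ne_zero hn0⟩).trans (hk _))
    have e1 : F.depth * (n * (B + 1) + m) = F.depth * n * B + F.depth * n + F.depth * m := by ring
    have e2 : n * (3 * F.depth + 6) = 3 * (F.depth * n) + 6 * n := by ring
    omega

/-! ### The rank bound and the running time in terms of logarithms -/

theorem lt_of_pow_half_le {m r : ℕ} (h : 2 ^ (r / 2) ≤ m + 1) : r < 2 * Nat.log 2 (m + 1) + 2 := by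
  have := Nat.le_log_of_pow_le (by norm_num) h
  omega

theorem ElimForest.depth_le {n m : ℕ} {G : WDigraph n m} (F : ElimForest G) : F.depth ≤ n :=
  Finset.sup_le fun v _ => (Set.ncard_le_card _).trans (by simp)

/-- The bound for the running time in terms of the real logarithm. -/
theorem time_bound {n m k t : ℕ} (hm : m ≤ n * n) (hk : k ≤ n)
    (ht : t ≤ 809 * (k * (n * (2 * Nat.log 2 (m + 1) + 2 + 1) + m)) + 50) :
    (t : ℝ) ≤ 20000 * ((k : ℝ) * ((m : ℝ) + (n : ℝ) * Real.log (n : ℝ)) + 1) := by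
  have ht' : (t : ℝ) ≤ 809 * (k * (n * (2 * (Nat.log 2 (m + 1) : ℕ) + 2 + 1) + m)) + 50 := by
    exact_mod_cast ht
  have hlog0 : 0 ≤ Real.log n := Real.log_natCast_nonneg n
  rcases Nat.lt_or_ge n 2 with hn | hn
  -- For `n < 2` the logarithm vanishes, and the summand `+ 1` in the bound absorbs the constant.
  · have hm1 : m ≤ 1 := by interval_cases n <;> omega
    have hl : Nat.log 2 (m + 1) ≤ 1 := by
      refine (Nat.log_mono_right (show m + 1 ≤ 2 by omega)).trans ?_
      exact Nat.lt_succ_iff.1 (Nat.log_lt_of_lt_pow (by norm_num) (by norm_num))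
    have h1 : t ≤ 20000 := by
      refine ht.trans ?_
      have h2 : n * (2 * Nat.log 2 (m + 1) + 2 + 1) ≤ 1 * 5 := Nat.mul_le_mul (by omega) (by omega)
      have h3 : k * (n * (2 * Nat.log 2 (m + 1) + 2 + 1) + m) ≤ 1 * 6 :=
        Nat.mul_le_mul (by omega) (by omega)
      omega
    have h2 : (t : ℝ) ≤ 20000 := by exact_mod_cast h1
    have h3 : 0 ≤ (k : ℝ) * ((m : ℝ) + (n : ℝ) * Real.log (n : ℝ)) := by positivity
    linarith
  · have hlog2 : Real.log 2 ≤ Real.log n :=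
      Real.log_le_log (by norm_num) (by exact_mod_cast hn)
    have hl2 : (0.69 : ℝ) < Real.log 2 := by linarith [Real.log_two_gt_d9]
    have h1 : (Nat.log 2 (m + 1) : ℝ) * Real.log 2 ≤ 3 * Real.log n := by
      -- A simple digraph has `m + 1 ≤ n ^ 2 + 1 ≤ n ^ 3` for `n ≥ 2`, so logarithms of `m + 1` are
      -- of order `log n`.
      have h2 : 2 ^ Nat.log 2 (m + 1) ≤ n ^ 3 := by
        refine (Nat.pow_log_le_self 2 (by omega)).trans ?_
        have : n * n * 2 ≤ n * n * n := Nat.mul_le_mul_left _ hn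
        have h4 : 2 * 2 ≤ n * n := Nat.mul_le_mul hn hn
        have : n ^ 3 = n * n * n := by ring
        omega
      have h3 : ((2 : ℝ) ^ Nat.log 2 (m + 1)) ≤ (n : ℝ) ^ 3 := by exact_mod_cast h2
      have h4 := Real.log_le_log (by positivity) h3
      rw [Real.log_pow, Real.log_pow] at h4
      exact_mod_cast h4
    -- With `log 2 > 0.69` the first summand is below `9 * log n` and the constant 3 below `5 * log
    -- n`; finally `809 * 15 < 20000`.
    have h5 : (2 * (Nat.log 2 (m + 1) : ℝ) + 2 + 1) ≤ 15 * Real.log n := by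
      have : (0 : ℝ) ≤ Nat.log 2 (m + 1) := Nat.cast_nonneg _
      nlinarith
    have h6 : (n : ℝ) * (2 * (Nat.log 2 (m + 1) : ℝ) + 2 + 1) ≤ n * (15 * Real.log n) :=
      mul_le_mul_of_nonneg_left h5 (Nat.cast_nonneg _)
    have h7 : (k : ℝ) * (n * (2 * (Nat.log 2 (m + 1) : ℝ) + 2 + 1) + m) ≤
        k * (15 * (m + n * Real.log n)) := by
      refine mul_le_mul_of_nonneg_left ?_ (Nat.cast_nonneg _)
      have : (0 : ℝ) ≤ m := Nat.cast_nonneg _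
      linarith
    have h8 : 0 ≤ (k : ℝ) * ((m : ℝ) + (n : ℝ) * Real.log (n : ℝ)) := by positivity
    linarith

end TwoHop

theorem theorem8 :
    ∃ (P : TwoHop.Prog) (C : ℝ),
      ∀ (n m : ℕ) (G : TwoHop.WDigraph n m) (F : TwoHop.ElimForest G),
        ∃ (s : TwoHop.State) (t : ℕ) (Lout Lin : Fin n → Finset (Fin n × ℝ≥0)),
          TwoHop.Runs P (TwoHop.input G F) s t ∧
          (t : ℝ) ≤ C * ((F.depth : ℝ) * ((m : ℝ) + (n : ℝ) * Real.log (n : ℝ)) + 1) ∧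
          TwoHop.Stores s 3 4 5 1 Lout ∧
          TwoHop.Stores s 6 7 8 2 Lin ∧
          TwoHop.IsTwoHopCover G Lout Lin ∧
          TwoHop.maxLabelSize Lout Lin ≤ 2 * F.depth ∧
          (∀ (u h : Fin n) (d : ℝ≥0), (h, d) ∈ Lout u ↔
            h ∈ F.rootPath u ∧ G.distIn (F.subtree h) u h = (d : ℝ≥0∞)) ∧
          (∀ (u h : Fin n) (d : ℝ≥0), (h, d) ∈ Lin u ↔
            h ∈ F.rootPath u ∧ G.distIn (F.subtree h) h u = (d : ℝ≥0∞)) := by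
  refine ⟨TwoHop.twoHopProg, 20000, fun n m G F => ?_⟩
  obtain ⟨s, t, hrun, hout, hin, ht⟩ :=
    TwoHop.twoHopProg_spec G F fun r hr => TwoHop.lt_of_pow_half_le hr
  rw [zero_add] at ht
  refine ⟨s, t, _, _, hrun, TwoHop.time_bound G.edges_le_sq F.depth_le ht, hout, hin,
    F.isTwoHopCover_labels, ?_, fun u h d => TwoHop.ElimForest.mem_labels,
    fun u h d => TwoHop.ElimForest.mem_labels⟩
  refine Finset.sup_le fun u _ => ?_
  have h1 := F.level_le_depth u
  have h2 := F.card_labels_le (fun h u => G.distIn (F.subtree h) u h) u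
  have h3 := F.card_labels_le (fun h u => G.distIn (F.subtree h) h u) u
  omega
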